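/- Let $\sigma>0$ and, for every $N\ge 1$, let $M_N=\frac1{\sqrt N}W_N+A_N$, where $A_N$ is the $N\times N$ matrix all of whose entries equal $\theta/N$, $\theta>0$ does not depend on $N$, and $W_N=(W_{i,j})_{1\le i,j\le N}$ is a random matrix of one of the following two kinds (the same kind for all $N$). - Complex case: $W_N$ is Hermitian; the real random variables $W_{i,i}$ ($1\le i\le N$), $\operatorname{Re}W_{i,j}$, $\operatorname{Im}W_{i,j}$ ($1\le i<j\le N$) are independent and have symmetric laws; $\mathbb E[(\operatorname{Re}W_{i,j})^2]=\mathbb E[(\operatorname{Im}W_{i,j})^2]=\sigma^2/2$ for $i<j$; the second moments $\mathbb E[W_{i,i}^2]$ are bounded uniformly in $i$ and $N$; and there is a constant $\beta>0$ such that $\mathbb E[(\operatorname{Re}W_{i,j})^{2k}]\le(\beta k)^k$ and $\mathbb E[(\operatorname{Im}W_{i,j})^{2k}]\le(\beta k)^k$ for all $i,j$, all $k\ge1$ and all $N$. - Real case: $W_N$ is real symmetric; the $W_{i,j}$ ($1\le i\le j\le N$) are independent and have symmetric laws; $\mathbb E[W_{i,j}^2]=\sigma^2$ for $i<j$; the second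 moments $\mathbb E[W_{i,i}^2]$ are bounded uniformly in $i$ and $N$; and there is a constant $\beta>0$ such that $\mathbb E[W_{i,j}^{2k}]\le(\beta k)^k$ for all $i,j$, all $k\ge1$ and all $N$. For $L\ge 1$, expand $$\mathbb E[\operatorname{tr}M_N^{L}]=\sum_{\mathcal P}\mathbb E[M_{i_0,i_1}M_{i_1,i_2}\cdots M_{i_{L-1},i_0}]$$ as a sum over the closed paths $\mathcal P=(i_0,i_1,\dots,i_{L-1},i_L=i_0)$ with vertices in $\{1,\dots,N\}$ (loops $i_{j}=i_{j-1}$ are allowed). The contribution of a set of closed paths is the corresponding partial sum. An instant $j\in\{1,\dots,L\}$ is marked for $\mathcal P$ if the unordered edge $\{i_{j-1},i_j\}$ occurs an odd number of times among the edges $\{i_{t-1},i_t\}$, $1\le t\le j$. The path $\mathcal P$ has a marked origin if $i_j=i_0$ for some marked instant $j$, and it is simple if there are no two distinct marked instants $j\ne j'$ with $i_j=i_{j'}$. Assume $\theta>\sigma$, put $\rho_\theta=\theta+\sigma^2/\theta$, and let $(s_N)$ be a sequence of positive integers with $s_N\to\infty$ and $s_N/\sqrt N\to0$ as $N\to\infty$.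 Let $L_N\in\{2s_N,\,2s_N+1\}$ for every $N$. Then, as $N\to\infty$, the contribution to $\mathbb E[\operatorname{tr}M_N^{L_N}]$ of all closed paths of length $L_N$ with a marked origin equals $$\rho_\theta^{L_N}\Bigl(1-\frac{\sigma^2}{\theta^2}\Bigr)(1+o(1)).$$ The dominant such paths are the simple ones: the contribution of the simple paths with a marked origin is also $\rho_\theta^{L_N}\bigl(1-\frac{\sigma^2}{\theta^2}\bigr)(1+o(1))$, and the contribution of the non-simple paths with a marked origin is $o(\rho_\theta^{L_N})$. -/

import Mathlib

open MeasureTheory ProbabilityTheory Filter Topology Asymptotics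

namespace DeformedWigner

/-- Index pairs `(i, j)` with `i < j`. -/
abbrev UpperPair (N : ℕ) : Type := {q : Fin N × Fin N // q.1 < q.2}

/-- Index pairs `(i, j)` with `i ≤ j`. -/
abbrev WeakUpperPair (N : ℕ) : Type := {q : Fin N × Fin N // q.1 ≤ q.2}

/-- The real coordinates of a random Hermitian matrix: the diagonal entries, then the real parts
and the imaginary parts of the entries strictly above the diagonal. -/
def hermitianCoord {N : ℕ} {Ω : Type*} (W : Ω → Matrix (Fin N) (Fin N) ℂ) :
    Fin N ⊕ UpperPair N ⊕ UpperPair N → Ω → ℝ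
  | .inl i => fun ω => (W ω i i).re
  | .inr (.inl q) => fun ω => (W ω q.1.1 q.1.2).re
  | .inr (.inr q) => fun ω => (W ω q.1.1 q.1.2).im

/-- A random Hermitian `N × N` matrix whose real coordinates are independent with symmetric laws,
with off-diagonal variances `σ² / 2` for real and imaginary parts, diagonal second moments bounded
by `K`, and sub-Gaussian moments with constant `β`. -/
structure IsComplexWigner {N : ℕ} {Ω : Type*} [MeasurableSpace Ω] (σ K β : ℝ)
    (P : Measure Ω) (W : Ω → Matrix (Fin N) (Fin N) ℂ) : Prop where
  measurable : ∀ i j, Measurable fun ω => W ω i j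
  hermitian : ∀ ω, (W ω).IsHermitian
  indep : iIndepFun (hermitianCoord W) P
  symm : ∀ c, IdentDistrib (hermitianCoord W c) (fun ω => -hermitianCoord W c ω) P P
  var_re : ∀ i j, i < j → ∫ ω, (W ω i j).re ^ 2 ∂P = σ ^ 2 / 2
  var_im : ∀ i j, i < j → ∫ ω, (W ω i j).im ^ 2 ∂P = σ ^ 2 / 2
  var_diag : ∀ i, ∫ ω, (W ω i i).re ^ 2 ∂P ≤ K
  integrable_re : ∀ i j (k : ℕ), 1 ≤ k → Integrable (fun ω => (W ω i j).re ^ (2 * k)) P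
  integrable_im : ∀ i j (k : ℕ), 1 ≤ k → Integrable (fun ω => (W ω i j).im ^ (2 * k)) P
  moment_re : ∀ i j (k : ℕ), 1 ≤ k → ∫ ω, (W ω i j).re ^ (2 * k) ∂P ≤ (β * k) ^ k
  moment_im : ∀ i j (k : ℕ), 1 ≤ k → ∫ ω, (W ω i j).im ^ (2 * k) ∂P ≤ (β * k) ^ k

/-- A random real symmetric `N × N` matrix (viewed with complex entries of zero imaginary part)
whose entries on and above the diagonal are independent with symmetric laws, with off-diagonal
variances `σ²`, diagonal second moments bounded by `K`, and sub-Gaussian moments with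
constant `β`. -/
structure IsRealWigner {N : ℕ} {Ω : Type*} [MeasurableSpace Ω] (σ K β : ℝ)
    (P : Measure Ω) (W : Ω → Matrix (Fin N) (Fin N) ℂ) : Prop where
  measurable : ∀ i j, Measurable fun ω => W ω i j
  real : ∀ ω i j, (W ω i j).im = 0
  symmetric : ∀ ω, (W ω).IsSymm
  indep : iIndepFun (fun (q : WeakUpperPair N) ω => (W ω q.1.1 q.1.2).re) P
  symm : ∀ i j, IdentDistrib (fun ω => (W ω i j).re) (fun ω => -(W ω i j).re) P P
  var : ∀ i j, i < j → ∫ ω, (W ω i j).re ^ 2 ∂P = σ ^ 2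
  var_diag : ∀ i, ∫ ω, (W ω i i).re ^ 2 ∂P ≤ K
  integrable : ∀ i j (k : ℕ), 1 ≤ k → Integrable (fun ω => (W ω i j).re ^ (2 * k)) P
  moment : ∀ i j (k : ℕ), 1 ≤ k → ∫ ω, (W ω i j).re ^ (2 * k) ∂P ≤ (β * k) ^ k

/-- A sequence of complex Wigner matrices, one for each size, with moment bounds that are uniform
in the size. -/
def IsComplexWignerEnsemble {Ω : ℕ → Type*} [∀ N, MeasurableSpace (Ω N)] (σ : ℝ)
    (P : ∀ N, Measure (Ω N)) (W : ∀ N, Ω N → Matrix (Fin N) (Fin N) ℂ) : Prop :=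
  ∃ K β : ℝ, 0 < β ∧ ∀ N, IsComplexWigner σ K β (P N) (W N)

/-- A sequence of real Wigner matrices, one for each size, with moment bounds that are uniform
in the size. -/
def IsRealWignerEnsemble {Ω : ℕ → Type*} [∀ N, MeasurableSpace (Ω N)] (σ : ℝ)
    (P : ∀ N, Measure (Ω N)) (W : ∀ N, Ω N → Matrix (Fin N) (Fin N) ℂ) : Prop :=
  ∃ K β : ℝ, 0 < β ∧ ∀ N, IsRealWigner σ K β (P N) (W N)

/-- The deformed matrix `M = W / √N + A`, where all entries of `A` equal `θ / N`. -/
noncomputable def deformed {N : ℕ} (θ : ℝ) (W : Matrix (Fin N) (Fin N) ℂ) :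
    Matrix (Fin N) (Fin N) ℂ :=
  Matrix.of fun i j => W i j / ((√(N : ℝ) : ℝ) : ℂ) + (θ : ℂ) / (N : ℂ)

/-- Closed paths `i₀, i₁, …, i_L = i₀` of length `L` on `N` vertices; loops are allowed. -/
abbrev ClosedPath (N L : ℕ) : Type := {i : Fin (L + 1) → Fin N // i (Fin.last L) = i 0}

/-- The unordered edge read by the step from `i_t` to `i_{t+1}`, `0 ≤ t < L`. -/
def ClosedPath.edge {N L : ℕ} (p : ClosedPath N L) (t : Fin L) : Sym2 (Fin N) :=
  s(p.1 t.castSucc, p.1 t.succ)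

/-- The instant `t + 1`, `0 ≤ t < L`, is marked: the edge read at this instant has occurred an odd
number of times up to and including this instant. -/
def ClosedPath.Marked {N L : ℕ} (p : ClosedPath N L) (t : Fin L) : Prop :=
  Odd (Finset.univ.filter fun u : Fin L => u ≤ t ∧ p.edge u = p.edge t).card

/-- The origin occurs at some marked instant. -/
def ClosedPath.MarkedOrigin {N L : ℕ} (p : ClosedPath N L) : Prop :=
  ∃ t : Fin L, p.Marked t ∧ p.1 t.succ = p.1 0

/-- The path has no self-intersection: no vertex occurs at two distinct marked instants. -/
def ClosedPath.IsSimple {N L : ℕ} (p : ClosedPath N L) : Prop :=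
  ∀ t u : Fin L, p.Marked t → p.Marked u → p.1 t.succ = p.1 u.succ → t = u

open Classical in
/-- The contribution to `𝔼[tr M ^ L]` of the closed paths of length `L` satisfying `A`: the sum of
`𝔼[M_{i₀ i₁} M_{i₁ i₂} ⋯ M_{i_{L-1} i_L}]` over these paths. -/
noncomputable def contribution {N : ℕ} {Ω : Type*} [MeasurableSpace Ω] (P : Measure Ω)
    (M : Ω → Matrix (Fin N) (Fin N) ℂ) (L : ℕ) (A : ClosedPath N L → Prop) : ℂ :=
  ∑ p : ClosedPath N L with A p, ∫ ω, ∏ t : Fin L, M ω (p.1 t.castSucc) (p.1 t.succ) ∂P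

/-- `ρ_θ = θ + σ² / θ`. -/
noncomputable def rho (θ σ : ℝ) : ℝ := θ + σ ^ 2 / θ

end DeformedWigner

/-! Since `M_ij = W_ij / √N + θ / N`, a closed path expands into walks whose steps are matrix steps
or jumps. Along the matrix steps an odd traversal of an edge opens it and an even one closes it. The
laws are symmetric, so only walks that leave no edge open have a nonzero expectation. Such a walk
pays `1/N` times a moment factor per opening, nothing per closing and `θ/N` per jump.

Call a step regular if it closes an edge, opens an edge towards a new vertex, or jumps to a new
vertex from a vertex of even degree in the graph of open edges. If all steps are regular, the open
edges form a path with the current vertex at its end, jumps occur only when that path is trivial,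
and every matrix edge of a closed walk is crossed once in each direction. The expectation is then
exactly a power of `σ` (`WignerLike.walkExpect_eq_listWeight`). The number of open edges traces a
nonnegative word with up steps of weight `σ²`, down steps of weight 1 and level steps at height 0 of
weight `θ`, up to the small loss in the number of new vertices. These words are counted by `ballot`.

The constant comes from a rotation. Cut the closed path at its last jump, drop that jump, and read
on from its landing vertex `x`. This gives a walk of length `L - 1` from `x` whose first `j` steps
are matrix steps leading to the old origin. Apart from walks with exactly one remaining jump, a
closed regular walk comes from a path with a marked origin iff its first `j` steps already form a
closed walk, and the path is then simple (`reachesMarked_rotate`, `simpleSteps_rotate`,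
`not_reachesMarked_rotate`). The sum over `j` is the decomposition of ballot words of length `L` by
their last level step (`ballot_last_level`). Hence the main term is the count of all ballot words
minus those without level step. The reflection principle evaluates it as `(1 - σ²/θ²) ρ^L` up to
`O((2σ)^L)` (`ballot_asymptotic`), and `2σ < ρ`.

The other walks are negligible. Irregular walks are dominated by a potential
(`WalkState.irregularSum_le`). It combines the ballot count of the continuation, a product of odd
double factorials of vertex credits which pays for the choice of the edge to close, a factor
`N^(-1/2)` for each pair of vertices of wrong parity, and a factor for the number of irregular
steps. An irregular step costs `O(L/N)`, or `O(1/√N)` when it disturbs or repairs parities by a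
jump, so the relative error is `O(L²/N + L/√N)`. Walks with one remaining jump are compared with a
smaller parameter `θ'` between `σ` and `θ`, which gives `L ρ_θ'^L`. Paths without jumps have a
marked origin only if they are irregular, and those total `O(L² (2σ)^L)`.

The three assertions are treated together, through a class of paths with a marked origin that
contains either all of the simple ones or none (`tendsto_contribution_sub`). -/

namespace DeformedWigner

/-! ### Ballot words with level steps at height zero. -/

/-- Weighted count of the words of length `n` in up steps (weight `σ²`), down steps (weight `1`) and
level steps at height `0` (weight `θ`, excluded from the first `j` letters), which start at height
`h`, stay nonnegative and end at height `0`. -/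
noncomputable def ballot (σ θ : ℝ) : ℕ → ℕ → ℕ → ℝ
  | 0, _, h => if h = 0 then 1 else 0
  | n + 1, j, 0 => σ ^ 2 * ballot σ θ n (j - 1) 1 + if j = 0 then θ * ballot σ θ n 0 0 else 0
  | n + 1, j, h + 1 => σ ^ 2 * ballot σ θ n (j - 1) (h + 2) + ballot σ θ n (j - 1) h

variable {σ θ : ℝ}

theorem ballot_nonneg (hθ : 0 ≤ θ) (n j h : ℕ) : 0 ≤ ballot σ θ n j h := by
  induction n generalizing j h with
  | zero => simp only [ballot]; split_ifs <;> norm_num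
  | succ n ih =>
    cases h with
    | zero =>
      have h1 := ih (j - 1) 1
      have h2 := ih 0 0
      simp only [ballot]
      split_ifs <;> positivity
    | succ h =>
      have h1 := ih (j - 1) (h + 2)
      have h2 := ih (j - 1) h
      simp only [ballot]
      positivity

/-- Both sides satisfy the same recursion above height 0, and at height 0 the level step of the
right side replaces the down step of the left side. The bound lets a jump at positive height be
charged to a part of the down steps. -/
theorem ballot_shift (n h : ℕ) :
    θ * ballot σ θ n 0 (h + 1) ≤ ballot σ θ n 0 h := by
  induction n generalizing h with
  | zero => simp only [ballot]; split_ifs <;> simp_all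
  | succ n ih =>
    cases h with
    | zero =>
      have h1 := ih 1
      simp only [ballot, if_true, Nat.zero_sub, zero_add]
      nlinarith [mul_le_mul_of_nonneg_left h1 (sq_nonneg σ)]
    | succ h =>
      have h1 := ih (h + 2)
      have h2 := ih h
      simp only [ballot, Nat.zero_sub]
      nlinarith [mul_le_mul_of_nonneg_left h1 (sq_nonneg σ)]

/-- Together with `ballot_up` this absorbs the ballot factor after an irregular step, a jump or an
opening, into the one before it. -/
theorem ballot_stay (hθ : 0 ≤ θ) (n h : ℕ) :
    θ * ballot σ θ n 0 h ≤ ballot σ θ (n + 1) 0 h := by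
  cases h with
  | zero =>
    simp only [ballot, if_true, Nat.zero_sub]
    have := ballot_nonneg (σ := σ) hθ n 0 1
    nlinarith [mul_nonneg (sq_nonneg σ) this]
  | succ h =>
    simp only [ballot, Nat.zero_sub]
    have := ballot_nonneg (σ := σ) hθ n 0 (h + 2)
    nlinarith [mul_nonneg (sq_nonneg σ) this, ballot_shift (σ := σ) (θ := θ) n h]

theorem ballot_up (hθ : 0 ≤ θ) (n j h : ℕ) :
    σ ^ 2 * ballot σ θ n (j - 1) (h + 1) ≤ ballot σ θ (n + 1) j h := by
  cases h with
  | zero =>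
    simp only [ballot, zero_add]
    have := mul_nonneg hθ (ballot_nonneg (σ := σ) hθ n 0 0)
    split_ifs <;> linarith
  | succ h =>
    simp only [ballot]
    have := ballot_nonneg (σ := σ) hθ n (j - 1) h
    linarith

theorem rho_pos (hσ : 0 < σ) (hθ : 0 < θ) : 0 < rho θ σ := by
  unfold rho; positivity

theorem two_mul_lt_rho (hσ : 0 < σ) (hθ : σ < θ) : 2 * σ < rho θ σ := by
  have h0 : 0 < θ := hσ.trans hθ
  have : rho θ σ - 2 * σ = (θ - σ) ^ 2 / θ := by unfold rho; field_simp; ring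
  have h2 : 0 < (θ - σ) ^ 2 / θ := div_pos (pow_pos (sub_pos.2 hθ) 2) h0
  linarith

/-- The function `θ⁻¹ ^ h` is an exact eigenfunction of the recursion, boundary included, with
eigenvalue `ρ`. -/
theorem ballot_zero_le (hθ : 0 < θ) (n h : ℕ) :
    ballot σ θ n 0 h ≤ rho θ σ ^ n * θ⁻¹ ^ h := by
  have hr : 0 ≤ rho θ σ := by unfold rho; positivity
  induction n generalizing h with
  | zero =>
    simp only [ballot]; split_ifs with h0
    · simp [h0]
    · positivity
  | succ n ih =>
    cases h with
    | zero =>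
      simp only [ballot, if_true, Nat.zero_sub]
      calc _ ≤ σ ^ 2 * (rho θ σ ^ n * θ⁻¹ ^ 1) + θ * (rho θ σ ^ n * θ⁻¹ ^ 0) := by
            gcongr <;> apply ih
        _ = _ := by rw [pow_succ (rho θ σ) n]; generalize rho θ σ ^ n = R; rw [rho]; field_simp; ring
    | succ h =>
      simp only [ballot, Nat.zero_sub]
      calc _ ≤ σ ^ 2 * (rho θ σ ^ n * θ⁻¹ ^ (h + 2)) + (rho θ σ ^ n * θ⁻¹ ^ h) := by
            gcongr <;> apply ih
        _ = _ := by
          rw [pow_succ (rho θ σ)]; generalize rho θ σ ^ n = R; rw [rho]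
          rw [pow_succ θ⁻¹ h, pow_add θ⁻¹ h 2]; field_simp; ring

/-- While level steps are forbidden, `σ⁻¹ ^ h` is a supersolution with eigenvalue `2σ`; afterwards
`ballot_zero_le` applies, and `θ⁻¹ ≤ σ⁻¹`. -/
theorem ballot_le (hσ : 0 < σ) (hθ : σ < θ) (n j h : ℕ) (hj : j ≤ n) :
    ballot σ θ n j h ≤ rho θ σ ^ (n - j) * (2 * σ) ^ j * σ⁻¹ ^ h := by
  have h0 : 0 < θ := hσ.trans hθ
  have hr := rho_pos hσ h0
  induction n generalizing j h with
  | zero =>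
    obtain rfl : j = 0 := by omega
    simp only [ballot]; split_ifs with h0
    · simp [h0]
    · positivity
  | succ n ih =>
    cases j with
    | zero =>
      refine (ballot_zero_le h0 _ _).trans ?_
      simp only [Nat.sub_zero, pow_zero, mul_one]
      gcongr
    | succ j =>
      have hj' : j ≤ n := by omega
      have e : n + 1 - (j + 1) = n - j := by omega
      rw [e]
      cases h with
      | zero =>
        simp only [ballot, Nat.add_sub_cancel]
        rw [if_neg (by omega)]
        calc _ ≤ σ ^ 2 * (rho θ σ ^ (n - j) * (2 * σ) ^ j * σ⁻¹ ^ 1) + 0 := by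
              gcongr; exact ih j 1 hj'
          _ = rho θ σ ^ (n - j) * (2 * σ) ^ j * σ := by field_simp; ring
          _ ≤ rho θ σ ^ (n - j) * (2 * σ) ^ j * (2 * σ) := by gcongr; linarith
          _ = _ := by rw [pow_succ (2 * σ)]; ring
      | succ h =>
        simp only [ballot, Nat.add_sub_cancel]
        calc _ ≤ σ ^ 2 * (rho θ σ ^ (n - j) * (2 * σ) ^ j * σ⁻¹ ^ (h + 2))
              + (rho θ σ ^ (n - j) * (2 * σ) ^ j * σ⁻¹ ^ h) := by
              gcongr
              · exact ih j _ hj'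
              · exact ih j _ hj'
          _ = _ := by
            rw [pow_succ (2 * σ), pow_succ σ⁻¹ h, pow_add σ⁻¹ h 2]; field_simp; ring

/-- Either there is no level step, or the last one is followed by `i` letters without level step
which start and end at height 0. The proof removes the first letter; the term `i = n` of the longer
sum is a word whose first letter is its last level step. -/
theorem ballot_last_level (n h : ℕ) :
    ballot σ θ n 0 h = ballot σ θ n n h +
      ∑ i ∈ Finset.range n, θ * ballot σ θ (n - 1 - i) 0 h * ballot σ θ i i 0 := by
  induction n generalizing h with
  | zero => simp
  | succ n ih =>
    have hs : ∀ i ∈ Finset.range n, n + 1 - 1 - i = (n - 1 - i) + 1 := by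
      intro i hi; rw [Finset.mem_range] at hi; omega
    cases h with
    | zero =>
      rw [Finset.sum_range_succ, Finset.sum_congr rfl fun i hi => by rw [hs i hi]]
      simp only [ballot, if_true, Nat.zero_sub, Nat.add_sub_cancel, Nat.sub_self]
      rw [if_neg (by omega), ih 1]
      nth_rw 1 [ih 0]
      simp only [mul_add, add_mul, Finset.sum_add_distrib, Finset.mul_sum]
      rw [Finset.sum_congr rfl fun i _ => show σ ^ 2 * (θ * ballot σ θ (n - 1 - i) 0 1 *
        ballot σ θ i i 0) = θ * (σ ^ 2 * ballot σ θ (n - 1 - i) 0 1) * ballot σ θ i i 0 by ring,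
        Finset.sum_congr rfl fun i _ => show θ * (θ * ballot σ θ (n - 1 - i) 0 0 *
        ballot σ θ i i 0) = θ * (θ * ballot σ θ (n - 1 - i) 0 0) * ballot σ θ i i 0 by ring]
      ring
    | succ h =>
      rw [Finset.sum_range_succ, Finset.sum_congr rfl fun i hi => by rw [hs i hi]]
      simp only [ballot, Nat.zero_sub, Nat.add_sub_cancel, Nat.sub_self]
      rw [ih (h + 2), ih h, if_neg (by omega)]
      simp only [mul_add, add_mul, Finset.sum_add_distrib, Finset.mul_sum]
      rw [Finset.sum_congr rfl fun i _ => show σ ^ 2 * (θ * ballot σ θ (n - 1 - i) 0 (h + 2) *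
        ballot σ θ i i 0) = θ * (σ ^ 2 * ballot σ θ (n - 1 - i) 0 (h + 2)) * ballot σ θ i i 0
        by ring]
      ring

/-- Binomially weighted sums of the values of `g` along a `±1` walk. -/
noncomputable def walkTransform (σ : ℝ) (g : ℤ → ℝ) (n : ℕ) (h : ℤ) : ℝ :=
  ∑ m ∈ Finset.range (n + 1), (n.choose m : ℝ) * σ ^ (2 * m) * g (n - 2 * m - h)

theorem walkTransform_succ (g : ℤ → ℝ) (n : ℕ) (h : ℤ) :
    walkTransform σ g (n + 1) h
      = walkTransform σ g n (h - 1) + σ ^ 2 * walkTransform σ g n (h + 1) := by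
  unfold walkTransform
  rw [Finset.sum_range_succ']
  simp only [Nat.choose_succ_succ, Nat.cast_add, add_mul, Finset.sum_add_distrib]
  rw [Finset.sum_range_succ (fun k => ((n.choose (k + 1) : ℕ) : ℝ) * _ * _) n,
    Finset.sum_range_succ' (fun m => (n.choose m : ℝ) * σ ^ (2 * m) * g (n - 2 * m - (h - 1))) n]
  rw [Nat.choose_succ_self, Finset.mul_sum]
  have e1 : ∀ k : ℕ, ((n.choose k : ℕ) : ℝ) * σ ^ (2 * (k + 1)) *
      g (((n + 1 : ℕ) : ℤ) - 2 * ((k + 1 : ℕ) : ℤ) - h)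
      = σ ^ 2 * ((n.choose k : ℝ) * σ ^ (2 * k) * g (n - 2 * k - (h + 1))) := by
    intro k
    rw [show (((n + 1 : ℕ) : ℤ) - 2 * ((k + 1 : ℕ) : ℤ) - h) = (n - 2 * k - (h + 1)) by
      push_cast; ring]
    ring
  have e2 : ∀ k : ℕ, ((n.choose (k + 1) : ℕ) : ℝ) * σ ^ (2 * (k + 1)) *
      g (((n + 1 : ℕ) : ℤ) - 2 * ((k + 1 : ℕ) : ℤ) - h)
      = (n.choose (k + 1) : ℝ) * σ ^ (2 * (k + 1)) * g (n - 2 * ((k + 1 : ℕ) : ℤ) - (h - 1)) := by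
    intro k
    rw [show (((n + 1 : ℕ) : ℤ) - 2 * ((k + 1 : ℕ) : ℤ) - h)
      = (n - 2 * ((k + 1 : ℕ) : ℤ) - (h - 1)) by push_cast; ring]
  have e3 : (((n + 1 : ℕ) : ℤ) - 2 * ((0 : ℕ) : ℤ) - h) = n - 2 * ((0 : ℕ) : ℤ) - (h - 1) := by
    push_cast; ring
  have e1' := Finset.sum_congr rfl fun k (_ : k ∈ Finset.range (n + 1)) => e1 k
  have e2' := Finset.sum_congr rfl fun k (_ : k ∈ Finset.range n) => e2 k
  push_cast at e1' e2' e3 ⊢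
  simp only [Nat.choose_zero_right]
  rw [e1', e2', e3]
  simp
  ring

/-- Powers of `θ` truncated to nonnegative exponents. -/
noncomputable def truncPow (θ : ℝ) (z : ℤ) : ℝ := if 0 ≤ z then θ ^ z else 0

theorem truncPow_sub (hθ : θ ≠ 0) (z : ℤ) :
    truncPow θ z - θ * truncPow θ (z - 1) = if z = 0 then 1 else 0 := by
  unfold truncPow
  rcases lt_trichotomy z 0 with h | h | h
  · rw [if_neg (by omega), if_neg (by omega), if_neg (by omega)]; simp
  · subst h; simp
  · rw [if_pos (by omega), if_pos (by omega), if_neg (by omega), zpow_sub_one₀ hθ]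
    field_simp; simp

theorem walkTransform_truncPow_sub (hθ : θ ≠ 0) (n : ℕ) (h : ℤ) :
    walkTransform σ (truncPow θ) n h - θ * walkTransform σ (truncPow θ) n (h + 1)
      = ∑ m ∈ Finset.range (n + 1), (n.choose m : ℝ) * σ ^ (2 * m) *
        if (n : ℤ) - 2 * m = h then 1 else 0 := by
  unfold walkTransform
  rw [Finset.mul_sum, ← Finset.sum_sub_distrib]
  refine Finset.sum_congr rfl fun m _ => ?_
  have := truncPow_sub hθ ((n : ℤ) - 2 * m - h)
  rw [show (n : ℤ) - 2 * m - h - 1 = n - 2 * m - (h + 1) by ring] at this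
  simp only [sub_eq_zero] at this
  rw [← this]
  ring

/-- Each difference counts free walks ending exactly at `-1`, respectively at `1`. Reflection
exchanges them, and the exponent of `σ²` differs by one. -/
theorem walkTransform_truncPow_reflect (hθ : θ ≠ 0) (n : ℕ) :
    walkTransform σ (truncPow θ) n (-1) - θ * walkTransform σ (truncPow θ) n 0
      = σ ^ 2 * (walkTransform σ (truncPow θ) n 1 - θ * walkTransform σ (truncPow θ) n 2) := by
  have h1 := walkTransform_truncPow_sub (σ := σ) hθ n (-1)
  have h2 := walkTransform_truncPow_sub (σ := σ) hθ n 1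
  norm_num at h1 h2
  rw [h1, h2, ← Finset.sum_range_reflect, Finset.mul_sum]
  refine Finset.sum_congr rfl fun m hm => ?_
  rw [Finset.mem_range] at hm
  have hmn : m ≤ n := by omega
  have e : n + 1 - 1 - m = n - m := by omega
  rw [e, Nat.choose_symm hmn]
  push_cast [hmn]
  by_cases h : (n : ℤ) = 1 + 2 * m
  · rw [if_pos (by linarith), if_pos (by linarith), show n - m = m + 1 by omega]; ring
  · rw [if_neg (fun h' => h (by linarith)), if_neg (fun h' => h (by linarith))]; ring

/-- The right side solves the free recursion and has the correct initial values because `truncPow`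
vanishes on negative exponents. The reflection identity is exactly the boundary condition created by
the level step at height 0. -/
theorem ballot_eq_walkTransform (hθ : θ ≠ 0) (n h : ℕ) :
    ballot σ θ n 0 h = walkTransform σ (truncPow θ) n h
      - σ ^ 2 * walkTransform σ (truncPow θ) n (h + 2) := by
  induction n generalizing h with
  | zero =>
    simp only [ballot, walkTransform, truncPow]
    rcases Nat.eq_zero_or_pos h with rfl | h0
    · simp
    · have e2 : ¬ ((h : ℤ) + 2 ≤ 0) := by omega
      simp [h0.ne', e2]
  | succ n ih =>
    rw [walkTransform_succ, walkTransform_succ]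
    cases h with
    | zero =>
      simp only [ballot, Nat.zero_sub, if_true]
      rw [ih 1, ih 0]
      have := walkTransform_truncPow_reflect (σ := σ) hθ n
      norm_num at this ⊢
      linarith
    | succ h =>
      simp only [ballot, Nat.zero_sub]
      rw [ih (h + 2), ih h]
      push_cast
      rw [show (h : ℤ) + 1 - 1 = h by ring, show (h : ℤ) + 1 + 1 = h + 2 by ring,
        show (h : ℤ) + 1 + 2 - 1 = h + 2 by ring, show (h : ℤ) + 1 + 2 + 1 = h + 2 + 2 by ring]
      ring

/-- Without truncation the sum is the binomial expansion of `θ⁻¹ ^ h * ρ ^ n`. The truncated terms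
have negative exponents, so replacing `θ` by `σ` enlarges each of them to `σ ^ n * σ⁻¹ ^ h` times
its binomial coefficient. -/
theorem walkTransform_truncPow_bound (hσ : 0 < σ) (hθ : σ < θ) (n : ℕ) (h : ℕ) :
    |walkTransform σ (truncPow θ) n h - θ⁻¹ ^ h * rho θ σ ^ n| ≤ σ⁻¹ ^ h * (2 * σ) ^ n := by
  have h0 : 0 < θ := hσ.trans hθ
  have e : θ⁻¹ ^ h * rho θ σ ^ n = ∑ m ∈ Finset.range (n + 1),
      (n.choose m : ℝ) * σ ^ (2 * m) * θ ^ ((n : ℤ) - 2 * m - h) := by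
    unfold rho
    rw [add_comm, add_pow, Finset.mul_sum]
    refine Finset.sum_congr rfl fun m hm => ?_
    rw [Finset.mem_range] at hm
    rw [show (n : ℤ) - 2 * m - h = ((n - m : ℕ) : ℤ) - (m : ℕ) - (h : ℕ) by omega,
      zpow_sub₀ h0.ne', zpow_sub₀ h0.ne', zpow_natCast, zpow_natCast, zpow_natCast, div_pow,
      pow_mul, inv_pow]
    field_simp
  have e2 : σ⁻¹ ^ h * (2 * σ) ^ n = ∑ m ∈ Finset.range (n + 1),
      (n.choose m : ℝ) * (σ ^ n * σ⁻¹ ^ h) := by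
    rw [← Finset.sum_mul, mul_pow, ← Nat.cast_sum, Nat.sum_range_choose]; push_cast; ring
  rw [e, e2]
  unfold walkTransform
  rw [← Finset.sum_sub_distrib]
  refine (Finset.abs_sum_le_sum_abs _ _).trans (Finset.sum_le_sum fun m _ => ?_)
  rw [← mul_sub, mul_assoc, abs_mul, abs_of_nonneg (Nat.cast_nonneg _)]
  refine mul_le_mul_of_nonneg_left ?_ (Nat.cast_nonneg _)
  unfold truncPow
  split_ifs with hz
  · simp; positivity
  · rw [zero_sub, mul_neg, abs_neg, abs_of_nonneg (by positivity)]
    have : θ ^ ((n : ℤ) - 2 * m - h) ≤ σ ^ ((n : ℤ) - 2 * m - h) := by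
      obtain ⟨k, hk⟩ : ∃ k : ℕ, (n : ℤ) - 2 * m - h = -(k : ℤ) :=
        ⟨(2 * m + h - n), by omega⟩
      rw [hk, zpow_neg, zpow_neg, zpow_natCast, zpow_natCast]
      gcongr
    calc _ ≤ σ ^ (2 * m) * σ ^ ((n : ℤ) - 2 * m - h) := by gcongr
      _ = _ := by
        rw [zpow_sub₀ hσ.ne', zpow_sub₀ hσ.ne', zpow_natCast, zpow_natCast,
          show (2 * (m : ℤ)) = ((2 * m : ℕ) : ℤ) by push_cast; ring, zpow_natCast, inv_pow]
        field_simp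

theorem ballot_asymptotic (hσ : 0 < σ) (hθ : σ < θ) (n : ℕ) :
    |ballot σ θ n 0 0 - (1 - σ ^ 2 / θ ^ 2) * rho θ σ ^ n| ≤ 2 * (2 * σ) ^ n := by
  have h0 : 0 < θ := hσ.trans hθ
  have h1 := walkTransform_truncPow_bound hσ hθ n 0
  have h2 := walkTransform_truncPow_bound hσ hθ n 2
  have e := ballot_eq_walkTransform (σ := σ) h0.ne' n 0
  have e2 : σ ^ 2 * (σ⁻¹ ^ 2 * (2 * σ) ^ n) = (2 * σ) ^ n := by field_simp
  have h3 := mul_le_mul_of_nonneg_left h2 (sq_nonneg σ)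
  rw [e2] at h3
  norm_num at e h1 h3
  rw [e]
  have e3 : walkTransform σ (truncPow θ) n 0 - σ ^ 2 * walkTransform σ (truncPow θ) n 2
      - (1 - σ ^ 2 / θ ^ 2) * rho θ σ ^ n
      = (walkTransform σ (truncPow θ) n 0 - rho θ σ ^ n)
        - σ ^ 2 * (walkTransform σ (truncPow θ) n 2 - (θ ^ 2)⁻¹ * rho θ σ ^ n) := by
    field_simp; ring
  rw [e3]
  refine (abs_sub _ _).trans ?_
  rw [abs_mul, abs_of_nonneg (sq_nonneg σ)]
  linarith

end DeformedWigner

namespace DeformedWigner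

variable {σ θ : ℝ} {N : ℕ}

/-! ### Degrees and parity defects of a finite graph. -/

section degree

variable {V : Type*} [DecidableEq V]

/-- Number of ends of the edge `e` at the vertex `v`; a loop at `v` has two. -/
def incidence (e : Sym2 V) (v : V) : ℕ :=
  Sym2.lift ⟨fun a b => (if v = a then 1 else 0) + if v = b then 1 else 0,
    fun _ _ => add_comm _ _⟩ e

@[simp]
theorem incidence_mk (a b v : V) :
    incidence s(a, b) v = (if v = a then 1 else 0) + if v = b then 1 else 0 := rfl

/-- Degree of `v` in the graph with edge set `O`; loops count twice. -/
def edgeDegree (O : Finset (Sym2 V)) (v : V) : ℕ := ∑ e ∈ O, incidence e v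

theorem edgeDegree_insert {O : Finset (Sym2 V)} {a b : V} (h : s(a, b) ∉ O) (v : V) :
    edgeDegree (insert s(a, b) O) v
      = edgeDegree O v + ((if v = a then 1 else 0) + if v = b then 1 else 0) := by
  rw [edgeDegree, Finset.sum_insert h, add_comm, incidence_mk, edgeDegree]

theorem edgeDegree_erase {O : Finset (Sym2 V)} {a b : V} (h : s(a, b) ∈ O) (v : V) :
    edgeDegree (O.erase s(a, b)) v + ((if v = a then 1 else 0) + if v = b then 1 else 0)
      = edgeDegree O v := by
  conv_rhs => rw [← Finset.insert_erase h]
  rw [edgeDegree_insert (Finset.notMem_erase _ _)]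

theorem card_neighbors_le [Fintype V] (O : Finset (Sym2 V)) (v : V) :
    (Finset.univ.filter fun w => s(v, w) ∈ O).card ≤ edgeDegree O v := by
  have h : (Finset.univ.filter fun w => s(v, w) ∈ O).card
      = ((Finset.univ.filter fun w => s(v, w) ∈ O).image fun w => s(v, w)).card := by
    rw [Finset.card_image_of_injective _ fun a b hab => Sym2.congr_right.1 hab]
  rw [h, Finset.card_eq_sum_ones]
  have hsub : ((Finset.univ.filter fun w => s(v, w) ∈ O).image fun w => s(v, w)) ⊆ O := by
    intro e he
    simp only [Finset.mem_image, Finset.mem_filter, Finset.mem_univ, true_and] at he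
    obtain ⟨w, hw, rfl⟩ := he
    exact hw
  refine (Finset.sum_le_sum fun e he => ?_).trans
    (Finset.sum_le_sum_of_subset hsub)
  simp only [Finset.mem_image, Finset.mem_filter, Finset.mem_univ, true_and] at he
  obtain ⟨w, hw, rfl⟩ := he
  simp

theorem edgeDegree_pos {O : Finset (Sym2 V)} {v w : V} (h : s(v, w) ∈ O) :
    1 ≤ edgeDegree O v := by
  have := edgeDegree_erase h v
  rw [if_pos rfl] at this
  omega

variable [Fintype V]

/-- The vertices at which the graph `O` has the wrong parity for a trail ending at `c`. -/
def defect (O : Finset (Sym2 V)) (c : V) : Finset V :=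
  Finset.univ.filter fun v => ¬ (Odd (edgeDegree O v) ↔ v = c)

theorem mem_defect {O : Finset (Sym2 V)} {c v : V} :
    v ∈ defect O c ↔ ¬ (Odd (edgeDegree O v) ↔ v = c) := by simp [defect]

/-- A matrix step changes the parities of the degrees at its two ends and moves the end of the trail
between the same two vertices; the changes cancel. Only jumps can alter the defect. -/
theorem defect_insert {O : Finset (Sym2 V)} {c w : V} (h : s(c, w) ∉ O) :
    defect (insert s(c, w) O) w = defect O c := by
  ext v
  rw [mem_defect, mem_defect, edgeDegree_insert h]
  by_cases h1 : v = c <;> by_cases h2 : v = w <;> simp [h1, h2, Nat.odd_add] <;> grind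

theorem defect_erase {O : Finset (Sym2 V)} {c w : V} (h : s(c, w) ∈ O) :
    defect (O.erase s(c, w)) w = defect O c := by
  ext v
  rw [mem_defect, mem_defect, ← edgeDegree_erase h]
  by_cases h1 : v = c <;> by_cases h2 : v = w <;> simp [h1, h2, Nat.odd_add] <;> grind

/-- Moving the end of the trail affects membership of `c` and `w` only; the identity records their
contributions before and after. -/
theorem card_defect_move (O : Finset (Sym2 V)) {c w : V} (h : w ≠ c) :
    (defect O w).card + ((if Odd (edgeDegree O c) then 0 else 1) +
        (if Odd (edgeDegree O w) then 1 else 0))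
      = (defect O c).card + ((if Odd (edgeDegree O c) then 1 else 0) +
        (if Odd (edgeDegree O w) then 0 else 1)) := by
  have key : ∀ x : V, (defect O x).card = ∑ v, if v ∈ defect O x then 1 else 0 := by
    intro x; simp
  rw [key, key]
  have e1 : ∀ f : V → ℕ, ∑ v, f v = f c + (f w + ∑ v ∈ (Finset.univ.erase c).erase w, f v) := by
    intro f
    rw [← Finset.add_sum_erase _ _ (Finset.mem_univ c),
      ← Finset.add_sum_erase (Finset.univ.erase c) _ (Finset.mem_erase.2 ⟨h, Finset.mem_univ w⟩)]
  rw [e1, e1]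
  have e2 : ∀ v ∈ (Finset.univ.erase c).erase w,
      (if v ∈ defect O w then 1 else 0) = if v ∈ defect O c then 1 else 0 := by
    intro v hv
    simp only [Finset.mem_erase, Finset.mem_univ, and_true] at hv
    simp [mem_defect, hv.1, hv.2]
  rw [Finset.sum_congr rfl e2]
  simp only [mem_defect, h, h.symm, iff_true, iff_false, not_not]
  split_ifs <;> omega

end degree

/-! ### Exploration of a walk and its invariants. -/

/-- State of the exploration of a walk whose steps are either matrix steps (`true`) or jumps
(`false`): current vertex, edges used an odd number of times by matrix steps, number of openings of
each edge, remaining closing credit of each vertex, visited vertices, number of irregular steps. -/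
structure WalkState (V : Type*) where
  cur : V
  opn : Finset (Sym2 V)
  mult : Sym2 V → ℕ
  credit : V → ℕ
  vis : Finset V
  flags : ℕ

namespace WalkState

section basic

variable {V : Type*} [DecidableEq V]

/-- The state at the start of a walk. -/
def start (x : V) : WalkState V where
  cur := x
  opn := ∅
  mult := fun _ => 0
  credit := Pi.single x 1
  vis := {x}
  flags := 0

/-- Matrix step along an open edge. -/
def closeStep (s : WalkState V) (w : V) : WalkState V where
  cur := w
  opn := s.opn.erase s(s.cur, w)
  mult := s.mult
  credit := Function.update s.credit s.cur (s.credit s.cur - 1)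
  vis := s.vis
  flags := s.flags

/-- Matrix step along an edge which is not open. -/
def openStep (s : WalkState V) (w : V) : WalkState V where
  cur := w
  opn := insert s(s.cur, w) s.opn
  mult := Function.update s.mult s(s.cur, w) (s.mult s(s.cur, w) + 1)
  credit := Function.update s.credit w (s.credit w + 1)
  vis := insert w s.vis
  flags := if w ∈ s.vis then s.flags + 1 else s.flags

/-- Credits after a departure by a jump. -/
def jumpCredit (s : WalkState V) : V → ℕ :=
  if Odd (edgeDegree s.opn s.cur) then s.credit
  else Function.update s.credit s.cur (s.credit s.cur - 1)

/-- Jump to an arbitrary vertex. -/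
def jumpStep (s : WalkState V) (w : V) : WalkState V where
  cur := w
  opn := s.opn
  mult := s.mult
  credit := Function.update s.jumpCredit w (s.jumpCredit w + 1)
  vis := insert w s.vis
  flags := if Odd (edgeDegree s.opn s.cur) ∨ w ∈ s.vis then s.flags + 1 else s.flags

/-- One step of the exploration. -/
def step (s : WalkState V) (a : Bool × V) : WalkState V :=
  if a.1 = true then
    if s(s.cur, a.2) ∈ s.opn then s.closeStep a.2 else s.openStep a.2
  else s.jumpStep a.2

theorem step_close {s : WalkState V} {w : V} (h : s(s.cur, w) ∈ s.opn) :
    s.step (true, w) = s.closeStep w := by simp [step, h]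

theorem step_open {s : WalkState V} {w : V} (h : s(s.cur, w) ∉ s.opn) :
    s.step (true, w) = s.openStep w := by simp [step, h]

theorem step_jump (s : WalkState V) (w : V) : s.step (false, w) = s.jumpStep w := by simp [step]

theorem step_cur (s : WalkState V) (a : Bool × V) : (s.step a).cur = a.2 := by
  unfold step; split_ifs <;> rfl

theorem flags_le_step (s : WalkState V) (a : Bool × V) : s.flags ≤ (s.step a).flags := by
  unfold step
  split_ifs
  · exact le_rfl
  · simp only [openStep]; split_ifs <;> omega
  · simp only [jumpStep]; split_ifs <;> omega

/-- The state after a list of steps. -/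
def run (s : WalkState V) (l : List (Bool × V)) : WalkState V := l.foldl step s

@[simp]
theorem run_nil (s : WalkState V) : s.run [] = s := rfl

@[simp]
theorem run_cons (s : WalkState V) (a : Bool × V) (l : List (Bool × V)) :
    s.run (a :: l) = (s.step a).run l := rfl

theorem flags_le_run (s : WalkState V) (l : List (Bool × V)) : s.flags ≤ (s.run l).flags := by
  induction l generalizing s with
  | nil => exact le_rfl
  | cons a l ih => exact (flags_le_step s a).trans (ih _)

end basic

/-- Consistency of a state reached after at most `t` steps. -/
structure Consistent (s : WalkState (Fin N)) (t : ℕ) : Prop where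
  degree_le : ∀ v, edgeDegree s.opn v + (if v = s.cur then 1 else 0) ≤ 2 * s.credit v
  credit_sum : ∑ v, (s.credit v - 1) ≤ s.flags
  defect_le : (defect s.opn s.cur).card ≤ 1 + 2 * s.flags
  vis_le : s.vis.card ≤ t + 1
  mult_sum : ∑ e, s.mult e ≤ t
  credit_vis : ∀ v, v ∉ s.vis → s.credit v = 0
  mult_vis : ∀ v w, v ∉ s.vis → s.mult s(v, w) = 0
  mult_open : ∀ e, s.mult e = 0 → e ∉ s.opn
  cur_vis : s.cur ∈ s.vis

theorem Consistent.open_vis {s : WalkState (Fin N)} {t : ℕ} (h : s.Consistent t) {v w : Fin N}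
    (hv : v ∉ s.vis) : s(w, v) ∉ s.opn := by
  rw [Sym2.eq_swap]
  exact h.mult_open _ (h.mult_vis v w hv)

theorem Consistent.degree_eq_zero {s : WalkState (Fin N)} {t : ℕ} (h : s.Consistent t)
    {v : Fin N} (hv : v ∉ s.vis) : edgeDegree s.opn v = 0 := by
  have := h.degree_le v
  rw [h.credit_vis v hv] at this
  omega

theorem Consistent.credit_pos {s : WalkState (Fin N)} {t : ℕ} (h : s.Consistent t) :
    1 ≤ s.credit s.cur := by
  have := h.degree_le s.cur
  rw [if_pos rfl] at this
  omega

theorem consistent_start (x : Fin N) : (start x).Consistent 0 where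
  degree_le v := by
    by_cases h : v = x <;> simp [start, edgeDegree, h]
  credit_sum := by
    refine (Finset.sum_eq_zero fun v _ => ?_).le
    by_cases h : v = x <;> simp [start, h]
  defect_le := by
    have : defect (start x).opn (start x).cur = {x} := by
      ext v; simp [mem_defect, start, edgeDegree]
    rw [this]; simp
  vis_le := by simp [start]
  mult_sum := by simp [start]
  credit_vis v hv := by
    have : v ≠ x := by simpa [start] using hv
    simp [start, this]
  mult_vis v w _ := rfl
  mult_open e _ := by simp [start]
  cur_vis := by simp [start]

theorem sum_pred_update_succ (c : Fin N → ℕ) (w : Fin N) :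
    ∑ v, (Function.update c w (c w + 1) v - 1) ≤
      ∑ v, (c v - 1) + if c w = 0 then 0 else 1 := by
  have h : ∀ f : Fin N → ℕ, ∑ v, f v = f w + ∑ v ∈ Finset.univ.erase w, f v := fun f =>
    (Finset.add_sum_erase _ _ (Finset.mem_univ w)).symm
  rw [h, h fun v => c v - 1]
  have : ∑ v ∈ Finset.univ.erase w, (Function.update c w (c w + 1) v - 1)
      = ∑ v ∈ Finset.univ.erase w, (c v - 1) :=
    Finset.sum_congr rfl fun v hv => by
      rw [Function.update_of_ne (Finset.ne_of_mem_erase hv)]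
  rw [this, Function.update_self]
  split_ifs <;> omega

theorem sum_pred_mono {c c' : Fin N → ℕ} (h : ∀ v, c' v ≤ c v) :
    ∑ v, (c' v - 1) ≤ ∑ v, (c v - 1) :=
  Finset.sum_le_sum fun v _ => Nat.sub_le_sub_right (h v) 1

theorem update_pred_le (c : Fin N → ℕ) (x v : Fin N) :
    Function.update c x (c x - 1) v ≤ c v := by
  by_cases h : v = x
  · subst h; simp
  · rw [Function.update_of_ne h]

theorem jumpCredit_le (s : WalkState (Fin N)) (v : Fin N) : s.jumpCredit v ≤ s.credit v := by
  unfold jumpCredit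
  split_ifs
  · exact le_rfl
  · exact update_pred_le _ _ _

/-- One unit of credit pays for two items at a vertex, where the items are the ends of open edges
and the presence of the walker. A closing removes two items at the departure vertex and, if it is
not a loop, exchanges an edge end for the walker at the arrival vertex. -/
theorem Consistent.close {s : WalkState (Fin N)} {t : ℕ} (h : s.Consistent t) {w : Fin N}
    (hw : s(s.cur, w) ∈ s.opn) : (s.closeStep w).Consistent (t + 1) where
  degree_le v := by
    have h1 := edgeDegree_erase hw v
    have h2 := h.degree_le v
    have h3 := edgeDegree_pos hw
    by_cases e1 : v = s.cur <;> by_cases e2 : v = w <;> simp_all [closeStep] <;> grind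
  credit_sum := (sum_pred_mono (update_pred_le _ _)).trans h.credit_sum
  defect_le := by
    simp only [closeStep]
    rw [defect_erase hw]
    exact h.defect_le
  vis_le := h.vis_le.trans (by omega)
  mult_sum := h.mult_sum.trans (by omega)
  credit_vis v hv := by
    have := update_pred_le s.credit s.cur v
    rw [h.credit_vis v hv] at this
    exact Nat.le_zero.1 this
  mult_vis := h.mult_vis
  mult_open e he := fun h' => h.mult_open e he (Finset.mem_of_mem_erase h')
  cur_vis := by
    by_contra hv
    exact h.open_vis hv hw

/-- The departure vertex exchanges the walker for an edge end, and the arrival vertex gains both,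
hence one unit of credit. Credit beyond the first unit can only arise at a visited vertex, where the
step is flagged. -/
theorem Consistent.opening {s : WalkState (Fin N)} {t : ℕ} (h : s.Consistent t) {w : Fin N}
    (hw : s(s.cur, w) ∉ s.opn) : (s.openStep w).Consistent (t + 1) where
  degree_le v := by
    have h1 := edgeDegree_insert hw v
    have h2 := h.degree_le v
    simp only [openStep]
    rw [h1]
    by_cases e1 : v = s.cur <;> by_cases e2 : v = w <;> simp_all <;> grind
  credit_sum := by
    refine (sum_pred_update_succ _ _).trans ?_
    have h1 := h.credit_sum
    simp only [openStep]
    split_ifs with h2 h3 h3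
    · omega
    · omega
    · omega
    · exact absurd (h.credit_vis w h3) h2
  defect_le := by
    simp only [openStep]
    rw [defect_insert hw]
    refine h.defect_le.trans ?_
    split_ifs <;> omega
  vis_le := (Finset.card_insert_le _ _).trans (by have := h.vis_le; omega)
  mult_sum := by
    have h1 : ∀ f : Sym2 (Fin N) → ℕ, ∑ v, f v = f s(s.cur, w)
        + ∑ v ∈ Finset.univ.erase s(s.cur, w), f v := fun f =>
      (Finset.add_sum_erase _ _ (Finset.mem_univ _)).symm
    have h2 := h.mult_sum
    rw [h1] at h2 ⊢
    have : ∑ e ∈ Finset.univ.erase s(s.cur, w), (s.openStep w).mult e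
        = ∑ e ∈ Finset.univ.erase s(s.cur, w), s.mult e :=
      Finset.sum_congr rfl fun e he => by
        simp only [openStep]
        rw [Function.update_of_ne (Finset.ne_of_mem_erase he)]
    rw [this]
    simp only [openStep, Function.update_self]
    omega
  credit_vis v hv := by
    simp only [openStep, Finset.mem_insert, not_or] at hv ⊢
    rw [Function.update_of_ne hv.1, h.credit_vis v hv.2]
  mult_vis v x hv := by
    simp only [openStep, Finset.mem_insert, not_or] at hv ⊢
    have hne : s(v, x) ≠ s(s.cur, w) := by
      intro h'
      have : v ∈ s(s.cur, w) := h' ▸ Sym2.mem_mk_left v x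
      rcases Sym2.mem_iff.1 this with rfl | rfl
      · exact hv.2 h.cur_vis
      · exact hv.1 rfl
    rw [Function.update_of_ne hne]
    exact h.mult_vis v x hv.2
  mult_open e he := by
    simp only [openStep] at he ⊢
    by_cases h' : e = s(s.cur, w)
    · subst h'; simp at he
    · rw [Function.update_of_ne h'] at he
      simp [h', h.mult_open e he]
  cur_vis := Finset.mem_insert_self _ _

/-- A jump removes just the walker from the departure vertex. At even degree `d`, the bound `d + 1 ≤
2c` improves to `d + 2 ≤ 2c`, so a whole unit of credit can be withdrawn. At odd degree nothing is
withdrawn, and the step is flagged. -/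
theorem Consistent.jump {s : WalkState (Fin N)} {t : ℕ} (h : s.Consistent t) (w : Fin N) :
    (s.jumpStep w).Consistent (t + 1) where
  degree_le v := by
    have h2 := h.degree_le v
    simp only [jumpStep, jumpCredit]
    by_cases e0 : Odd (edgeDegree s.opn s.cur)
    · by_cases e1 : v = s.cur <;> by_cases e2 : v = w <;> simp_all <;> grind
    · by_cases e1 : v = s.cur <;> by_cases e2 : v = w <;> simp_all <;> grind
  credit_sum := by
    refine (sum_pred_update_succ _ _).trans ?_
    have h1 := h.credit_sum
    have h2 := sum_pred_mono s.jumpCredit_le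
    simp only [jumpStep]
    split_ifs with h3 h4 h4
    · omega
    · omega
    · omega
    · push Not at h4
      have := s.jumpCredit_le w
      rw [h.credit_vis w h4.2] at this
      omega
  defect_le := by
    have h1 := h.defect_le
    simp only [jumpStep]
    by_cases hw : w = s.cur
    · rw [hw]; refine h1.trans ?_; split_ifs <;> omega
    · have h2 := card_defect_move s.opn hw
      split_ifs with h3
      · split_ifs at h2 <;> omega
      · push Not at h3
        have h4 := h.degree_eq_zero h3.2
        rw [if_neg h3.1, if_neg h3.1, h4] at h2
        simp at h2
        omega
  vis_le := (Finset.card_insert_le _ _).trans (by have := h.vis_le; omega)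
  mult_sum := h.mult_sum.trans (by omega)
  credit_vis v hv := by
    simp only [jumpStep, Finset.mem_insert, not_or] at hv ⊢
    rw [Function.update_of_ne hv.1]
    have := s.jumpCredit_le v
    rw [h.credit_vis v hv.2] at this
    omega
  mult_vis v x hv := by
    simp only [jumpStep, Finset.mem_insert, not_or] at hv ⊢
    exact h.mult_vis v x hv.2
  mult_open := h.mult_open
  cur_vis := Finset.mem_insert_self _ _

theorem Consistent.step {s : WalkState (Fin N)} {t : ℕ} (h : s.Consistent t)
    (a : Bool × Fin N) : (s.step a).Consistent (t + 1) := by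
  unfold WalkState.step
  split_ifs with h1 h2
  · exact h.close h2
  · exact h.opening h2
  · exact h.jump _

theorem Consistent.run {s : WalkState (Fin N)} {t : ℕ} (h : s.Consistent t)
    (l : List (Bool × Fin N)) : (s.run l).Consistent (t + l.length) := by
  induction l generalizing s t with
  | nil => exact h
  | cons a l ih =>
    have := ih (h.step a)
    rw [List.length_cons, show t + (l.length + 1) = t + 1 + l.length by omega]
    exact this

end WalkState

end DeformedWigner

/-! ### Weights of walks and the potential. -/

namespace DeformedWigner

variable {σ θ : ℝ} {N : ℕ}

/-- The odd double factorial `(2m - 1)!!`. -/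
noncomputable def oddFactorial : ℕ → ℝ
  | 0 => 1
  | m + 1 => (2 * m + 1) * oddFactorial m

theorem one_le_oddFactorial (m : ℕ) : 1 ≤ oddFactorial m := by
  induction m with
  | zero => exact le_rfl
  | succ m ih =>
    simp only [oddFactorial]
    have : (0 : ℝ) ≤ m := Nat.cast_nonneg m
    nlinarith

/-- Product of the odd double factorials of the values of `c`. -/
noncomputable def creditProd (c : Fin N → ℕ) : ℝ := ∏ v, oddFactorial (c v)

theorem one_le_creditProd (c : Fin N → ℕ) : 1 ≤ creditProd c :=
  Finset.prod_induction _ (fun x : ℝ => 1 ≤ x) (fun _ _ => one_le_mul_of_one_le_of_one_le) le_rfl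
    fun v _ => one_le_oddFactorial (c v)

theorem creditProd_update_succ (c : Fin N → ℕ) (w : Fin N) :
    creditProd (Function.update c w (c w + 1)) = (2 * c w + 1) * creditProd c := by
  unfold creditProd
  rw [← Finset.mul_prod_erase _ _ (Finset.mem_univ w),
    ← Finset.mul_prod_erase Finset.univ (fun v => oddFactorial (c v)) (Finset.mem_univ w)]
  rw [Function.update_self, oddFactorial, mul_assoc]
  congr 2
  exact Finset.prod_congr rfl fun v hv => by
    rw [Function.update_of_ne (Finset.ne_of_mem_erase hv)]

theorem creditProd_update_pred (c : Fin N → ℕ) (w : Fin N) (h : 1 ≤ c w) :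
    (2 * c w - 1) * creditProd (Function.update c w (c w - 1)) = creditProd c := by
  have h1 := creditProd_update_succ (Function.update c w (c w - 1)) w
  rw [Function.update_self, Function.update_idem, Nat.sub_add_cancel h,
    Function.update_eq_self] at h1
  rw [h1]
  push_cast [h]
  ring

theorem creditProd_update_pred_le (c : Fin N → ℕ) (w : Fin N) :
    creditProd (Function.update c w (c w - 1)) ≤ creditProd c := by
  rcases Nat.eq_zero_or_pos (c w) with h | h
  · rw [h, Nat.zero_sub, ← h, Function.update_eq_self]
  · have h1 := creditProd_update_pred c w h
    have h2 : (1 : ℝ) ≤ c w := by exact_mod_cast h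
    have h3 := one_le_creditProd (Function.update c w (c w - 1))
    nlinarith

/-- Bound for the contribution of irregular continuations of length `n` after `r` irregular steps. -/
noncomputable def flagFactor (q : ℝ) (r n : ℕ) : ℝ :=
  (1 - n * q)⁻¹ ^ (r + 1) - if r = 0 then 1 else 0

theorem one_le_inv_one_sub {q : ℝ} (hq : 0 ≤ q) {n : ℕ} (h : n * q < 1) :
    1 ≤ (1 - n * q)⁻¹ := by
  have : 0 ≤ n * q := by positivity
  exact (one_le_inv₀ (by linarith)).2 (by linarith)

theorem flagFactor_nonneg {q : ℝ} (hq : 0 ≤ q) {n : ℕ} (h : n * q < 1) (r : ℕ) :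
    0 ≤ flagFactor q r n := by
  unfold flagFactor
  have h1 := one_le_pow₀ (one_le_inv_one_sub hq h) (n := r + 1)
  split_ifs <;> linarith

theorem flagFactor_zero_right (q : ℝ) (r : ℕ) :
    flagFactor q r 0 = if r = 0 then 0 else 1 := by
  unfold flagFactor; split_ifs <;> simp

/-- Discrete form of the derivative of `(1 - nq)⁻¹ ^ (r + 1)` in `n`: an irregular step costs `q (1
+ r)` and raises `r`. The correction at `r = 0` removes the walks that never become irregular, and
it cancels on both sides. -/
theorem flagFactor_succ {q : ℝ} (hq : 0 ≤ q) {n : ℕ} (h : (n + 1 : ℕ) * q < 1) (r : ℕ) :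
    flagFactor q r n + q * (1 + r) * flagFactor q (r + 1) n ≤ flagFactor q r (n + 1) := by
  unfold flagFactor
  rw [if_neg (Nat.succ_ne_zero r)]
  push_cast at h ⊢
  have hn : (0 : ℝ) ≤ n * q := by positivity
  have ha : 0 < 1 - n * q := by nlinarith
  have hb : 0 < 1 - (n + 1) * q := by linarith
  set a := 1 - (n : ℝ) * q with hadef
  have hab : 1 - ((n : ℝ) + 1) * q = a - q := by rw [hadef]; ring
  rw [hab] at hb ⊢
  have key : a⁻¹ ^ (r + 1) + q * (1 + r) * a⁻¹ ^ (r + 2) ≤ (a - q)⁻¹ ^ (r + 1) := by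
    have h1 : 1 + ((r + 1 : ℕ) : ℝ) * (q * a⁻¹) ≤ (1 + q * a⁻¹) ^ (r + 1) :=
      one_add_mul_le_pow (by have : 0 ≤ q * a⁻¹ := by positivity
                             linarith) _
    -- Equivalent to `(a + q) (a - q) ≤ a²`.
    have h2 : (1 + q * a⁻¹) * a⁻¹ ≤ (a - q)⁻¹ := by
      rw [le_inv_comm₀ (by positivity) hb]
      have : ((1 + q * a⁻¹) * a⁻¹)⁻¹ = a * a / (a + q) := by field_simp
      rw [this, le_div_iff₀ (by positivity)]
      nlinarith
    calc _ = (1 + ((r + 1 : ℕ) : ℝ) * (q * a⁻¹)) * a⁻¹ ^ (r + 1) := by push_cast; ring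
      _ ≤ (1 + q * a⁻¹) ^ (r + 1) * a⁻¹ ^ (r + 1) := by gcongr
      _ = ((1 + q * a⁻¹) * a⁻¹) ^ (r + 1) := by rw [mul_pow]
      _ ≤ _ := by gcongr
  split_ifs <;> linarith

/-- Sum of `φ` over all lists of `n` steps. -/
def walkSum {M : Type*} [AddCommMonoid M] {α : Type*} [Fintype α] : ℕ → (List α → M) → M
  | 0, φ => φ []
  | n + 1, φ => ∑ a, walkSum n fun l => φ (a :: l)

section walkSum

variable {M : Type*} [AddCommMonoid M] {α : Type*} [Fintype α]

theorem walkSum_eq_sum (n : ℕ) (φ : List α → M) :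
    walkSum n φ = ∑ f : Fin n → α, φ (List.ofFn f) := by
  induction n generalizing φ with
  | zero => simp [walkSum]
  | succ n ih =>
    simp only [walkSum, ih]
    rw [← (Fin.consEquiv fun _ => α).sum_comp, Fintype.sum_prod_type]
    simp [Fin.consEquiv, List.ofFn_succ]

theorem walkSum_congr {n : ℕ} {φ ψ : List α → M} (h : ∀ l, l.length = n → φ l = ψ l) :
    walkSum n φ = walkSum n ψ := by
  rw [walkSum_eq_sum, walkSum_eq_sum]
  exact Finset.sum_congr rfl fun f _ => h _ (by simp)

theorem walkSum_add (n : ℕ) (φ ψ : List α → M) :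
    walkSum n (fun l => φ l + ψ l) = walkSum n φ + walkSum n ψ := by
  simp [walkSum_eq_sum, Finset.sum_add_distrib]

theorem walkSum_const_zero (n : ℕ) : walkSum n (fun _ : List α => (0 : M)) = 0 := by
  simp [walkSum_eq_sum]

theorem walkSum_mono {n : ℕ} {φ ψ : List α → ℝ} (h : ∀ l, l.length = n → φ l ≤ ψ l) :
    walkSum n φ ≤ walkSum n ψ := by
  rw [walkSum_eq_sum, walkSum_eq_sum]
  exact Finset.sum_le_sum fun f _ => h _ (by simp)

theorem walkSum_mul_left (n : ℕ) (c : ℝ) (φ : List α → ℝ) :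
    walkSum n (fun l => c * φ l) = c * walkSum n φ := by
  simp [walkSum_eq_sum, Finset.mul_sum]

end walkSum

/-- Weight of the `(k + 1)`-st opening of the edge `e`. -/
noncomputable def openWeight {V : Type*} (σ B : ℝ) (e : Sym2 V) (k : ℕ) : ℝ :=
  open Classical in if k = 0 ∧ ¬ e.IsDiag then σ ^ 2 else B * (k + 1)

theorem openWeight_nonneg {V : Type*} {B : ℝ} (hB : 0 ≤ B) (e : Sym2 V) (k : ℕ) :
    0 ≤ openWeight σ B e k := by
  unfold openWeight; split_ifs <;> positivity

theorem openWeight_le {V : Type*} {B : ℝ} (hB : σ ^ 2 ≤ B) (e : Sym2 V) (k : ℕ) :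
    openWeight σ B e k ≤ B * (k + 1) := by
  unfold openWeight; split_ifs with h
  · rw [h.1]; simpa using hB
  · exact le_rfl

namespace WalkState

/-- Weight of a step. -/
noncomputable def stepWeight (σ θ B : ℝ) (s : WalkState (Fin N)) (a : Bool × Fin N) : ℝ :=
  if a.1 = true then
    if s(s.cur, a.2) ∈ s.opn then 1
    else openWeight σ B s(s.cur, a.2) (s.mult s(s.cur, a.2)) / N
  else θ / N

/-- Product of the weights of a list of steps. -/
noncomputable def listWeight (σ θ B : ℝ) : WalkState (Fin N) → List (Bool × Fin N) → ℝ
  | _, [] => 1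
  | s, a :: l => stepWeight σ θ B s a * listWeight σ θ B (s.step a) l

theorem stepWeight_nonneg {B : ℝ} (hθ : 0 ≤ θ) (hB : 0 ≤ B) (s : WalkState (Fin N))
    (a : Bool × Fin N) : 0 ≤ stepWeight σ θ B s a := by
  have := openWeight_nonneg (σ := σ) hB s(s.cur, a.2) (s.mult s(s.cur, a.2))
  unfold stepWeight; split_ifs <;> positivity

theorem listWeight_nonneg {B : ℝ} (hθ : 0 ≤ θ) (hB : 0 ≤ B) (s : WalkState (Fin N))
    (l : List (Bool × Fin N)) : 0 ≤ listWeight σ θ B s l := by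
  induction l generalizing s with
  | nil => exact zero_le_one
  | cons a l ih => exact mul_nonneg (stepWeight_nonneg hθ hB s a) (ih _)

end WalkState

/-- The first `j` steps of a list are matrix steps. -/
def StartsWith {V : Type*} (j : ℕ) (l : List (Bool × V)) : Prop := ∀ a ∈ l.take j, a.1 = true

instance {V : Type*} (j : ℕ) (l : List (Bool × V)) : Decidable (StartsWith j l) :=
  inferInstanceAs (Decidable (∀ a ∈ l.take j, a.1 = true))

theorem startsWith_zero {V : Type*} (l : List (Bool × V)) : StartsWith 0 l := by
  simp [StartsWith]

theorem startsWith_cons {V : Type*} (j : ℕ) (a : Bool × V) (l : List (Bool × V)) :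
    StartsWith j (a :: l) ↔ (j = 0 ∨ a.1 = true) ∧ StartsWith (j - 1) l := by
  cases j with
  | zero => simp [StartsWith]
  | succ j => simp [StartsWith]

namespace WalkState

/-- Total weight of the irregular closed walks of length `n` from the state `s` whose first `j`
steps are matrix steps. -/
noncomputable def irregularSum (σ θ B : ℝ) (n j : ℕ) (s : WalkState (Fin N)) : ℝ :=
  walkSum n fun l => if StartsWith j l ∧ (s.run l).opn = ∅ ∧ 1 ≤ (s.run l).flags then
    listWeight σ θ B s l else 0

theorem irregularSum_succ (B : ℝ) (n j : ℕ) (s : WalkState (Fin N)) :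
    irregularSum σ θ B (n + 1) j s
      = ∑ w, stepWeight σ θ B s (true, w) * irregularSum σ θ B n (j - 1) (s.step (true, w))
        + if j = 0 then ∑ w, stepWeight σ θ B s (false, w) *
            irregularSum σ θ B n 0 (s.step (false, w)) else 0 := by
  unfold irregularSum
  simp only [walkSum]
  rw [Fintype.sum_prod_type, Fintype.sum_bool]
  congr 1
  · refine Finset.sum_congr rfl fun w _ => ?_
    rw [← walkSum_mul_left]
    refine walkSum_congr fun l _ => ?_
    rw [mul_ite, mul_zero]
    exact if_congr (and_congr_left fun _ => by simp [startsWith_cons]) rfl rfl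
  · split_ifs with hj
    · subst hj
      refine Finset.sum_congr rfl fun w _ => ?_
      rw [← walkSum_mul_left]
      refine walkSum_congr fun l _ => ?_
      rw [mul_ite, mul_zero]
      exact if_congr (and_congr_left fun _ => by simp [startsWith_cons]) rfl rfl
    · refine Finset.sum_eq_zero fun w _ => ?_
      refine (walkSum_congr fun l _ => ?_).trans
        (walkSum_const_zero (α := Bool × Fin N) (M := ℝ) n)
      rw [if_neg]
      simp [startsWith_cons, hj]

/-- The potential which dominates `irregularSum`. -/
noncomputable def potential (σ θ q : ℝ) (n j : ℕ) (s : WalkState (Fin N)) : ℝ :=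
  ballot σ θ n j s.opn.card * creditProd s.credit *
    (√(N : ℝ))⁻¹ ^ ((defect s.opn s.cur).card / 2) * flagFactor q s.flags n

/-- The credit product loses the factor `2c - 1`, which is at least the number of open edges that
could be closed from the current vertex. -/
theorem potential_close {q : ℝ} (n j : ℕ) {s : WalkState (Fin N)} {t : ℕ}
    (h : s.Consistent t) {w : Fin N} (hw : s(s.cur, w) ∈ s.opn) :
    potential σ θ q n j (s.step (true, w)) =
      (2 * (s.credit s.cur : ℝ) - 1)⁻¹ * (ballot σ θ n j (s.opn.card - 1) * (creditProd s.credit *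
        (√(N : ℝ))⁻¹ ^ ((defect s.opn s.cur).card / 2)) * flagFactor q s.flags n) := by
  rw [step_close hw]
  unfold potential
  simp only [closeStep]
  rw [defect_erase hw, Finset.card_erase_of_mem hw,
    ← creditProd_update_pred s.credit s.cur h.credit_pos]
  have : (2 * (s.credit s.cur : ℝ) - 1) ≠ 0 := by
    have : (1 : ℝ) ≤ s.credit s.cur := by exact_mod_cast h.credit_pos
    intro h'; linarith
  field_simp

theorem potential_fresh {q : ℝ} (n j : ℕ) {s : WalkState (Fin N)} {t : ℕ}
    (h : s.Consistent t) {w : Fin N} (hw : w ∉ s.vis) :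
    potential σ θ q n j (s.step (true, w)) =
      (ballot σ θ n j (s.opn.card + 1) * (creditProd s.credit *
        (√(N : ℝ))⁻¹ ^ ((defect s.opn s.cur).card / 2)) * flagFactor q s.flags n) := by
  have ho := h.open_vis hw (w := s.cur)
  rw [step_open ho]
  unfold potential
  simp only [openStep]
  rw [defect_insert ho, Finset.card_insert_of_notMem ho, if_neg hw, creditProd_update_succ,
    h.credit_vis w hw]
  push_cast; ring

theorem potential_reopen {q : ℝ} (n j : ℕ) {s : WalkState (Fin N)}
    {w : Fin N} (hw : w ∈ s.vis) (ho : s(s.cur, w) ∉ s.opn) :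
    potential σ θ q n j (s.step (true, w)) =
      (2 * s.credit w + 1) * (ballot σ θ n j (s.opn.card + 1) * (creditProd s.credit *
        (√(N : ℝ))⁻¹ ^ ((defect s.opn s.cur).card / 2)) * flagFactor q (s.flags + 1) n) := by
  rw [step_open ho]
  unfold potential
  simp only [openStep]
  rw [defect_insert ho, Finset.card_insert_of_notMem ho, if_pos hw, creditProd_update_succ]
  ring

/-- A credit is at most one plus its excess, and the excesses sum to at most the number of irregular
steps. -/
theorem sum_credit_le {s : WalkState (Fin N)} {t : ℕ} (h : s.Consistent t) (A : Finset (Fin N)) :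
    ∑ w ∈ A, (2 * (s.credit w : ℝ) + 1) ≤ 3 * A.card + 2 * s.flags := by
  have h1 : ∑ w ∈ A, (2 * s.credit w + 1) ≤ ∑ w ∈ A, 3 + 2 * ∑ w ∈ A, (s.credit w - 1) := by
    rw [Finset.mul_sum, ← Finset.sum_add_distrib]
    exact Finset.sum_le_sum fun w _ => by omega
  have h2 : ∑ w ∈ A, (s.credit w - 1) ≤ s.flags :=
    (Finset.sum_le_sum_of_subset (Finset.subset_univ A)).trans h.credit_sum
  have h3 : ∑ w ∈ A, (2 * s.credit w + 1) ≤ 3 * A.card + 2 * s.flags := by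
    rw [Finset.sum_const, smul_eq_mul] at h1; omega
  exact_mod_cast h3

theorem credit_le {s : WalkState (Fin N)} {t : ℕ} (h : s.Consistent t) (w : Fin N) :
    2 * (s.credit w : ℝ) + 1 ≤ 3 * (1 + s.flags) := by
  have h1 : s.credit w - 1 ≤ s.flags :=
    (Finset.single_le_sum (f := fun v => s.credit v - 1) (fun _ _ => Nat.zero_le _)
      (Finset.mem_univ w)).trans h.credit_sum
  have : 2 * s.credit w + 1 ≤ 3 * (1 + s.flags) := by omega
  exact_mod_cast this

theorem sum_mult_le {s : WalkState (Fin N)} {t : ℕ} (h : s.Consistent t) :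
    ∑ w ∈ s.vis, ((s.mult s(s.cur, w) : ℝ) + 1) ≤ 2 * t + 1 := by
  have h1 : ∑ w ∈ s.vis, s.mult s(s.cur, w) ≤ t := by
    have : ∑ w ∈ s.vis, s.mult s(s.cur, w) = ∑ e ∈ s.vis.image fun w => s(s.cur, w), s.mult e := by
      rw [Finset.sum_image fun a _ b _ hab => Sym2.congr_right.1 hab]
    rw [this]
    exact (Finset.sum_le_sum_of_subset (Finset.subset_univ _)).trans h.mult_sum
  have h2 := h.vis_le
  rw [Finset.sum_add_distrib, Finset.sum_const, nsmul_eq_mul, mul_one]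
  have : ∑ w ∈ s.vis, s.mult s(s.cur, w) + s.vis.card ≤ 2 * t + 1 := by omega
  exact_mod_cast this

/-- Only a jump onto a vertex of the defect can decrease the defect, and then by at most two
vertices, that is one factor `√N`. There are few such targets. -/
theorem defect_factor_le (hN : 1 ≤ N) (O : Finset (Sym2 (Fin N))) (c w : Fin N) :
    (√(N : ℝ))⁻¹ ^ ((defect O w).card / 2) ≤ (√(N : ℝ))⁻¹ ^ ((defect O c).card / 2) *
      (1 + if w ∈ defect O c then √(N : ℝ) else 0) := by
  have hN' : (1 : ℝ) ≤ √(N : ℝ) := by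
    rw [Real.one_le_sqrt]; exact_mod_cast hN
  have h0 : 0 ≤ (√(N : ℝ))⁻¹ := by positivity
  have h1 : (√(N : ℝ))⁻¹ ≤ 1 := inv_le_one_of_one_le₀ hN'
  by_cases hw : w = c
  · subst hw
    refine le_mul_of_one_le_right (by positivity) ?_
    split_ifs <;> linarith
  have h2 := card_defect_move O hw
  split_ifs with h3
  · have hc : (defect O c).card / 2 ≤ (defect O w).card / 2 + 1 := by
      split_ifs at h2 <;> omega
    have hp : (√(N : ℝ))⁻¹ ^ ((defect O w).card / 2 + 1) ≤ (√(N : ℝ))⁻¹ ^ ((defect O c).card / 2) :=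
      pow_le_pow_of_le_one h0 h1 hc
    rw [pow_succ] at hp
    have e : (√(N : ℝ))⁻¹ ^ ((defect O w).card / 2) =
        (√(N : ℝ))⁻¹ ^ ((defect O w).card / 2) * (√(N : ℝ))⁻¹ * √(N : ℝ) := by field_simp
    rw [e]
    have hq : 0 ≤ (√(N : ℝ))⁻¹ ^ ((defect O c).card / 2) := by positivity
    nlinarith
  · rw [add_zero, mul_one]
    have hwo : ¬ Odd (edgeDegree O w) := by
      intro ho
      exact h3 (mem_defect.2 (by simp [ho, hw]))
    refine pow_le_pow_of_le_one h0 h1 (Nat.div_le_div_right ?_)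
    rw [if_neg hwo, if_neg hwo] at h2
    split_ifs at h2 <;> omega

theorem creditProd_jump_le (s : WalkState (Fin N)) (w : Fin N) :
    creditProd (s.jumpStep w).credit ≤ (2 * s.credit w + 1) * creditProd s.credit := by
  simp only [jumpStep]
  rw [creditProd_update_succ]
  have h1 : creditProd s.jumpCredit ≤ creditProd s.credit := by
    unfold jumpCredit
    split_ifs
    · exact le_rfl
    · exact creditProd_update_pred_le _ _
  have h2 : (s.jumpCredit w : ℝ) ≤ s.credit w := by exact_mod_cast s.jumpCredit_le w
  have h3 := one_le_creditProd s.jumpCredit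
  gcongr

theorem potential_jump_visited {q : ℝ} (hN : 1 ≤ N) (hθ : 0 ≤ θ) (hq : 0 ≤ q) (n j : ℕ)
    (hnq : n * q < 1) {s : WalkState (Fin N)}
    {w : Fin N} (hw : w ∈ s.vis) :
    potential σ θ q n j (s.step (false, w)) ≤
      (2 * s.credit w + 1) * (1 + if w ∈ defect s.opn s.cur then √(N : ℝ) else 0) *
      (ballot σ θ n j s.opn.card * (creditProd s.credit *
        (√(N : ℝ))⁻¹ ^ ((defect s.opn s.cur).card / 2)) * flagFactor q (s.flags + 1) n) := by
  rw [step_jump]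
  have e : (s.jumpStep w).flags = s.flags + 1 := by simp [jumpStep, hw]
  unfold potential
  rw [e]
  have h1 := creditProd_jump_le s w
  have h2 := defect_factor_le hN s.opn s.cur w
  have h3 := flagFactor_nonneg hq hnq (s.flags + 1)
  have h4 := ballot_nonneg (σ := σ) hθ n j s.opn.card
  have h5 := one_le_creditProd (s.jumpStep w).credit
  have h6 := one_le_creditProd s.credit
  calc _ ≤ ballot σ θ n j s.opn.card * ((2 * s.credit w + 1) * creditProd s.credit) *
      ((√(N : ℝ))⁻¹ ^ ((defect s.opn s.cur).card / 2) *
      (1 + if w ∈ defect s.opn s.cur then √(N : ℝ) else 0)) * flagFactor q (s.flags + 1) n := by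
        change ballot σ θ n j s.opn.card * creditProd (s.jumpStep w).credit *
          (√(N : ℝ))⁻¹ ^ ((defect s.opn w).card / 2) * flagFactor q (s.flags + 1) n ≤ _
        gcongr
    _ = _ := by ring

/-- Leaving a vertex of odd degree for a new one puts both into the defect. The step has about `N`
targets and no small weight of its own; the factor `1/√N` anticipates half of the price of the later
jumps which must repair the parities. -/
theorem potential_jump_fresh_odd {q : ℝ} (hN : 1 ≤ N) (hθ : 0 ≤ θ) (hq : 0 ≤ q) (n j : ℕ)
    (hnq : n * q < 1) {s : WalkState (Fin N)} {t : ℕ} (h : s.Consistent t)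
    {w : Fin N} (hw : w ∉ s.vis) (hd : Odd (edgeDegree s.opn s.cur)) :
    potential σ θ q n j (s.step (false, w)) ≤ (√(N : ℝ))⁻¹ *
      (ballot σ θ n j s.opn.card * (creditProd s.credit *
        (√(N : ℝ))⁻¹ ^ ((defect s.opn s.cur).card / 2)) * flagFactor q (s.flags + 1) n) := by
  rw [step_jump]
  have e : (s.jumpStep w).flags = s.flags + 1 := by simp [jumpStep, hd]
  unfold potential
  rw [e]
  have h1 := creditProd_jump_le s w
  rw [h.credit_vis w hw] at h1
  have hwc : w ≠ s.cur := fun h' => hw (h' ▸ h.cur_vis)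
  have hc := card_defect_move s.opn hwc
  rw [h.degree_eq_zero hw, if_pos hd, if_pos hd] at hc
  simp at hc
  have h3 := flagFactor_nonneg hq hnq (s.flags + 1)
  have h4 := ballot_nonneg (σ := σ) hθ n j s.opn.card
  change ballot σ θ n j s.opn.card * creditProd (s.jumpStep w).credit *
          (√(N : ℝ))⁻¹ ^ ((defect s.opn w).card / 2) * flagFactor q (s.flags + 1) n ≤ _
  rw [show (defect s.opn w).card / 2 = (defect s.opn s.cur).card / 2 + 1 by omega]
  calc _ ≤ ballot σ θ n j s.opn.card * ((2 * (0 : ℕ) + 1) * creditProd s.credit) *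
          (√(N : ℝ))⁻¹ ^ ((defect s.opn s.cur).card / 2 + 1) * flagFactor q (s.flags + 1) n := by
        gcongr
    _ = _ := by push_cast; ring

theorem potential_jump_fresh_even {q : ℝ} (n j : ℕ) {s : WalkState (Fin N)} {t : ℕ}
    (h : s.Consistent t)
    {w : Fin N} (hw : w ∉ s.vis) (hd : ¬ Odd (edgeDegree s.opn s.cur)) :
    potential σ θ q n j (s.step (false, w)) = (2 * (s.credit s.cur : ℝ) - 1)⁻¹ *
      (ballot σ θ n j s.opn.card * (creditProd s.credit *
        (√(N : ℝ))⁻¹ ^ ((defect s.opn s.cur).card / 2)) * flagFactor q s.flags n) := by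
  rw [step_jump]
  unfold potential
  have hwc : w ≠ s.cur := fun h' => hw (h' ▸ h.cur_vis)
  have hc := card_defect_move s.opn hwc
  rw [h.degree_eq_zero hw, if_neg hd, if_neg hd] at hc
  simp at hc
  have e1 : s.jumpCredit w = 0 := Nat.le_zero.1 (h.credit_vis w hw ▸ s.jumpCredit_le w)
  have e2 := creditProd_update_pred s.credit s.cur h.credit_pos
  simp only [jumpStep]
  rw [creditProd_update_succ, e1, if_neg (by simp [hd, hw]), ← e2, jumpCredit, if_neg hd, hc]
  have : (2 * (s.credit s.cur : ℝ) - 1) ≠ 0 := by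
    have : (1 : ℝ) ≤ s.credit s.cur := by exact_mod_cast h.credit_pos
    intro h'; linarith
  push_cast
  field_simp
  ring

end WalkState

end DeformedWigner

/-! ### Irregular walks are dominated by the potential. -/

namespace DeformedWigner

variable {σ θ : ℝ} {N : ℕ}

namespace WalkState

/-- Closings and openings towards new vertices form the regular part. Openings towards visited
vertices cost `O(t/N)`, because the multiplicities of all edges sum to at most `t`, and the credit
at the target costs a further factor linear in the number of flags. -/
theorem sum_matrix_potential_le {B q : ℝ} (hN : 1 ≤ N) (hσ : 0 < σ) (hθ : 0 ≤ θ)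
    (hB : σ ^ 2 ≤ B) (hq : 0 ≤ q) (n j : ℕ) (hnq : n * q < 1) {s : WalkState (Fin N)} {t : ℕ}
    (h : s.Consistent t) :
    ∑ w, stepWeight σ θ B s (true, w) * potential σ θ q n (j - 1) (s.step (true, w)) ≤
      (edgeDegree s.opn s.cur * (2 * (s.credit s.cur : ℝ) - 1)⁻¹ *
          ballot σ θ n (j - 1) (s.opn.card - 1)
        + σ ^ 2 * ballot σ θ n (j - 1) (s.opn.card + 1)) * (creditProd s.credit *
          (√(N : ℝ))⁻¹ ^ ((defect s.opn s.cur).card / 2)) * flagFactor q s.flags n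
      + 3 * B * (2 * t + 1) / (σ ^ 2 * N) * (1 + s.flags) * ballot σ θ (n + 1) j s.opn.card *
        (creditProd s.credit * (√(N : ℝ))⁻¹ ^ ((defect s.opn s.cur).card / 2)) *
        flagFactor q (s.flags + 1) n := by
  have hNpos : (0 : ℝ) < N := by exact_mod_cast hN
  set R := creditProd s.credit * (√(N : ℝ))⁻¹ ^ ((defect s.opn s.cur).card / 2) with hR
  have hR0 : 0 ≤ R := mul_nonneg (zero_le_one.trans (one_le_creditProd _)) (by positivity)
  have hF0 := flagFactor_nonneg hq hnq s.flags
  have hF1 := flagFactor_nonneg hq hnq (s.flags + 1)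
  set F0 := flagFactor q s.flags n
  set F1 := flagFactor q (s.flags + 1) n
  have hb1 := ballot_nonneg (σ := σ) hθ n (j - 1) (s.opn.card - 1)
  have hb2 := ballot_nonneg (σ := σ) hθ n (j - 1) (s.opn.card + 1)
  have hb3 := ballot_nonneg (σ := σ) hθ (n + 1) j s.opn.card
  have hup := ballot_up (σ := σ) hθ n j s.opn.card
  set b1 := ballot σ θ n (j - 1) (s.opn.card - 1)
  set b2 := ballot σ θ n (j - 1) (s.opn.card + 1)
  set b3 := ballot σ θ (n + 1) j s.opn.card
  have hB0 : 0 < B := (by positivity : 0 < σ ^ 2).trans_le hB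
  have hc : (1 : ℝ) ≤ s.credit s.cur := by exact_mod_cast h.credit_pos
  set ci := (2 * (s.credit s.cur : ℝ) - 1)⁻¹ with hci
  have hci0 : 0 ≤ ci := inv_nonneg.2 (by linarith)
  have hpt : ∀ w, stepWeight σ θ B s (true, w) * potential σ θ q n (j - 1) (s.step (true, w)) ≤
      (if s(s.cur, w) ∈ s.opn then ci * (b1 * R * F0) else 0)
      + σ ^ 2 / N * (b2 * R * F0)
      + (if w ∈ s.vis then B * (s.mult s(s.cur, w) + 1) / N * (3 * (1 + s.flags)) * (b2 * R * F1)
        else 0) := by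
    intro w
    have hx : 0 ≤ σ ^ 2 / N * (b2 * R * F0) := by positivity
    have hy : 0 ≤ B * (s.mult s(s.cur, w) + 1) / N * (3 * (1 + (s.flags : ℝ))) * (b2 * R * F1) := by
      positivity
    by_cases ho : s(s.cur, w) ∈ s.opn
    · rw [if_pos ho, potential_close n (j - 1) h ho]
      have : stepWeight σ θ B s (true, w) = 1 := by simp [stepWeight, ho]
      rw [this, one_mul, add_assoc]
      refine le_add_of_nonneg_right (add_nonneg hx ?_)
      split_ifs <;> positivity
    · rw [if_neg ho, zero_add]
      have hw : stepWeight σ θ B s (true, w)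
          = openWeight σ B s(s.cur, w) (s.mult s(s.cur, w)) / N := by simp [stepWeight, ho]
      by_cases hv : w ∈ s.vis
      · rw [if_pos hv, potential_reopen n (j - 1) hv ho, hw]
        refine le_add_of_nonneg_of_le hx ?_
        have h1 := openWeight_le (σ := σ) hB s(s.cur, w) (s.mult s(s.cur, w))
        have h2 := credit_le h w
        have h3 := openWeight_nonneg (σ := σ) hB0.le s(s.cur, w) (s.mult s(s.cur, w))
        rw [← mul_assoc]
        exact mul_le_mul_of_nonneg_right (mul_le_mul (by gcongr) h2 (by positivity)
          (by positivity)) (by positivity)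
      · rw [if_neg hv, add_zero, potential_fresh n (j - 1) h hv, hw]
        have : openWeight σ B s(s.cur, w) (s.mult s(s.cur, w)) = σ ^ 2 := by
          unfold openWeight
          rw [if_pos]
          refine ⟨?_, ?_⟩
          · rw [Sym2.eq_swap]; exact h.mult_vis w _ hv
          · rw [Sym2.mk_isDiag_iff]; exact fun h' => hv (h' ▸ h.cur_vis)
        rw [this]
  refine (Finset.sum_le_sum fun w _ => hpt w).trans ?_
  rw [Finset.sum_add_distrib, Finset.sum_add_distrib]
  have s1 : ∑ w, (if s(s.cur, w) ∈ s.opn then ci * (b1 * R * F0) else 0)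
      ≤ edgeDegree s.opn s.cur * (ci * (b1 * R * F0)) := by
    rw [← Finset.sum_filter, Finset.sum_const, nsmul_eq_mul]
    have : ((Finset.univ.filter fun w => s(s.cur, w) ∈ s.opn).card : ℝ)
      ≤ edgeDegree s.opn s.cur := by exact_mod_cast card_neighbors_le s.opn s.cur
    gcongr
  have s2 : ∑ _w : Fin N, σ ^ 2 / N * (b2 * R * F0) = σ ^ 2 * b2 * R * F0 := by
    rw [Finset.sum_const, Finset.card_univ, Fintype.card_fin, nsmul_eq_mul]
    field_simp
  have s3 : ∑ w, (if w ∈ s.vis then B * (s.mult s(s.cur, w) + 1) / N * (3 * (1 + s.flags)) *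
      (b2 * R * F1) else 0) ≤ 3 * B * (2 * t + 1) / (σ ^ 2 * N) * (1 + s.flags) * b3 * R * F1 := by
    rw [← Finset.sum_filter, Finset.filter_univ_mem]
    have e : ∀ w, B * (s.mult s(s.cur, w) + 1) / N * (3 * (1 + s.flags)) * (b2 * R * F1)
        = (s.mult s(s.cur, w) + 1) * (B / N * (3 * (1 + s.flags)) * (b2 * R * F1)) := by
      intro w; ring
    rw [Finset.sum_congr rfl fun w _ => e w, ← Finset.sum_mul]
    have hs := sum_mult_le h
    calc _ ≤ (2 * (t : ℝ) + 1) * (B / N * (3 * (1 + s.flags)) * (b2 * R * F1)) := by gcongr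
      _ = (2 * (t : ℝ) + 1) * (B / N * (3 * (1 + s.flags)) * ((σ ^ 2 * b2) / σ ^ 2 * R * F1)) := by
        field_simp
      _ ≤ (2 * (t : ℝ) + 1) * (B / N * (3 * (1 + s.flags)) * (b3 / σ ^ 2 * R * F1)) := by gcongr
      _ = _ := by field_simp
  rw [s2]
  calc _ ≤ edgeDegree s.opn s.cur * (ci * (b1 * R * F0)) + σ ^ 2 * b2 * R * F0 + _ :=
        add_le_add (add_le_add s1 le_rfl) s3
    _ = _ := by ring

/-- Jumps to visited vertices cost `O(t/N)`, those into the defect `8/√N` because they release a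
factor `√N`, and those from a vertex of odd degree to a new one `1/√N`. This is the source of the
rate `9/√N`. -/
theorem sum_jump_potential_le {B q : ℝ} (hN : 1 ≤ N) (hθ : 0 ≤ θ)
    (hq : 0 ≤ q) (n : ℕ) (hnq : n * q < 1) {s : WalkState (Fin N)} {t : ℕ}
    (h : s.Consistent t) :
    ∑ w, stepWeight σ θ B s (false, w) * potential σ θ q n 0 (s.step (false, w)) ≤
      (if Odd (edgeDegree s.opn s.cur) then 0 else (2 * (s.credit s.cur : ℝ) - 1)⁻¹ *
          (θ * ballot σ θ n 0 s.opn.card)) * (creditProd s.credit *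
          (√(N : ℝ))⁻¹ ^ ((defect s.opn s.cur).card / 2)) * flagFactor q s.flags n
      + (3 * (t + 1) / N + 9 / √(N : ℝ)) * (1 + s.flags) * ballot σ θ (n + 1) 0 s.opn.card *
        (creditProd s.credit * (√(N : ℝ))⁻¹ ^ ((defect s.opn s.cur).card / 2)) *
        flagFactor q (s.flags + 1) n := by
  have hNpos : (0 : ℝ) < N := by exact_mod_cast hN
  have hsN : 0 < √(N : ℝ) := Real.sqrt_pos.2 hNpos
  set R := creditProd s.credit * (√(N : ℝ))⁻¹ ^ ((defect s.opn s.cur).card / 2) with hR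
  have hR0 : 0 ≤ R := mul_nonneg (zero_le_one.trans (one_le_creditProd _)) (by positivity)
  have hF0 := flagFactor_nonneg hq hnq s.flags
  have hF1 := flagFactor_nonneg hq hnq (s.flags + 1)
  set F0 := flagFactor q s.flags n
  set F1 := flagFactor q (s.flags + 1) n
  have hb1 := ballot_nonneg (σ := σ) hθ n 0 s.opn.card
  have hst := ballot_stay (σ := σ) hθ n s.opn.card
  set b1 := ballot σ θ n 0 s.opn.card
  set b3 := ballot σ θ (n + 1) 0 s.opn.card
  have hc : (1 : ℝ) ≤ s.credit s.cur := by exact_mod_cast h.credit_pos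
  set ci := (2 * (s.credit s.cur : ℝ) - 1)⁻¹ with hci
  have hci0 : 0 ≤ ci := inv_nonneg.2 (by linarith)
  set E0 : ℝ := (if Odd (edgeDegree s.opn s.cur) then 0 else ci * (θ * b1)) with hE0
  have hE00 : 0 ≤ E0 := by rw [hE0]; split_ifs <;> positivity
  have hpt : ∀ w, stepWeight σ θ B s (false, w) * potential σ θ q n 0 (s.step (false, w)) ≤
      1 / N * (E0 * R * F0)
      + 1 / N * ((√(N : ℝ))⁻¹ * (b3 * R * F1))
      + (if w ∈ s.vis then (2 * s.credit w + 1) *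
          (1 + if w ∈ defect s.opn s.cur then √(N : ℝ) else 0) * (1 / N * (b3 * R * F1))
        else 0) := by
    intro w
    have hw : stepWeight σ θ B s (false, w) = θ / N := by simp [stepWeight]
    have hb30 : 0 ≤ b3 := (mul_nonneg hθ hb1).trans hst
    have hx : 0 ≤ 1 / N * (E0 * R * F0) := by positivity
    have hy : 0 ≤ 1 / N * ((√(N : ℝ))⁻¹ * (b3 * R * F1)) := by positivity
    rw [hw]
    by_cases hv : w ∈ s.vis
    · rw [if_pos hv]
      refine le_add_of_nonneg_of_le (add_nonneg hx hy) ?_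
      refine (mul_le_mul_of_nonneg_left (potential_jump_visited hN hθ hq n 0 hnq hv)
        (by positivity)).trans ?_
      set Y := (2 * (s.credit w : ℝ) + 1) * (1 + if w ∈ defect s.opn s.cur then √(N : ℝ) else 0)
      have hY : 0 ≤ Y := by positivity
      calc _ = Y * (1 / N * ((θ * b1) * R * F1)) := by ring
        _ ≤ _ := by gcongr
    · rw [if_neg hv, add_zero]
      by_cases ho : Odd (edgeDegree s.opn s.cur)
      · refine le_add_of_nonneg_of_le hx ?_
        refine (mul_le_mul_of_nonneg_left (potential_jump_fresh_odd hN hθ hq n 0 hnq h hv ho)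
          (by positivity)).trans ?_
        calc _ = 1 / N * ((√(N : ℝ))⁻¹ * ((θ * b1) * R * F1)) := by ring
          _ ≤ _ := by gcongr
      · refine le_add_of_le_of_nonneg ?_ hy
        rw [potential_jump_fresh_even n 0 h hv ho, hE0, if_neg ho]
        refine le_of_eq ?_
        ring
  refine (Finset.sum_le_sum fun w _ => hpt w).trans ?_
  rw [Finset.sum_add_distrib, Finset.sum_add_distrib]
  have s1 : ∀ x : ℝ, ∑ _w : Fin N, 1 / N * x = x := by
    intro x
    rw [Finset.sum_const, Finset.card_univ, Fintype.card_fin, nsmul_eq_mul]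
    field_simp
  have hb30 : 0 ≤ b3 := (mul_nonneg hθ hb1).trans hst
  have hsq : √(N : ℝ) * √(N : ℝ) = N := Real.mul_self_sqrt hNpos.le
  have s3 : ∑ w, (if w ∈ s.vis then (2 * (s.credit w : ℝ) + 1) *
          (1 + if w ∈ defect s.opn s.cur then √(N : ℝ) else 0) * (1 / N * (b3 * R * F1))
        else 0) ≤ (3 * (t + 1) / N + 8 / √(N : ℝ)) * (1 + s.flags) * (b3 * R * F1) := by
    rw [← Finset.sum_filter, Finset.filter_univ_mem, ← Finset.sum_mul]
    have e : ∑ w ∈ s.vis, (2 * (s.credit w : ℝ) + 1) *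
          (1 + if w ∈ defect s.opn s.cur then √(N : ℝ) else 0)
        ≤ (3 * (t + 1) + √(N : ℝ) * 8) * (1 + s.flags) := by
      simp only [mul_add, mul_one, mul_ite, mul_zero]
      rw [Finset.sum_add_distrib, ← Finset.sum_filter, ← Finset.sum_mul]
      have e1 := sum_credit_le h s.vis
      have e2 := sum_credit_le h (s.vis.filter (· ∈ defect s.opn s.cur))
      have e3 : ((s.vis.filter (· ∈ defect s.opn s.cur)).card : ℝ) ≤ 1 + 2 * s.flags := by
        have : (s.vis.filter (· ∈ defect s.opn s.cur)).card ≤ 1 + 2 * s.flags :=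
          (Finset.card_le_card fun x hx => (Finset.mem_filter.1 hx).2).trans h.defect_le
        exact_mod_cast this
      have e4 : (s.vis.card : ℝ) ≤ t + 1 := by exact_mod_cast h.vis_le
      -- With `r` flags the defect has at most `1 + 2r` vertices, so the sum is at most `3 (1 + 2r)
      -- + 2r = 3 + 8r`.
      have e5 : ∑ w ∈ s.vis.filter (· ∈ defect s.opn s.cur), (2 * (s.credit w : ℝ) + 1)
          ≤ 8 * (1 + s.flags) := by
        have : (0 : ℝ) ≤ s.flags := by positivity
        linarith
      have e6 : ∑ w ∈ s.vis, (2 * (s.credit w : ℝ) + 1) ≤ 3 * (t + 1) * (1 + s.flags) := by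
        have f1 : (0 : ℝ) ≤ s.flags := by positivity
        have f2 : (0 : ℝ) ≤ t := by positivity
        nlinarith [mul_nonneg f1 f2]
      have e7 := mul_le_mul_of_nonneg_right e5 hsN.le
      calc _ ≤ 3 * ((t : ℝ) + 1) * (1 + s.flags) + 8 * (1 + (s.flags : ℝ)) * √(N : ℝ) :=
            add_le_add e6 e7
        _ = _ := by ring
    calc _ ≤ (3 * (t + 1) + √(N : ℝ) * 8) * (1 + s.flags) * (1 / N * (b3 * R * F1)) := by gcongr
      _ = ((3 * (t + 1) + √(N : ℝ) * 8) / N) * (1 + s.flags) * (b3 * R * F1) := by ring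
      _ = _ := by
        congr 2
        rw [add_div]
        congr 1
        rw [div_eq_div_iff hNpos.ne' hsN.ne']
        linear_combination 8 * hsq
  rw [s1, s1]
  have hfl : (0 : ℝ) ≤ s.flags := by positivity
  have s2 : (√(N : ℝ))⁻¹ * (b3 * R * F1) ≤ 1 / √(N : ℝ) * (1 + s.flags) * (b3 * R * F1) := by
    rw [one_div]
    gcongr
    exact le_mul_of_one_le_right (by positivity) (by linarith)
  calc _ ≤ E0 * R * F0 + 1 / √(N : ℝ) * (1 + s.flags) * (b3 * R * F1) + _ :=
        add_le_add (add_le_add le_rfl s2) s3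
    _ = _ := by ring

/-- At most `2c - 1` closings share the factor `(2c - 1)⁻¹`. If the degree is even, at most `2c - 2`
closings exist, and the jump takes the free place: by `ballot_shift` it weighs no more than a
closing. With no open edge the jump is the level step of the recursion. -/
theorem regular_ballot_le (hθ : 0 ≤ θ) (n j : ℕ) {s : WalkState (Fin N)} {t : ℕ}
    (h : s.Consistent t) :
    edgeDegree s.opn s.cur * (2 * (s.credit s.cur : ℝ) - 1)⁻¹ *
          ballot σ θ n (j - 1) (s.opn.card - 1)
        + σ ^ 2 * ballot σ θ n (j - 1) (s.opn.card + 1)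
      + (if j = 0 then (if Odd (edgeDegree s.opn s.cur) then 0
          else (2 * (s.credit s.cur : ℝ) - 1)⁻¹ * (θ * ballot σ θ n 0 s.opn.card)) else 0)
      ≤ ballot σ θ (n + 1) j s.opn.card := by
  have hc : (1 : ℝ) ≤ s.credit s.cur := by exact_mod_cast h.credit_pos
  set c := (2 * (s.credit s.cur : ℝ) - 1) with hcdef
  have hc0 : 0 < c := by linarith
  have hci : c⁻¹ ≤ 1 := inv_le_one_of_one_le₀ (by linarith)
  have hci0 : 0 ≤ c⁻¹ := by positivity
  have hd := h.degree_le s.cur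
  rw [if_pos rfl] at hd
  rcases Nat.eq_zero_or_pos s.opn.card with h0 | h0
  · have ho : s.opn = ∅ := Finset.card_eq_zero.1 h0
    rw [ho]
    have hb := mul_nonneg hθ (ballot_nonneg (σ := σ) hθ n 0 0)
    simp only [edgeDegree, Finset.sum_empty, Finset.card_empty, ballot]
    simp only [Nat.cast_zero, zero_mul, zero_add, Nat.not_odd_zero, if_false]
    split_ifs with h1
    · nlinarith
    · exact le_rfl
  · obtain ⟨k, hk⟩ : ∃ k, s.opn.card = k + 1 := ⟨s.opn.card - 1, by omega⟩
    rw [hk, Nat.add_sub_cancel]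
    simp only [ballot]
    have hb := ballot_nonneg (σ := σ) hθ n (j - 1) k
    have hd1 : (edgeDegree s.opn s.cur : ℝ) + 1 ≤ 2 * s.credit s.cur := by exact_mod_cast hd
    have hd1' : (edgeDegree s.opn s.cur : ℝ) * c⁻¹ ≤ 1 := by
      rw [← div_eq_mul_inv, div_le_one hc0]; linarith
    split_ifs with h1 h2
    · nlinarith [mul_le_mul_of_nonneg_right hd1' hb]
    · subst h1
      have hsh := ballot_shift (σ := σ) (θ := θ) n k
      have hd2 : edgeDegree s.opn s.cur + 2 ≤ 2 * s.credit s.cur := by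
        rw [Nat.not_odd_iff_even] at h2
        obtain ⟨x, hx⟩ := h2
        omega
      have hd2' : (edgeDegree s.opn s.cur : ℝ) + 2 ≤ 2 * s.credit s.cur := by exact_mod_cast hd2
      have hd3 : ((edgeDegree s.opn s.cur : ℝ) + 1) * c⁻¹ ≤ 1 := by
        rw [← div_eq_mul_inv, div_le_one hc0]; linarith
      have e1 := mul_le_mul_of_nonneg_left hsh hci0
      have e2 := mul_le_mul_of_nonneg_right hd3 hb
      simp only [Nat.zero_sub] at e2 ⊢
      linarith
    · nlinarith [mul_le_mul_of_nonneg_right hd1' hb]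

/-- The irregular closed walks are dominated by the potential. -/
theorem irregularSum_le {B q : ℝ} (hN : 1 ≤ N) (hσ : 0 < σ) (hθ : 0 ≤ θ)
    (hB : σ ^ 2 ≤ B) (hq : 0 ≤ q) (T : ℕ) (hTq : T * q < 1)
    (hU : 3 * B * (2 * T + 1) / (σ ^ 2 * N) ≤ q) (n j : ℕ) {s : WalkState (Fin N)} {t : ℕ}
    (h : s.Consistent t) (ht : t + n ≤ T)
    (hA : n ≤ j ∨ 3 * B * (2 * T + 1) / (σ ^ 2 * N) + (3 * (T + 1) / N + 9 / √(N : ℝ)) ≤ q) :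
    irregularSum σ θ B n j s ≤ potential σ θ q n j s := by
  have hB0 : 0 < B := (by positivity : 0 < σ ^ 2).trans_le hB
  induction n generalizing j s t with
  | zero =>
    unfold irregularSum potential
    rw [flagFactor_zero_right]
    change (if StartsWith j [] ∧ s.opn = ∅ ∧ 1 ≤ s.flags then (1 : ℝ) else 0) ≤ _
    have hc := one_le_creditProd s.credit
    by_cases hcase : s.opn = ∅ ∧ 1 ≤ s.flags
    -- Without open edges the defect is the current vertex alone, and `1 / 2 = 0`: a closed walk has
    -- repaid every factor `1/√N`.
    · have hd : defect s.opn s.cur = {s.cur} := by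
        ext v; simp [mem_defect, hcase.1, edgeDegree]
      have h1 : s.flags ≠ 0 := by omega
      rw [if_pos (show StartsWith j [] ∧ s.opn = ∅ ∧ 1 ≤ s.flags from
        ⟨by simp [StartsWith], hcase⟩), hd, if_neg h1, hcase.1]
      simpa [ballot] using hc
    · rw [if_neg (fun h' : StartsWith j [] ∧ s.opn = ∅ ∧ 1 ≤ s.flags => hcase h'.2)]
      have hb := ballot_nonneg (σ := σ) hθ 0 j s.opn.card
      split_ifs
      · simp
      · positivity
  | succ n ih =>
    have hTq' : (n + 1 : ℕ) * q < 1 := by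
      refine lt_of_le_of_lt (mul_le_mul_of_nonneg_right ?_ hq) hTq
      exact_mod_cast (by omega : n + 1 ≤ T)
    have hnq : n * q < 1 := by
      refine lt_of_le_of_lt (mul_le_mul_of_nonneg_right ?_ hq) hTq'
      exact_mod_cast Nat.le_succ n
    have hF0 := flagFactor_nonneg hq hnq s.flags
    have hF1 := flagFactor_nonneg hq hnq (s.flags + 1)
    have hFs := flagFactor_succ hq hTq' s.flags
    have htT : (t : ℝ) ≤ T := by exact_mod_cast (by omega : t ≤ T)
    have hreg := regular_ballot_le (σ := σ) hθ n j h
    have hNpos : (0 : ℝ) < N := by exact_mod_cast hN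
    have h1 : ∑ w, stepWeight σ θ B s (true, w) *
        irregularSum σ θ B n (j - 1) (s.step (true, w)) ≤ _ :=
      (Finset.sum_le_sum fun w _ => mul_le_mul_of_nonneg_left
        (ih (j - 1) (h.step (true, w)) (by omega)
          (hA.imp (fun h' => by omega) id)) (stepWeight_nonneg hθ hB0.le s _)).trans
        (sum_matrix_potential_le hN hσ hθ hB hq n j hnq h)
    rw [irregularSum_succ]
    set R := creditProd s.credit * (√(N : ℝ))⁻¹ ^ ((defect s.opn s.cur).card / 2) with hR
    have hR0 : 0 ≤ R := mul_nonneg (zero_le_one.trans (one_le_creditProd _)) (by positivity)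
    have hb3 := ballot_nonneg (σ := σ) hθ (n + 1) j s.opn.card
    have hpot : potential σ θ q (n + 1) j s
        = ballot σ θ (n + 1) j s.opn.card * R * flagFactor q s.flags (n + 1) := by
      unfold potential; rw [hR]; ring
    rw [hpot]
    have hfinal : ∀ q' : ℝ, q' ≤ q → ballot σ θ (n + 1) j s.opn.card * R * flagFactor q s.flags n
        + q' * (1 + s.flags) * ballot σ θ (n + 1) j s.opn.card * R * flagFactor q (s.flags + 1) n
        ≤ ballot σ θ (n + 1) j s.opn.card * R * flagFactor q s.flags (n + 1) := by
      intro q' hq'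
      calc _ ≤ ballot σ θ (n + 1) j s.opn.card * R * flagFactor q s.flags n
          + q * (1 + s.flags) * ballot σ θ (n + 1) j s.opn.card * R *
            flagFactor q (s.flags + 1) n := by gcongr
        _ = ballot σ θ (n + 1) j s.opn.card * R *
            (flagFactor q s.flags n + q * (1 + s.flags) * flagFactor q (s.flags + 1) n) := by ring
        _ ≤ _ := by gcongr
    have hqU : 3 * B * (2 * t + 1) / (σ ^ 2 * N) ≤ 3 * B * (2 * T + 1) / (σ ^ 2 * N) := by gcongr
    have hqA : 3 * ((t : ℝ) + 1) / N + 9 / √(N : ℝ) ≤ 3 * (T + 1) / N + 9 / √(N : ℝ) := by gcongr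
    by_cases hj : j = 0
    · rw [if_pos hj] at hreg ⊢
      subst hj
      -- A jump is allowed here, so the alternative that forbids jumps throughout, with its smaller
      -- rate, is excluded.
      have hA' := hA.resolve_left (by omega)
      have h2 : ∑ w, stepWeight σ θ B s (false, w) *
          irregularSum σ θ B n 0 (s.step (false, w)) ≤ _ :=
        (Finset.sum_le_sum fun w _ => mul_le_mul_of_nonneg_left
          (ih 0 (h.step (false, w)) (by omega) (Or.inr hA'))
          (stepWeight_nonneg hθ hB0.le s _)).trans
          (sum_jump_potential_le hN hθ hq n hnq h)
      refine (add_le_add h1 h2).trans (le_trans ?_ (hfinal _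
        ((add_le_add hqU hqA).trans hA')))
      have e1 := mul_le_mul_of_nonneg_right (mul_le_mul_of_nonneg_right hreg hR0) hF0
      rw [← hR]
      linarith
    · rw [if_neg hj] at hreg ⊢
      rw [add_zero] at hreg ⊢
      refine h1.trans (le_trans ?_ (hfinal _ (hqU.trans hU)))
      have e1 := mul_le_mul_of_nonneg_right (mul_le_mul_of_nonneg_right hreg hR0) hF0
      linarith

/-- Irregular closed walks from a given vertex. -/
theorem irregularSum_start_le {B q : ℝ} (hN : 1 ≤ N) (hσ : 0 < σ) (hθ : 0 ≤ θ)
    (hB : σ ^ 2 ≤ B) (hq : 0 ≤ q) (T : ℕ) (hTq : T * q < 1)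
    (hU : 3 * B * (2 * T + 1) / (σ ^ 2 * N) ≤ q) (n j : ℕ) (x : Fin N) (hn : n ≤ T)
    (hA : n ≤ j ∨ 3 * B * (2 * T + 1) / (σ ^ 2 * N) + (3 * (T + 1) / N + 9 / √(N : ℝ)) ≤ q) :
    irregularSum σ θ B n j (start x) ≤ ballot σ θ n j 0 * ((1 - n * q)⁻¹ - 1) := by
  refine (irregularSum_le hN hσ hθ hB hq T hTq hU n j (consistent_start x) (by omega) hA).trans
    (le_of_eq ?_)
  have hd : defect (start x).opn (start x).cur = {x} := by
    ext v; simp [mem_defect, start, edgeDegree]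
  have hc : creditProd (start x).credit = 1 := by
    refine Finset.prod_eq_one fun v _ => ?_
    by_cases h : v = x <;> simp [start, h, oddFactorial]
  unfold potential
  rw [hd, hc]
  simp [start, flagFactor]

end WalkState

end DeformedWigner

/-! ### Common moment properties of the two ensembles. -/

namespace DeformedWigner

variable {σ θ : ℝ} {N : ℕ}

section independence

variable {Ω : Type*} [MeasurableSpace Ω] {P : Measure Ω}

/-- Functions of disjoint blocks of independent variables are independent. -/
theorem iIndepFun_of_blocks [IsProbabilityMeasure P] {ι κ : Type*} [DecidableEq κ]
    {f : ι → Ω → ℝ} (hf : ∀ c, Measurable (f c)) (hind : iIndepFun f P) (g : ι → κ)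
    {Y : κ → Ω → ℂ}
    (hY : ∀ e, Measurable[⨆ c ∈ {c | g c = e}, MeasurableSpace.comap (f c) inferInstance] (Y e)) :
    iIndepFun Y P := by
  rw [iIndepFun_iff_measure_inter_preimage_eq_mul]
  intro S sets hS
  induction S using Finset.induction_on with
  | empty => simp
  | insert e S he ih =>
    rw [Finset.set_biInter_insert, Finset.prod_insert he,
      ← ih fun i hi => hS i (Finset.mem_insert_of_mem hi)]
    have hle : ∀ c, MeasurableSpace.comap (f c) inferInstance ≤ (inferInstance : MeasurableSpace Ω) :=
      fun c => (hf c).comap_le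
    have hi := indep_iSup_of_disjoint hle hind.iIndep
      (S := {c | g c = e}) (T := {c | g c ∈ S}) (by
        rw [Set.disjoint_left]
        intro c hc hc'
        simp only [Set.mem_ofPred_eq] at hc hc'
        exact he (hc ▸ hc'))
    refine (Indep_iff _ _ _).1 hi _ _ ?_ ?_
    · exact hY e (hS e (Finset.mem_insert_self e S))
    · refine Finset.measurableSet_biInter (m := ⨆ c ∈ {c | g c ∈ S},
        MeasurableSpace.comap (f c) inferInstance) S fun i hi' => ?_
      have hsub : (⨆ c ∈ {c | g c = i}, MeasurableSpace.comap (f c) inferInstance) ≤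
          ⨆ c ∈ {c | g c ∈ S}, MeasurableSpace.comap (f c) inferInstance := by
        refine biSup_mono fun c hc => ?_
        simp only [Set.mem_ofPred_eq] at hc ⊢
        exact hc ▸ hi'
      exact hsub _ (hY i (hS i (Finset.mem_insert_of_mem hi')))

end independence

/-- The properties shared by the real and the complex ensembles which enter the moment method. -/
structure WignerLike {Ω : Type*} [MeasurableSpace Ω] (σ b : ℝ) (P : Measure Ω)
    (W : Ω → Matrix (Fin N) (Fin N) ℂ) : Prop where
  measurable : ∀ i j, Measurable fun ω => W ω i j
  herm : ∀ ω i j, W ω j i = star (W ω i j)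
  indep : iIndepFun (fun (e : Sym2 (Fin N)) ω => W ω e.inf e.sup) P
  symm : ∀ i j, IdentDistrib (fun ω => W ω i j) (fun ω => -W ω i j) P P
  var : ∀ i j, i ≠ j → ∫ ω, ‖W ω i j‖ ^ 2 ∂P = σ ^ 2
  integrable : ∀ i j (k : ℕ), Integrable (fun ω => ‖W ω i j‖ ^ (2 * k)) P
  moment : ∀ i j (k : ℕ), 1 ≤ k → ∫ ω, ‖W ω i j‖ ^ (2 * k) ∂P ≤ (b * k) ^ k

section ensembles

variable {Ω : Type*} [MeasurableSpace Ω] {P : Measure Ω} [IsProbabilityMeasure P]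
  {W : Ω → Matrix (Fin N) (Fin N) ℂ} {K β : ℝ}

theorem IsRealWigner.wignerLike (h : IsRealWigner σ K β P W) (hβ : 0 < β) :
    WignerLike σ (2 * β) P W := by
  have hre : ∀ ω i j, W ω i j = ((W ω i j).re : ℂ) := fun ω i j =>
    Complex.ext (by simp) (by simp [h.real ω i j])
  have hnorm : ∀ ω i j, ‖W ω i j‖ = |(W ω i j).re| := fun ω i j => by
    rw [hre ω i j, Complex.norm_real]; simp
  have hpow : ∀ ω i j (k : ℕ), ‖W ω i j‖ ^ (2 * k) = (W ω i j).re ^ (2 * k) := fun ω i j k => by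
    rw [hnorm, (even_two_mul k).pow_abs]
  refine ⟨h.measurable, fun ω i j => ?_, ?_, fun i j => ?_, fun i j hij => ?_, fun i j k => ?_,
    fun i j k hk => ?_⟩
  · rw [hre ω i j, ← (h.symmetric ω).apply i j, hre ω j i]
    simp
  · have h1 := h.indep.precomp (g := fun e : Sym2 (Fin N) => Sym2.sortEquiv e)
      Sym2.sortEquiv.injective
    have h2 := h1.comp (fun _ x => ((x : ℝ) : ℂ)) fun _ => Complex.measurable_ofReal
    convert h2 using 2 with e
    ext ω
    exact hre ω _ _
  · have h1 := (h.symm i j).comp Complex.measurable_ofReal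
    convert h1 using 1
    · ext ω; exact hre ω i j
    · ext ω
      simp only [Function.comp, Complex.ofReal_neg]
      rw [← hre ω i j]
  · have e : ∀ ω, ‖W ω i j‖ ^ 2 = (W ω i j).re ^ 2 := fun ω => hpow ω i j 1
    simp only [e]
    rcases lt_or_gt_of_ne hij with hlt | hlt
    · exact h.var i j hlt
    · rw [← h.var j i hlt]
      congr 1; ext ω
      rw [(h.symmetric ω).apply]
  · simp only [hpow]
    rcases Nat.eq_zero_or_pos k with rfl | hk
    · simp
    · exact h.integrable i j k hk
  · simp only [hpow]
    refine (h.moment i j k hk).trans (pow_le_pow_left₀ (by positivity) ?_ k)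
    have : 0 ≤ β * k := by positivity
    nlinarith

theorem IsComplexWigner.measurable_coord {P : Measure Ω} (h : IsComplexWigner σ K β P W) (c) :
    Measurable (hermitianCoord W c) := by
  rcases c with i | q | q
  · exact Complex.measurable_re.comp (h.measurable _ _)
  · exact Complex.measurable_re.comp (h.measurable _ _)
  · exact Complex.measurable_im.comp (h.measurable _ _)

/-- The edge to which a real coordinate belongs. -/
def coordEdge : Fin N ⊕ UpperPair N ⊕ UpperPair N → Sym2 (Fin N)
  | .inl i => s(i, i)
  | .inr (.inl q) => s(q.1.1, q.1.2)
  | .inr (.inr q) => s(q.1.1, q.1.2)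

/-- The real coordinates attached to one edge form a block, so independence passes to the entries.
The constant `2β` comes from `‖z‖^(2k) ≤ 2^(k-1) (Re^(2k) + Im^(2k))`. -/
theorem IsComplexWigner.wignerLike (h : IsComplexWigner σ K β P W) :
    WignerLike σ (2 * β) P W := by
  have hherm : ∀ ω i j, W ω j i = star (W ω i j) := fun ω i j => ((h.hermitian ω).apply j i).symm
  have hdiag : ∀ ω i, (W ω i i).im = 0 := fun ω i => by
    have := congrArg Complex.im (hherm ω i i)
    simp at this
    linarith
  have hsq : ∀ ω i j, ‖W ω i j‖ ^ 2 = (W ω i j).re ^ 2 + (W ω i j).im ^ 2 := fun ω i j => by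
    rw [Complex.sq_norm, Complex.normSq_apply]; ring
  have hpow : ∀ ω i j (k : ℕ), ‖W ω i j‖ ^ (2 * k) ≤
      2 ^ (k - 1) * ((W ω i j).re ^ (2 * k) + (W ω i j).im ^ (2 * k)) := fun ω i j k => by
    rw [pow_mul, hsq, pow_mul, pow_mul]
    exact add_pow_le (sq_nonneg _) (sq_nonneg _) k
  have hint : ∀ i j (k : ℕ), Integrable (fun ω => ‖W ω i j‖ ^ (2 * k)) P := fun i j k => by
    rcases Nat.eq_zero_or_pos k with rfl | hk
    · simp
    · refine Integrable.mono' (((h.integrable_re i j k hk).add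
        (h.integrable_im i j k hk)).const_mul (2 ^ (k - 1))) ?_ ?_
      · exact ((h.measurable i j).norm.pow_const _).aestronglyMeasurable
      · refine Filter.Eventually.of_forall fun ω => ?_
        rw [Real.norm_of_nonneg (by positivity)]
        exact hpow ω i j k
  refine ⟨h.measurable, hherm, ?_, fun i j => ?_, fun i j hij => ?_, hint,
    fun i j k hk => ?_⟩
  · refine iIndepFun_of_blocks h.measurable_coord h.indep coordEdge fun e => ?_
    have hm : ∀ c, coordEdge c = e →
        Measurable[⨆ c ∈ {c | coordEdge c = e},
          MeasurableSpace.comap (hermitianCoord W c) inferInstance] (hermitianCoord W c) := by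
      intro c hc
      have h1 : MeasurableSpace.comap (hermitianCoord W c) inferInstance ≤
        ⨆ c ∈ {c | coordEdge c = e}, MeasurableSpace.comap (hermitianCoord W c) inferInstance :=
        le_biSup (fun c => MeasurableSpace.comap (hermitianCoord W c) inferInstance) hc
      exact Measurable.mono (comap_measurable _) h1 le_rfl
    rcases e.inf_le_sup.lt_or_eq with hlt | heq
    · have he : s(e.inf, e.sup) = e := by
        have := Sym2.sortEquiv.left_inv e
        exact this
      have h1 := hm (.inr (.inl ⟨(e.inf, e.sup), hlt⟩)) he
      have h2 := hm (.inr (.inr ⟨(e.inf, e.sup), hlt⟩)) he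
      have e1 : (fun ω => W ω e.inf e.sup) = fun ω =>
          ((hermitianCoord W (.inr (.inl ⟨(e.inf, e.sup), hlt⟩)) ω : ℝ) : ℂ) +
          ((hermitianCoord W (.inr (.inr ⟨(e.inf, e.sup), hlt⟩)) ω : ℝ) : ℂ) * Complex.I := by
        ext ω
        exact (Complex.re_add_im _).symm
      rw [e1]
      exact (Complex.measurable_ofReal.comp h1).add
        ((Complex.measurable_ofReal.comp h2).mul_const _)
    · have he : s(e.inf, e.inf) = e := by
        have : s(e.inf, e.sup) = e := Sym2.sortEquiv.left_inv e
        rwa [← heq] at this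
      have h1 := hm (.inl e.inf) he
      have e1 : (fun ω => W ω e.inf e.sup) = fun ω =>
          ((hermitianCoord W (.inl e.inf) ω : ℝ) : ℂ) := by
        ext ω
        rw [← heq]
        exact Complex.ext rfl (by simp [hdiag])
      rw [e1]
      exact Complex.measurable_ofReal.comp h1
  · have key : ∀ i j, i ≤ j → IdentDistrib (fun ω => W ω i j) (fun ω => -W ω i j) P P := by
      intro i j hij
      rcases hij.lt_or_eq with hlt | rfl
      · have hne : (.inr (.inl ⟨(i, j), hlt⟩) : Fin N ⊕ UpperPair N ⊕ UpperPair N) ≠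
          .inr (.inr ⟨(i, j), hlt⟩) := by simp
        have hi := h.indep.indepFun hne
        have hi' : IndepFun (fun ω => -hermitianCoord W (.inr (.inl ⟨(i, j), hlt⟩)) ω)
            (fun ω => -hermitianCoord W (.inr (.inr ⟨(i, j), hlt⟩)) ω) P :=
          hi.comp measurable_neg measurable_neg
        have hp := (h.symm (.inr (.inl ⟨(i, j), hlt⟩))).prodMk (h.symm (.inr (.inr ⟨(i, j), hlt⟩)))
          hi hi'
        have hu : Measurable fun x : ℝ × ℝ => (x.1 : ℂ) + x.2 * Complex.I := by fun_prop
        have hc := hp.comp hu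
        convert hc using 1
        · ext ω; exact (Complex.re_add_im _).symm
        · ext ω
          simp only [Function.comp, hermitianCoord, Complex.ofReal_neg, neg_mul]
          rw [← neg_add, Complex.re_add_im]
      · have hc := (h.symm (.inl i)).comp Complex.measurable_ofReal
        have e : ∀ ω, W ω i i = ((W ω i i).re : ℂ) := fun ω => Complex.ext rfl (by simp [hdiag])
        convert hc using 1
        · ext ω; exact e ω
        · ext ω
          simp only [Function.comp, hermitianCoord, Complex.ofReal_neg]
          rw [← e ω]
    rcases le_total i j with hij | hij
    · exact key i j hij
    · have hc := (key j i hij).comp (u := star) (by exact continuous_star.measurable)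
      convert hc using 1
      · ext ω; simp [Function.comp, hherm ω j i]
      · ext ω; simp [Function.comp, hherm ω j i]
  · have key : ∀ i j, i < j → ∫ ω, ‖W ω i j‖ ^ 2 ∂P = σ ^ 2 := by
      intro i j hlt
      simp only [hsq]
      rw [integral_add (h.integrable_re i j 1 le_rfl) (h.integrable_im i j 1 le_rfl),
        h.var_re i j hlt, h.var_im i j hlt]
      ring
    rcases lt_or_gt_of_ne hij with hlt | hlt
    · exact key i j hlt
    · rw [← key j i hlt]
      congr 1; ext ω
      rw [hherm ω j i, norm_star]
  · calc ∫ ω, ‖W ω i j‖ ^ (2 * k) ∂P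
        ≤ ∫ ω, 2 ^ (k - 1) * ((W ω i j).re ^ (2 * k) + (W ω i j).im ^ (2 * k)) ∂P :=
          integral_mono (hint i j k) (((h.integrable_re i j k hk).add
            (h.integrable_im i j k hk)).const_mul (2 ^ (k - 1))) fun ω => hpow ω i j k
      _ = 2 ^ (k - 1) * (∫ ω, (W ω i j).re ^ (2 * k) ∂P + ∫ ω, (W ω i j).im ^ (2 * k) ∂P) := by
          rw [integral_const_mul, integral_add (h.integrable_re i j k hk)
            (h.integrable_im i j k hk)]
      _ ≤ 2 ^ (k - 1) * ((β * k) ^ k + (β * k) ^ k) := by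
          gcongr
          · exact h.moment_re i j k hk
          · exact h.moment_im i j k hk
      _ = (2 * β * k) ^ k := by
          obtain ⟨m, rfl⟩ : ∃ m, k = m + 1 := ⟨k - 1, by omega⟩
          rw [Nat.add_sub_cancel, mul_assoc 2 β, mul_pow 2, pow_succ (2 : ℝ) m]; ring

end ensembles

/-- Product of the weights of the first `k` openings of the edge `e`. -/
noncomputable def edgeWeight {V : Type*} (σ B : ℝ) (e : Sym2 V) (k : ℕ) : ℝ :=
  ∏ i ∈ Finset.range k, openWeight σ B e i

/-- From `k^k ≤ e^k k!` the moment is at most `(b e)^k k!`. The opening weights multiply to `B^k k!`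
on a loop and to `σ² B^(k-1) k!` otherwise, whence the two conditions on `B`. A single pair on a
proper edge is excluded: there the variance itself gives `σ²`. -/
theorem moment_le_edgeWeight {V : Type*} {b B : ℝ} (hb : 0 ≤ b)
    (hB1 : b * Real.exp 1 ≤ B) (hB2 : (b * Real.exp 1) ^ 2 ≤ σ ^ 2 * B) (e : Sym2 V) (k : ℕ)
    (hk : 1 ≤ k) (hke : e.IsDiag ∨ 2 ≤ k) : (b * k) ^ k ≤ edgeWeight σ B e k := by
  have hB0 : 0 ≤ B := le_trans (by positivity) hB1
  have h1 : (b * k) ^ k ≤ (b * Real.exp 1) ^ k * k.factorial := by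
    have h := Real.pow_div_factorial_le_exp (k : ℝ) (by positivity) k
    rw [div_le_iff₀ (by positivity)] at h
    calc (b * k) ^ k = b ^ k * (k : ℝ) ^ k := mul_pow _ _ _
      _ ≤ b ^ k * (Real.exp k * k.factorial) := by gcongr
      _ = _ := by rw [mul_pow, ← Real.exp_nat_mul, mul_one]; ring
  refine h1.trans ?_
  by_cases hd : e.IsDiag
  · have e1 : edgeWeight σ B e k = B ^ k * k.factorial := by
      unfold edgeWeight openWeight
      simp only [hd, not_true, and_false, if_false]
      rw [Finset.prod_mul_distrib, Finset.prod_const, Finset.card_range,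
        ← Finset.prod_range_add_one_eq_factorial]
      push_cast; rfl
    rw [e1]
    gcongr
  · obtain ⟨m, rfl⟩ : ∃ m, k = m + 2 := ⟨k - 2, by rcases hke with h | h; exact absurd h hd; omega⟩
    have e1 : edgeWeight σ B e (m + 2) = σ ^ 2 * B * B ^ m * (m + 2).factorial := by
      unfold edgeWeight
      rw [Finset.prod_range_succ', ← Finset.prod_range_add_one_eq_factorial,
        Finset.prod_range_succ' (fun x => x + 1) (m + 1)]
      unfold openWeight
      simp only [hd, Nat.add_eq_zero_iff, one_ne_zero, and_false, if_false,
        Finset.prod_mul_distrib, Finset.prod_const, Finset.card_range, not_false_iff, and_true,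
        if_true]
      push_cast; ring
    rw [e1]
    refine mul_le_mul_of_nonneg_right ?_ (by positivity)
    rw [add_comm m 2, pow_add]
    gcongr

end DeformedWigner

/-! ### Expectations of products of entries. -/

namespace DeformedWigner

variable {σ θ : ℝ} {N : ℕ}

theorem list_prod_map_eq_prod_filter {α κ M : Type*} [Fintype κ] [DecidableEq κ] [CommMonoid M]
    (g : α → κ) (f : α → M) (l : List α) :
    (l.map f).prod = ∏ e, ((l.filter fun a => g a = e).map f).prod := by
  induction l with
  | nil => simp
  | cons a l ih =>
    have h : ∀ e, (((a :: l).filter fun a => g a = e).map f).prod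
        = (if g a = e then f a else 1) * ((l.filter fun a => g a = e).map f).prod := by
      intro e
      by_cases h : g a = e <;> simp [h]
    simp only [h]
    rw [Finset.prod_mul_distrib, ← ih]
    simp

/-- The edge underlying a directed step. -/
def dirEdge {V : Type*} (d : V × V) : Sym2 V := s(d.1, d.2)

/-- Number of directed steps of a list along a given edge. -/
def edgeCount (ds : List (Fin N × Fin N)) (e : Sym2 (Fin N)) : ℕ :=
  (ds.filter fun d => dirEdge d = e).length

section expectation

variable {Ω : Type*} [MeasurableSpace Ω] {P : Measure Ω} [IsProbabilityMeasure P]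
  {W : Ω → Matrix (Fin N) (Fin N) ℂ} {b : ℝ}

/-- Expectation of a product of matrix entries. -/
noncomputable def expect (P : Measure Ω) (W : Ω → Matrix (Fin N) (Fin N) ℂ)
    (ds : List (Fin N × Fin N)) : ℂ :=
  ∫ ω, (ds.map fun d => W ω d.1 d.2).prod ∂P

theorem WignerLike.memLp {P : Measure Ω} (h : WignerLike σ b P W) (i j : Fin N) (k : ℕ) (hk : 1 ≤ k) :
    MemLp (fun ω => W ω i j) (2 * k : ℕ) P := by
  rw [← integrable_norm_rpow_iff (h.measurable i j).aestronglyMeasurable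
    (by simp; omega) (ENNReal.natCast_ne_top _)]
  have := h.integrable i j k
  simpa [← Real.rpow_natCast] using this

theorem WignerLike.integrable_prod {ι : Type*} (h : WignerLike σ b P W) (S : Finset ι)
    (d : ι → Fin N × Fin N) :
    Integrable (fun ω => ∏ t ∈ S, W ω (d t).1 (d t).2) P := by
  rcases S.eq_empty_or_nonempty with rfl | hS
  · simp
  · have h1 : MemLp (fun ω => ∏ t ∈ S, W ω (d t).1 (d t).2)
        -- Hölder with every exponent equal to `2 |S|`, so that the reciprocals sum to at most one.
        (∑ t ∈ S, (((2 * S.card : ℕ) : ENNReal))⁻¹)⁻¹ P :=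
      MemLp.prod' (p := fun _ => ((2 * S.card : ℕ) : ENNReal))
        fun t _ => h.memLp _ _ _ (Finset.card_pos.2 hS)
    refine h1.integrable ?_
    rw [Finset.sum_const, nsmul_eq_mul, ENNReal.one_le_inv]
    have h0 : ((2 * S.card : ℕ) : ENNReal) ≠ 0 := by
      have := Finset.card_pos.2 hS
      simp; exact hS.ne_empty
    calc (S.card : ENNReal) * ((2 * S.card : ℕ) : ENNReal)⁻¹
        ≤ ((2 * S.card : ℕ) : ENNReal) * ((2 * S.card : ℕ) : ENNReal)⁻¹ := by
          gcongr; omega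
      _ = 1 := ENNReal.mul_inv_cancel h0 (ENNReal.natCast_ne_top _)

/-- The value of the entry along `d` as a function of the entry above the diagonal. -/
noncomputable def entryOf (d : Fin N × Fin N) (z : ℂ) : ℂ := if d.1 ≤ d.2 then z else star z

theorem measurable_entryOf (d : Fin N × Fin N) : Measurable (entryOf d) := by
  unfold entryOf
  split_ifs
  · exact measurable_id
  · exact continuous_star.measurable

theorem entryOf_neg (d : Fin N × Fin N) (z : ℂ) : entryOf d (-z) = -entryOf d z := by
  unfold entryOf; split_ifs <;> simp

theorem norm_entryOf (d : Fin N × Fin N) (z : ℂ) : ‖entryOf d z‖ = ‖z‖ := by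
  unfold entryOf; split_ifs <;> simp

theorem WignerLike.entry {P : Measure Ω} (h : WignerLike σ b P W) (ω : Ω) (d : Fin N × Fin N) :
    W ω d.1 d.2 = entryOf d (W ω (dirEdge d).inf (dirEdge d).sup) := by
  unfold entryOf dirEdge
  split_ifs with hd
  · simp [hd]
  · have : d.2 ≤ d.1 := (not_le.1 hd).le
    simp only [Sym2.inf_mk, Sym2.sup_mk, inf_eq_right.2 this, sup_eq_left.2 this]
    exact h.herm ω _ _

/-- The factor of the edge `e` as a function of the entry above the diagonal. -/
noncomputable def edgeFactor (ds : List (Fin N × Fin N)) (e : Sym2 (Fin N)) (z : ℂ) : ℂ :=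
  ((ds.filter fun d => dirEdge d = e).map fun d => entryOf d z).prod

theorem measurable_list_entryOf (l : List (Fin N × Fin N)) :
    Measurable fun z : ℂ => (l.map fun d => entryOf d z).prod := by
  induction l with
  | nil => simp
  | cons a l ih =>
    simp only [List.map_cons, List.prod_cons]
    exact (measurable_entryOf a).mul ih

theorem edgeFactor_neg (ds : List (Fin N × Fin N)) (e : Sym2 (Fin N)) (z : ℂ) :
    edgeFactor ds e (-z) = (-1) ^ edgeCount ds e * edgeFactor ds e z := by
  unfold edgeFactor edgeCount
  induction ds.filter fun d => dirEdge d = e with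
  | nil => simp
  | cons a l ih =>
    rw [List.map_cons, List.prod_cons, List.map_cons, List.prod_cons, ih, entryOf_neg,
      List.length_cons, pow_succ]
    ring

theorem norm_edgeFactor (ds : List (Fin N × Fin N)) (e : Sym2 (Fin N)) (z : ℂ) :
    ‖edgeFactor ds e z‖ = ‖z‖ ^ edgeCount ds e := by
  unfold edgeFactor edgeCount
  induction ds.filter fun d => dirEdge d = e with
  | nil => simp
  | cons a l ih =>
    simp only [List.map_cons, List.prod_cons, norm_mul, ih, norm_entryOf, List.length_cons]; ring

theorem WignerLike.expect_eq_prod {P : Measure Ω} (h : WignerLike σ b P W)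
    (ds : List (Fin N × Fin N)) :
    expect P W ds = ∏ e, ∫ ω, edgeFactor ds e (W ω e.inf e.sup) ∂P := by
  unfold expect
  have e1 : ∀ ω, (ds.map fun d => W ω d.1 d.2).prod
      = ∏ e, edgeFactor ds e (W ω e.inf e.sup) := by
    intro ω
    rw [list_prod_map_eq_prod_filter dirEdge]
    refine Finset.prod_congr rfl fun e _ => ?_
    unfold edgeFactor
    congr 1
    refine List.map_congr_left fun d hd => ?_
    rw [List.mem_filter] at hd
    have : dirEdge d = e := by simpa using hd.2
    rw [h.entry ω d, this]
  simp only [e1]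
  exact h.indep.integral_fun_prod_comp (fun e => (h.measurable _ _).aemeasurable)
    fun e => (measurable_list_entryOf _).aestronglyMeasurable

/-- The factor of an edge crossed an odd number of times changes sign with the entry, whose law is
symmetric. -/
theorem WignerLike.expect_eq_zero {P : Measure Ω} (h : WignerLike σ b P W)
    {ds : List (Fin N × Fin N)} {e : Sym2 (Fin N)} (he : Odd (edgeCount ds e)) : expect P W ds = 0 := by
  rw [h.expect_eq_prod]
  refine Finset.prod_eq_zero (Finset.mem_univ e) ?_
  have h1 := ((h.symm e.inf e.sup).comp (u := edgeFactor ds e)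
    (measurable_list_entryOf _)).integral_eq
  simp only [Function.comp_def, edgeFactor_neg, he.neg_one_pow, neg_one_mul, integral_neg] at h1
  exact self_eq_neg.1 h1

theorem WignerLike.norm_expect_le {B : ℝ} (h : WignerLike σ b P W) (hb : 0 ≤ b)
    (hB1 : b * Real.exp 1 ≤ B) (hB2 : (b * Real.exp 1) ^ 2 ≤ σ ^ 2 * B)
    {ds : List (Fin N × Fin N)} {k : Sym2 (Fin N) → ℕ} (hk : ∀ e, edgeCount ds e = 2 * k e) :
    ‖expect P W ds‖ ≤ ∏ e, edgeWeight σ B e (k e) := by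
  rw [h.expect_eq_prod, norm_prod]
  refine Finset.prod_le_prod (fun e _ => norm_nonneg _) fun e _ => ?_
  refine (norm_integral_le_integral_norm _).trans ?_
  simp only [norm_edgeFactor, hk]
  rcases Nat.eq_zero_or_pos (k e) with h0 | h0
  · simp [h0, edgeWeight]
  · by_cases hke : e.IsDiag ∨ 2 ≤ k e
    · exact (h.moment _ _ _ h0).trans (moment_le_edgeWeight hb hB1 hB2 e (k e) h0 hke)
    · push Not at hke
      have h1 : k e = 1 := by omega
      have hne : e.inf ≠ e.sup := by
        intro h'
        apply hke.1
        have : s(e.inf, e.sup) = e := Sym2.sortEquiv.left_inv e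
        rw [← this, Sym2.mk_isDiag_iff]
        exact h'
      rw [h1, mul_one, h.var _ _ hne]
      simp [edgeWeight, openWeight, hke.1]

theorem WignerLike.expect_of_matched (h : WignerLike σ b P W) {ds : List (Fin N × Fin N)}
    (hm : ∀ e, (ds.filter fun d => dirEdge d = e) = [] ∨ ∃ x y, x ≠ y ∧
      (ds.filter fun d => dirEdge d = e) = [(x, y), (y, x)]) :
    expect P W ds = (σ : ℂ) ^ ds.length := by
  rw [h.expect_eq_prod]
  have h1 : (σ : ℂ) ^ ds.length = (ds.map fun _ => (σ : ℂ)).prod := by simp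
  rw [h1, list_prod_map_eq_prod_filter dirEdge]
  refine Finset.prod_congr rfl fun e _ => ?_
  rcases hm e with h0 | ⟨x, y, hxy, h0⟩
  · simp only [edgeFactor, h0]; simp
  · simp only [edgeFactor, h0]
    have hmem : (x, y) ∈ ds.filter fun d => dirEdge d = e := by rw [h0]; simp
    have hmem' : (y, x) ∈ ds.filter fun d => dirEdge d = e := by rw [h0]; simp
    rw [List.mem_filter] at hmem hmem'
    have he : dirEdge (x, y) = e := by simpa using hmem.2
    have he' : dirEdge (y, x) = e := by simpa using hmem'.2
    have e2 : ∀ ω, (([(x, y), (y, x)] : List (Fin N × Fin N)).map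
        fun d => entryOf d (W ω e.inf e.sup)).prod = ((‖W ω x y‖ ^ 2 : ℝ) : ℂ) := by
      intro ω
      have a1 := h.entry ω (x, y)
      have a2 := h.entry ω (y, x)
      rw [he] at a1
      rw [he'] at a2
      simp only [List.map_cons, List.map_nil, List.prod_cons, List.prod_nil, mul_one]
      rw [← a1, ← a2]
      simp only
      rw [h.herm ω x y, Complex.star_def, Complex.mul_conj, Complex.normSq_eq_norm_sq]
    simp only [e2]
    rw [integral_complex_ofReal, h.var x y hxy]
    simp [sq]

end expectation

end DeformedWigner

/-! ### From the expectation of a walk to its weight. -/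

namespace DeformedWigner

variable {σ θ : ℝ} {N : ℕ}

/-- The directed steps of a walk from `x`. -/
def dirSteps {V : Type*} : V → List (Bool × V) → List (V × V)
  | _, [] => []
  | x, a :: l => (x, a.2) :: dirSteps a.2 l

/-- The directed matrix steps of a walk from `x`. -/
def matrixSteps {V : Type*} : V → List (Bool × V) → List (V × V)
  | _, [] => []
  | x, a :: l => if a.1 = true then (x, a.2) :: matrixSteps a.2 l else matrixSteps a.2 l

/-- Number of jumps. -/
def numJump {V : Type*} (l : List (Bool × V)) : ℕ := l.countP fun a => !a.1

section lists

variable {V : Type*}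

@[simp]
theorem dirSteps_length (x : V) (l : List (Bool × V)) : (dirSteps x l).length = l.length := by
  induction l generalizing x with
  | nil => rfl
  | cons a l ih => simp [dirSteps, ih]

theorem matrixSteps_eq_dirSteps (x : V) {l : List (Bool × V)} (h : ∀ a ∈ l, a.1 = true) :
    matrixSteps x l = dirSteps x l := by
  induction l generalizing x with
  | nil => rfl
  | cons a l ih =>
    simp only [matrixSteps, dirSteps]
    rw [if_pos (h a (by simp)), ih a.2 fun b hb => h b (by simp [hb])]

variable [DecidableEq V]

theorem dirSteps_append (x : V) (s : WalkState V) (hx : s.cur = x) (l l' : List (Bool × V)) :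
    dirSteps x (l ++ l') = dirSteps x l ++ dirSteps (s.run l).cur l' := by
  induction l generalizing x s with
  | nil => simp [dirSteps, hx]
  | cons a l ih =>
    simp only [List.cons_append, dirSteps, WalkState.run_cons]
    rw [ih a.2 (s.step a) (s.step_cur a)]

theorem matrixSteps_append (x : V) (s : WalkState V) (hx : s.cur = x) (l l' : List (Bool × V)) :
    matrixSteps x (l ++ l') = matrixSteps x l ++ matrixSteps (s.run l).cur l' := by
  induction l generalizing x s with
  | nil => simp [matrixSteps, hx]
  | cons a l ih =>
    simp only [List.cons_append, matrixSteps, WalkState.run_cons]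
    rw [ih a.2 (s.step a) (s.step_cur a)]
    split_ifs <;> rfl

theorem WalkState.run_append (s : WalkState V) (l l' : List (Bool × V)) :
    s.run (l ++ l') = (s.run l).run l' := by simp [WalkState.run]

end lists

@[simp]
theorem edgeCount_append (l l' : List (Fin N × Fin N)) (e : Sym2 (Fin N)) :
    edgeCount (l ++ l') e = edgeCount l e + edgeCount l' e := by
  simp [edgeCount]

theorem edgeCount_cons (d : Fin N × Fin N) (l : List (Fin N × Fin N)) (e : Sym2 (Fin N)) :
    edgeCount (d :: l) e = edgeCount l e + if dirEdge d = e then 1 else 0 := by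
  unfold edgeCount
  by_cases h : dirEdge d = e <;> simp [h]

@[simp]
theorem edgeCount_nil (e : Sym2 (Fin N)) : edgeCount ([] : List (Fin N × Fin N)) e = 0 := rfl

namespace WalkState

/-- Indicator of the open edges. -/
def openCount (s : WalkState (Fin N)) (e : Sym2 (Fin N)) : ℕ := if e ∈ s.opn then 1 else 0

theorem openCount_of_mem {s : WalkState (Fin N)} {e : Sym2 (Fin N)} (h : e ∈ s.opn) :
    s.openCount e = 1 := if_pos h

theorem openCount_of_notMem {s : WalkState (Fin N)} {e : Sym2 (Fin N)} (h : e ∉ s.opn) :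
    s.openCount e = 0 := if_neg h

theorem openCount_congr {s s' : WalkState (Fin N)} {e : Sym2 (Fin N)}
    (h : e ∈ s.opn ↔ e ∈ s'.opn) : s.openCount e = s'.openCount e := by
  by_cases h' : e ∈ s'.opn
  · rw [openCount_of_mem h', openCount_of_mem (h.2 h')]
  · rw [openCount_of_notMem h', openCount_of_notMem fun h'' => h' (h.1 h'')]

/-- Matrix traversals of an edge alternate between opening and closing, so they number twice the
openings, corrected by whether the edge is open at either end of the walk. -/
theorem edgeCount_run (s : WalkState (Fin N)) (l : List (Bool × Fin N)) (e : Sym2 (Fin N)) :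
    edgeCount (matrixSteps s.cur l) e + 2 * s.mult e + (s.run l).openCount e
      = 2 * (s.run l).mult e + s.openCount e := by
  induction l generalizing s with
  | nil => simp only [matrixSteps, run_nil, edgeCount_nil]; omega
  | cons a l ih =>
    have h := ih (s.step a)
    rw [step_cur] at h
    rw [run_cons]
    obtain ⟨c, w⟩ := a
    generalize (s.step (c, w)).run l = s' at h
    cases c with
    | false =>
      have h3 : matrixSteps s.cur ((false, w) :: l) = matrixSteps w l := by simp [matrixSteps]
      rw [h3]
      rw [step_jump] at h
      have h1 : (s.jumpStep w).openCount e = s.openCount e := rfl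
      have h2 : (s.jumpStep w).mult e = s.mult e := rfl
      rw [h1, h2] at h
      exact h
    | true =>
      have h3 : matrixSteps s.cur ((true, w) :: l) = (s.cur, w) :: matrixSteps w l := by
        simp [matrixSteps]
      rw [h3, edgeCount_cons]
      have hd : dirEdge (s.cur, w) = s(s.cur, w) := rfl
      dsimp only at h
      by_cases ho : s(s.cur, w) ∈ s.opn
      · rw [step_close ho] at h
        have h2 : (s.closeStep w).mult e = s.mult e := rfl
        rw [h2] at h
        by_cases he : e = s(s.cur, w)
        · rw [if_pos (hd.trans he.symm), openCount_of_mem (s := s) (he ▸ ho)]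
          rw [openCount_of_notMem (s := s.closeStep w) (by simp [closeStep, he])] at h
          omega
        · rw [if_neg fun h' => he (h'.symm.trans hd)]
          rw [openCount_congr (s := s.closeStep w) (s' := s) (by simp [closeStep, he])] at h
          omega
      · rw [step_open ho] at h
        by_cases he : e = s(s.cur, w)
        · rw [if_pos (hd.trans he.symm), openCount_of_notMem (s := s) (he ▸ ho)]
          have h2 : (s.openStep w).mult e = s.mult e + 1 := by simp [openStep, he]
          rw [openCount_of_mem (s := s.openStep w) (by simp [openStep, he]), h2] at h
          omega
        · rw [if_neg fun h' => he (h'.symm.trans hd)]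
          have h2 : (s.openStep w).mult e = s.mult e := by simp [openStep, he]
          rw [openCount_congr (s := s.openStep w) (s' := s) (by simp [openStep, he]), h2] at h
          omega

theorem edgeCount_run_start (x : Fin N) (l : List (Bool × Fin N)) (e : Sym2 (Fin N)) :
    edgeCount (matrixSteps x l) e + ((start x).run l).openCount e
      = 2 * ((start x).run l).mult e := by
  have := edgeCount_run (start x) l e
  rw [openCount_of_notMem (s := start x) (by simp [start])] at this
  simpa [start] using this

theorem odd_edgeCount_iff (x : Fin N) (l : List (Bool × Fin N)) (e : Sym2 (Fin N)) :
    Odd (edgeCount (matrixSteps x l) e) ↔ e ∈ ((start x).run l).opn := by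
  have := edgeCount_run_start x l e
  by_cases h : e ∈ ((start x).run l).opn
  · rw [openCount_of_mem h] at this
    simp only [h, iff_true]
    rw [Nat.odd_iff]; omega
  · rw [openCount_of_notMem h] at this
    simp only [h, iff_false, Nat.not_odd_iff_even]
    rw [Nat.even_iff]; omega

/-- Weight accumulated by the openings of edges. -/
noncomputable def openProd (σ B : ℝ) (s : WalkState (Fin N)) : ℝ :=
  (∏ e, edgeWeight σ B e (s.mult e)) * (1 / N) ^ (∑ e, s.mult e)

theorem openProd_openStep (B : ℝ) (s : WalkState (Fin N)) (w : Fin N) :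
    openProd σ B (s.openStep w)
      = openProd σ B s * (openWeight σ B s(s.cur, w) (s.mult s(s.cur, w)) / N) := by
  unfold openProd
  have h1 : ∑ e, (s.openStep w).mult e = ∑ e, s.mult e + 1 := by
    rw [← Finset.add_sum_erase _ _ (Finset.mem_univ s(s.cur, w)),
      ← Finset.add_sum_erase Finset.univ s.mult (Finset.mem_univ s(s.cur, w))]
    have : ∑ e ∈ Finset.univ.erase s(s.cur, w), (s.openStep w).mult e
        = ∑ e ∈ Finset.univ.erase s(s.cur, w), s.mult e :=
      Finset.sum_congr rfl fun e he => by
        simp only [openStep]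
        rw [Function.update_of_ne (Finset.ne_of_mem_erase he)]
    rw [this]
    simp only [openStep, Function.update_self]
    omega
  have h2 : ∏ e, edgeWeight σ B e ((s.openStep w).mult e)
      = (∏ e, edgeWeight σ B e (s.mult e)) *
        openWeight σ B s(s.cur, w) (s.mult s(s.cur, w)) := by
    rw [← Finset.mul_prod_erase _ _ (Finset.mem_univ s(s.cur, w)),
      ← Finset.mul_prod_erase Finset.univ (fun e => edgeWeight σ B e (s.mult e))
        (Finset.mem_univ s(s.cur, w))]
    have : ∏ e ∈ Finset.univ.erase s(s.cur, w), edgeWeight σ B e ((s.openStep w).mult e)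
        = ∏ e ∈ Finset.univ.erase s(s.cur, w), edgeWeight σ B e (s.mult e) :=
      Finset.prod_congr rfl fun e he => by
        simp only [openStep]
        rw [Function.update_of_ne (Finset.ne_of_mem_erase he)]
    rw [this]
    simp only [openStep, Function.update_self]
    rw [edgeWeight, Finset.prod_range_succ, ← edgeWeight]
    ring
  rw [h1, h2, pow_succ]
  ring

theorem openProd_mul_listWeight (B : ℝ) (s : WalkState (Fin N)) (l : List (Bool × Fin N)) :
    openProd σ B s * listWeight σ θ B s l = (θ / N) ^ numJump l * openProd σ B (s.run l) := by
  induction l generalizing s with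
  | nil => simp [listWeight, numJump]
  | cons a l ih =>
    obtain ⟨c, w⟩ := a
    simp only [listWeight, run_cons]
    cases c with
    | false =>
      have h : openProd σ B (s.step (false, w)) = openProd σ B s := by
        rw [step_jump]; rfl
      have h2 : numJump ((false, w) :: l) = numJump l + 1 := by simp [numJump]
      have h3 : stepWeight σ θ B s (false, w) = θ / N := by simp [stepWeight]
      have := ih (s.step (false, w))
      rw [h] at this
      rw [h2, h3, pow_succ, mul_left_comm, this]; ring
    | true =>
      have h2 : numJump ((true, w) :: l) = numJump l := by simp [numJump]
      have := ih (s.step (true, w))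
      rw [h2, ← this]
      by_cases ho : s(s.cur, w) ∈ s.opn
      · have h3 : stepWeight σ θ B s (true, w) = 1 := by simp [stepWeight, ho]
        have h : openProd σ B (s.step (true, w)) = openProd σ B s := by
          rw [step_close ho]; rfl
        rw [h, h3, one_mul]
      · have h3 : stepWeight σ θ B s (true, w)
          = openWeight σ B s(s.cur, w) (s.mult s(s.cur, w)) / N := by simp [stepWeight, ho]
        have h : openProd σ B (s.step (true, w)) = openProd σ B s *
            (openWeight σ B s(s.cur, w) (s.mult s(s.cur, w)) / N) := by
          rw [step_open ho]; exact openProd_openStep B s w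
        rw [h, h3]; ring

theorem listWeight_start (B : ℝ) (x : Fin N) (l : List (Bool × Fin N)) :
    listWeight σ θ B (start x) l = (θ / N) ^ numJump l * openProd σ B ((start x).run l) := by
  rw [← openProd_mul_listWeight]
  simp [openProd, start, edgeWeight]

end WalkState

section walkExpect

open WalkState

variable {Ω : Type*} [MeasurableSpace Ω] {P : Measure Ω} [IsProbabilityMeasure P]
  {W : Ω → Matrix (Fin N) (Fin N) ℂ} {b : ℝ}

/-- Contribution of a walk to the expansion of the expected product of entries. -/
noncomputable def walkExpect (θ : ℝ) (P : Measure Ω) (W : Ω → Matrix (Fin N) (Fin N) ℂ)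
    (x : Fin N) (l : List (Bool × Fin N)) : ℂ :=
  ((((√(N : ℝ))⁻¹ ^ (matrixSteps x l).length * (θ / N) ^ numJump l : ℝ)) : ℂ) *
    expect P W (matrixSteps x l)

theorem matrixSteps_length_of_closed {x : Fin N} {l : List (Bool × Fin N)}
    (h : ((start x).run l).opn = ∅) :
    (matrixSteps x l).length = 2 * ∑ e, ((start x).run l).mult e := by
  have h1 : (matrixSteps x l).length = ∑ e, edgeCount (matrixSteps x l) e := by
    generalize matrixSteps x l = ds
    induction ds with
    | nil => simp
    | cons d ds ih =>
      simp only [edgeCount_cons, List.length_cons, Finset.sum_add_distrib, ih]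
      simp
  rw [h1, Finset.mul_sum]
  refine Finset.sum_congr rfl fun e _ => ?_
  have := edgeCount_run_start x l e
  rwa [openCount_of_notMem (by simp [h]), add_zero] at this

theorem sqrt_inv_pow_two_mul (k : ℕ) : (√(N : ℝ))⁻¹ ^ (2 * k) = (1 / N) ^ k := by
  rw [pow_mul, inv_pow, Real.sq_sqrt (Nat.cast_nonneg N), one_div]

theorem WignerLike.walkExpect_eq_zero {P : Measure Ω} (h : WignerLike σ b P W) {x : Fin N}
    {l : List (Bool × Fin N)} (ho : ((start x).run l).opn ≠ ∅) : walkExpect θ P W x l = 0 := by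
  obtain ⟨e, he⟩ := Finset.nonempty_iff_ne_empty.2 ho
  rw [walkExpect, h.expect_eq_zero ((odd_edgeCount_iff x l e).2 he), mul_zero]

/-- In a closed walk the matrix steps are twice the openings, so `N^(-1/2)` per matrix step is `1/N`
per opening; edge by edge the moments are bounded by the opening weights. -/
theorem WignerLike.norm_walkExpect_le {B : ℝ} (h : WignerLike σ b P W) (hb : 0 ≤ b) (hθ : 0 ≤ θ)
    (hB1 : b * Real.exp 1 ≤ B) (hB2 : (b * Real.exp 1) ^ 2 ≤ σ ^ 2 * B) (x : Fin N)
    (l : List (Bool × Fin N)) :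
    ‖walkExpect θ P W x l‖ ≤
      if ((start x).run l).opn = ∅ then listWeight σ θ B (start x) l else 0 := by
  split_ifs with ho
  · rw [walkExpect, norm_mul, Complex.norm_real, Real.norm_of_nonneg (by positivity),
      matrixSteps_length_of_closed ho, sqrt_inv_pow_two_mul, listWeight_start, openProd]
    have h1 := h.norm_expect_le (ds := matrixSteps x l) hb hB1 hB2
      (k := ((start x).run l).mult) fun e => by
        have := edgeCount_run_start x l e
        rwa [openCount_of_notMem (by simp [ho]), add_zero] at this
    calc _ ≤ (1 / (N : ℝ)) ^ (∑ e, ((start x).run l).mult e) * (θ / N) ^ numJump l *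
          ∏ e, edgeWeight σ B e (((start x).run l).mult e) := by gcongr
      _ = _ := by ring
  · rw [h.walkExpect_eq_zero ho, norm_zero]

end walkExpect

end DeformedWigner

/-! ### Structure of regular walks. -/

namespace DeformedWigner

variable {σ θ : ℝ} {N : ℕ}

/-- The edges of a path given by its list of vertices. -/
def pathEdges {V : Type*} [DecidableEq V] : List V → Finset (Sym2 V)
  | a :: b :: l => insert s(a, b) (pathEdges (b :: l))
  | _ => ∅

theorem mem_of_mem_pathEdges {V : Type*} [DecidableEq V] {u v : V} {l : List V}
    (h : s(u, v) ∈ pathEdges l) : u ∈ l ∧ v ∈ l := by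
  induction l with
  | nil => simp [pathEdges] at h
  | cons a l ih =>
    cases l with
    | nil => simp [pathEdges] at h
    | cons b l =>
      rw [pathEdges, Finset.mem_insert] at h
      rcases h with h | h
      · rw [Sym2.eq_iff] at h
        rcases h with ⟨rfl, rfl⟩ | ⟨rfl, rfl⟩ <;> simp
      · exact ⟨List.mem_cons_of_mem _ (ih h).1, List.mem_cons_of_mem _ (ih h).2⟩

theorem head_edge_mem_pathEdges {V : Type*} [DecidableEq V] {a w : V} {l : List V}
    (hn : (a :: l).Nodup) (h : s(a, w) ∈ pathEdges (a :: l)) : ∃ l', l = w :: l' := by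
  cases l with
  | nil => simp [pathEdges] at h
  | cons b l =>
    rw [pathEdges, Finset.mem_insert] at h
    rcases h with h | h
    · rw [Sym2.congr_right] at h
      exact ⟨l, by rw [h]⟩
    · exact absurd (mem_of_mem_pathEdges h).1 (List.nodup_cons.1 hn).1

theorem pathEdges_cons_eq_empty {V : Type*} [DecidableEq V] {a : V} {l : List V} :
    pathEdges (a :: l) = ∅ ↔ l = [] := by
  cases l <;> simp [pathEdges]

theorem pathEdges_erase {V : Type*} [DecidableEq V] {a b : V} {l : List V}
    (hn : (a :: b :: l).Nodup) : (pathEdges (a :: b :: l)).erase s(a, b) = pathEdges (b :: l) := by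
  rw [pathEdges, Finset.erase_insert]
  exact fun h => (List.nodup_cons.1 hn).1 (mem_of_mem_pathEdges h).1

namespace WalkState

/-- The open edges form a path from the current vertex through the vertices in `tl`. -/
structure Stack (s : WalkState (Fin N)) (tl : List (Fin N)) : Prop where
  nodup : (s.cur :: tl).Nodup
  opn_eq : s.opn = pathEdges (s.cur :: tl)
  mem_vis : ∀ v ∈ s.cur :: tl, v ∈ s.vis

theorem stack_start (x : Fin N) : (start x).Stack [] where
  nodup := by simp
  opn_eq := rfl
  mem_vis := by simp [start]

theorem Stack.opn_eq_empty {s : WalkState (Fin N)} {tl : List (Fin N)} (h : s.Stack tl) :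
    s.opn = ∅ ↔ tl = [] := by rw [h.opn_eq, pathEdges_cons_eq_empty]

theorem Stack.close {s : WalkState (Fin N)} {w : Fin N} {tl : List (Fin N)}
    (h : s.Stack (w :: tl)) : (s.closeStep w).Stack tl where
  nodup := (List.nodup_cons.1 h.nodup).2
  opn_eq := by
    simp only [closeStep]
    rw [h.opn_eq, pathEdges_erase h.nodup]
  mem_vis v hv := h.mem_vis v (List.mem_cons_of_mem _ hv)

theorem Stack.opening {s : WalkState (Fin N)} {w : Fin N} {tl : List (Fin N)}
    (h : s.Stack tl) (hw : w ∉ s.vis) : (s.openStep w).Stack (s.cur :: tl) where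
  nodup := List.nodup_cons.2 ⟨fun hm => hw (h.mem_vis w hm), h.nodup⟩
  opn_eq := by
    simp only [openStep]
    rw [h.opn_eq, pathEdges, Sym2.eq_swap]
  mem_vis v hv := by
    simp only [openStep, Finset.mem_insert]
    rcases List.mem_cons.1 hv with h' | h'
    · exact Or.inl h'
    · exact Or.inr (h.mem_vis v h')

theorem Stack.jump {s : WalkState (Fin N)} (h : s.Stack []) (w : Fin N) :
    (s.jumpStep w).Stack [] where
  nodup := by simp
  opn_eq := h.opn_eq_empty.2 rfl
  mem_vis v hv := by
    simp only [List.mem_singleton] at hv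
    simp [jumpStep, hv]

/-- Without flags no vertex has excess credit, so the current vertex carries at most one open edge.
A jump from a nontrivial path would therefore be flagged. -/
theorem Stack.odd_degree {s : WalkState (Fin N)} {t : ℕ} {w : Fin N} {tl : List (Fin N)}
    (h : s.Stack (w :: tl)) (hs : s.Consistent t) (hf : s.flags = 0) :
    Odd (edgeDegree s.opn s.cur) := by
  have h1 : 1 ≤ edgeDegree s.opn s.cur := edgeDegree_pos (w := w) (by rw [h.opn_eq]; simp [pathEdges])
  have h2 := hs.degree_le s.cur
  have h3 := hs.credit_sum
  rw [hf, Nat.le_zero, Finset.sum_eq_zero_iff] at h3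
  have h4 := h3 s.cur (Finset.mem_univ _)
  rw [if_pos rfl] at h2
  have : edgeDegree s.opn s.cur = 1 := by omega
  rw [this]; exact odd_one

theorem Stack.even_degree {s : WalkState (Fin N)} (h : s.Stack []) :
    ¬ Odd (edgeDegree s.opn s.cur) := by
  rw [h.opn_eq_empty.2 rfl]; simp [edgeDegree]

/-- The three kinds of regular steps. -/
theorem Stack.step_cases {s : WalkState (Fin N)} {t : ℕ} {tl : List (Fin N)}
    (h : s.Stack tl) (hs : s.Consistent t) (hf : s.flags = 0) {a : Bool × Fin N}
    (ha : (s.step a).flags = 0) :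
    (∃ w tl', a = (true, w) ∧ tl = w :: tl' ∧ s(s.cur, w) ∈ s.opn ∧ s.step a = s.closeStep w) ∨
    (∃ w, a = (true, w) ∧ w ∉ s.vis ∧ s(s.cur, w) ∉ s.opn ∧ s.step a = s.openStep w) ∨
    (∃ w, a = (false, w) ∧ w ∉ s.vis ∧ tl = [] ∧ s.step a = s.jumpStep w) := by
  obtain ⟨c, w⟩ := a
  cases c with
  | true =>
    by_cases ho : s(s.cur, w) ∈ s.opn
    · obtain ⟨tl', rfl⟩ := head_edge_mem_pathEdges h.nodup (h.opn_eq ▸ ho)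
      exact Or.inl ⟨w, tl', rfl, rfl, ho, step_close ho⟩
    · refine Or.inr (Or.inl ⟨w, rfl, fun hv => ?_, ho, step_open ho⟩)
      rw [step_open ho] at ha
      simp only [openStep, if_pos hv] at ha
      omega
  | false =>
    rw [step_jump] at ha
    have hc : ¬ (Odd (edgeDegree s.opn s.cur) ∨ w ∈ s.vis) := fun hc => by
      simp only [jumpStep, if_pos hc] at ha
      omega
    refine Or.inr (Or.inr ⟨w, rfl, fun hv => hc (Or.inr hv), ?_, step_jump s w⟩)
    cases tl with
    | nil => rfl
    | cons v tl => exact absurd (Or.inl (h.odd_degree hs hf)) hc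

theorem vis_subset_step (s : WalkState (Fin N)) (a : Bool × Fin N) : s.vis ⊆ (s.step a).vis := by
  unfold step
  split_ifs
  · exact Finset.Subset.refl _
  · exact Finset.subset_insert _ _
  · exact Finset.subset_insert _ _

theorem vis_subset_run (s : WalkState (Fin N)) (l : List (Bool × Fin N)) :
    s.vis ⊆ (s.run l).vis := by
  induction l generalizing s with
  | nil => exact Finset.Subset.refl _
  | cons a l ih => exact (vis_subset_step s a).trans (ih _)

end WalkState

open WalkState

/-- Occurrences of an edge in a list of directed steps. -/
def onEdge (ds : List (Fin N × Fin N)) (e : Sym2 (Fin N)) : List (Fin N × Fin N) :=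
  ds.filter fun d => dirEdge d = e

theorem edgeCount_eq_length (ds : List (Fin N × Fin N)) (e : Sym2 (Fin N)) :
    edgeCount ds e = (onEdge ds e).length := rfl

theorem onEdge_append (ds ds' : List (Fin N × Fin N)) (e : Sym2 (Fin N)) :
    onEdge (ds ++ ds') e = onEdge ds e ++ onEdge ds' e := by simp [onEdge]

theorem onEdge_singleton_of_eq {d : Fin N × Fin N} {e : Sym2 (Fin N)} (h : dirEdge d = e) :
    onEdge [d] e = [d] := by simp [onEdge, h]

theorem onEdge_singleton_of_ne {d : Fin N × Fin N} {e : Sym2 (Fin N)} (h : dirEdge d ≠ e) :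
    onEdge [d] e = [] := by simp [onEdge, h]

/-- Structure of a walk all of whose steps are regular; `tl` is the path of open edges behind the
current vertex. -/
structure RegularWalk (x : Fin N) (l : List (Bool × Fin N)) (tl : List (Fin N)) : Prop where
  stack : ((start x).run l).Stack tl
  consistent : ((start x).run l).Consistent l.length
  flags : ((start x).run l).flags = 0
  steps : ∀ d ∈ dirSteps x l, d.1 ∈ ((start x).run l).vis ∧ d.2 ∈ ((start x).run l).vis ∧ d.1 ≠ d.2
  start_vis : x ∈ ((start x).run l).vis
  opened : ∀ p a b q, ((start x).run l).cur :: tl = p ++ a :: b :: q →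
    onEdge (dirSteps x l) s(a, b) = [(b, a)]
  closed : ∀ e ∉ ((start x).run l).opn, onEdge (dirSteps x l) e = [] ∨
    (∃ d, onEdge (dirSteps x l) e = [d]) ∨
    ∃ a b, b ∉ ((start x).run l).cur :: tl ∧ onEdge (dirSteps x l) e = [(a, b), (b, a)]
  bottom : ∃ β, (((start x).run l).cur :: tl).getLast? = some β ∧ (numJump l = 0 → β = x) ∧
    (1 ≤ numJump l → β ≠ x) ∧ (numJump l ≠ 1 → onEdge (dirSteps x l) s(β, x) = [])

theorem regularWalk_nil (x : Fin N) : RegularWalk x [] [] where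
  stack := stack_start x
  consistent := consistent_start x
  flags := rfl
  steps := by simp [dirSteps]
  start_vis := by simp [start]
  opened p a b q h := by
    have := congrArg List.length h
    simp only [List.length_append, List.length_cons, List.length_nil] at this
    omega
  closed e _ := Or.inl rfl
  bottom := ⟨x, by simp [start], by simp, by simp [numJump], fun _ => rfl⟩

theorem run_concat (s : WalkState (Fin N)) (l : List (Bool × Fin N)) (a : Bool × Fin N) :
    s.run (l ++ [a]) = (s.run l).step a := by rw [run_append]; rfl

theorem dirSteps_concat (x : Fin N) (l : List (Bool × Fin N)) (a : Bool × Fin N) :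
    dirSteps x (l ++ [a]) = dirSteps x l ++ [(((start x).run l).cur, a.2)] := by
  rw [dirSteps_append x (start x) rfl]; rfl

theorem onEdge_dirSteps_concat_of_ne {x : Fin N} {l : List (Bool × Fin N)} {a : Bool × Fin N}
    {e : Sym2 (Fin N)} (h : s(((start x).run l).cur, a.2) ≠ e) :
    onEdge (dirSteps x (l ++ [a])) e = onEdge (dirSteps x l) e := by
  rw [dirSteps_concat, onEdge_append, onEdge_singleton_of_ne (d := (_, a.2)) h, List.append_nil]

theorem onEdge_dirSteps_concat_self (x : Fin N) (l : List (Bool × Fin N)) (a : Bool × Fin N) :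
    onEdge (dirSteps x (l ++ [a])) s(((start x).run l).cur, a.2) =
      onEdge (dirSteps x l) s(((start x).run l).cur, a.2) ++ [(((start x).run l).cur, a.2)] := by
  rw [dirSteps_concat, onEdge_append, onEdge_singleton_of_eq
    (show dirEdge (((start x).run l).cur, a.2) = s(((start x).run l).cur, a.2) from rfl)]

theorem numJump_concat_true {V : Type*} (l : List (Bool × V)) (w : V) :
    numJump (l ++ [(true, w)]) = numJump l := by simp [numJump]

theorem numJump_concat_false {V : Type*} (l : List (Bool × V)) (w : V) :
    numJump (l ++ [(false, w)]) = numJump l + 1 := by simp [numJump]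

theorem RegularWalk.onEdge_of_notMem {x : Fin N} {l : List (Bool × Fin N)} {tl : List (Fin N)}
    (h : RegularWalk x l tl) {w : Fin N} (hw : w ∉ ((start x).run l).vis) (v : Fin N) :
    onEdge (dirSteps x l) s(v, w) = [] := by
  rw [onEdge, List.filter_eq_nil_iff]
  intro d hd hde
  have hde : s(d.1, d.2) = s(v, w) := of_decide_eq_true hde
  obtain ⟨h1, h2, -⟩ := h.steps d hd
  rcases Sym2.eq_iff.1 hde with ⟨-, h'⟩ | ⟨h', -⟩
  · exact hw (h' ▸ h2)
  · exact hw (h' ▸ h1)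

theorem RegularWalk.close {x : Fin N} {l : List (Bool × Fin N)} {w : Fin N} {tl : List (Fin N)}
    (h : RegularWalk x l (w :: tl)) (ho : s(((start x).run l).cur, w) ∈ ((start x).run l).opn) :
    RegularWalk x (l ++ [(true, w)]) tl := by
  have hr : (start x).run (l ++ [(true, w)]) = ((start x).run l).closeStep w := by
    rw [run_concat, step_close ho]
  have hn := h.stack.nodup
  have hcur : ((start x).run l).cur ∉ w :: tl := (List.nodup_cons.1 hn).1
  have hpair := h.opened [] _ _ _ rfl
  constructor
  · rw [hr]; exact h.stack.close
  · rw [hr, List.length_append]; exact h.consistent.close ho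
  · rw [hr]; exact h.flags
  · rw [hr]
    intro d hd
    rw [dirSteps_concat] at hd
    rcases List.mem_append.1 hd with hd | hd
    · exact h.steps d hd
    · rw [List.mem_singleton.1 hd]
      exact ⟨h.consistent.cur_vis, h.stack.mem_vis w (by simp), fun e => hcur (List.mem_cons.2 (Or.inl e))⟩
  · rw [hr]; exact h.start_vis
  · rw [hr]
    intro p a b q hpq
    have hpq : w :: tl = p ++ a :: b :: q := hpq
    have hold := h.opened (((start x).run l).cur :: p) a b q (by rw [hpq]; rfl)
    rw [onEdge_dirSteps_concat_of_ne, hold]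
    intro he
    rw [hpq] at hcur
    rcases Sym2.eq_iff.1 he with ⟨h', -⟩ | ⟨h', -⟩ <;> exact hcur (by simp [h'])
  · rw [hr]
    intro e he
    have he : e ∉ ((start x).run l).opn.erase s(((start x).run l).cur, w) := he
    show _ ∨ _ ∨ ∃ a b, b ∉ w :: tl ∧ _
    by_cases hee : e = s(((start x).run l).cur, w)
    · right; right
      refine ⟨w, ((start x).run l).cur, hcur, ?_⟩
      rw [hee]
      have := onEdge_dirSteps_concat_self x l (true, w)
      dsimp only at this
      rw [this, hpair]
      rfl
    · have he' : e ∉ ((start x).run l).opn := fun h' => he (Finset.mem_erase.2 ⟨hee, h'⟩)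
      rw [onEdge_dirSteps_concat_of_ne fun h' => hee h'.symm]
      rcases h.closed e he' with h1 | h1 | ⟨a, b, hb, h1⟩
      · exact Or.inl h1
      · exact Or.inr (Or.inl h1)
      · exact Or.inr (Or.inr ⟨a, b, fun h' => hb (List.mem_cons_of_mem _ h'), h1⟩)
  · rw [hr, numJump_concat_true]
    obtain ⟨β, h1, h2, h3, h4⟩ := h.bottom
    refine ⟨β, ?_, h2, h3, fun hj => ?_⟩
    · show (w :: tl).getLast? = some β
      rw [← h1]; simp
    · rw [onEdge_dirSteps_concat_of_ne, h4 hj]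
      intro he
      rw [← he] at h4
      have := (h4 hj).symm.trans hpair
      simp at this

theorem RegularWalk.opening {x : Fin N} {l : List (Bool × Fin N)} {w : Fin N} {tl : List (Fin N)}
    (h : RegularWalk x l tl) (ho : s(((start x).run l).cur, w) ∉ ((start x).run l).opn)
    (hw : w ∉ ((start x).run l).vis) :
    RegularWalk x (l ++ [(true, w)]) (((start x).run l).cur :: tl) := by
  have hr : (start x).run (l ++ [(true, w)]) = ((start x).run l).openStep w := by
    rw [run_concat, step_open ho]
  have hcv := h.consistent.cur_vis
  have hself := onEdge_dirSteps_concat_self x l (true, w)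
  dsimp only at hself
  rw [h.onEdge_of_notMem hw] at hself
  constructor
  · rw [hr]; exact h.stack.opening hw
  · rw [hr, ← step_open ho, List.length_append]; exact h.consistent.step (true, w)
  · rw [hr]; simp only [openStep, if_neg hw]; exact h.flags
  · rw [hr]
    intro d hd
    simp only [openStep, Finset.mem_insert]
    rw [dirSteps_concat] at hd
    rcases List.mem_append.1 hd with hd | hd
    · obtain ⟨h1, h2, h3⟩ := h.steps d hd
      exact ⟨Or.inr h1, Or.inr h2, h3⟩
    · rw [List.mem_singleton.1 hd]
      exact ⟨Or.inr hcv, Or.inl rfl, fun e => hw (by dsimp only at e; exact e ▸ hcv)⟩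
  · rw [hr]; exact Finset.mem_insert_of_mem h.start_vis
  · rw [hr]
    intro p a b q hpq
    have hpq : w :: ((start x).run l).cur :: tl = p ++ a :: b :: q := hpq
    cases p with
    | nil =>
      simp only [List.nil_append, List.cons.injEq] at hpq
      obtain ⟨rfl, rfl, -⟩ := hpq
      rw [Sym2.eq_swap, hself]; rfl
    | cons c p =>
      simp only [List.cons_append, List.cons.injEq] at hpq
      have hold := h.opened p a b q hpq.2
      rw [onEdge_dirSteps_concat_of_ne, hold]
      intro he
      have ha : a ∈ ((start x).run l).vis := h.stack.mem_vis a (by rw [hpq.2]; simp)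
      have hb : b ∈ ((start x).run l).vis := h.stack.mem_vis b (by rw [hpq.2]; simp)
      rcases Sym2.eq_iff.1 he with ⟨-, h'⟩ | ⟨-, h'⟩
      · exact hw (by dsimp only at h'; exact h' ▸ hb)
      · exact hw (by dsimp only at h'; exact h' ▸ ha)
  · rw [hr]
    intro e he
    have he : e ∉ insert s(((start x).run l).cur, w) ((start x).run l).opn := he
    show _ ∨ _ ∨ ∃ a b, b ∉ w :: ((start x).run l).cur :: tl ∧ _
    rw [Finset.mem_insert, not_or] at he
    rw [onEdge_dirSteps_concat_of_ne fun h' => he.1 h'.symm]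
    rcases h.closed e he.2 with h1 | h1 | ⟨a, b, hb, h1⟩
    · exact Or.inl h1
    · exact Or.inr (Or.inl h1)
    · refine Or.inr (Or.inr ⟨a, b, fun h' => ?_, h1⟩)
      rcases List.mem_cons.1 h' with h' | h'
      · have : (a, b) ∈ dirSteps x l :=
          List.mem_of_mem_filter (p := fun d => dirEdge d = e) (by
            show (a, b) ∈ onEdge (dirSteps x l) e
            rw [h1]; simp)
        exact hw (h' ▸ (h.steps _ this).2.1)
      · exact hb h'
  · rw [hr, numJump_concat_true]
    obtain ⟨β, h1, h2, h3, h4⟩ := h.bottom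
    have hβ : β ∈ ((start x).run l).vis := h.stack.mem_vis β (List.mem_of_getLast? h1)
    refine ⟨β, ?_, h2, h3, fun hj => ?_⟩
    · show (w :: ((start x).run l).cur :: tl).getLast? = some β
      rw [← h1]; simp
    · rw [onEdge_dirSteps_concat_of_ne, h4 hj]
      intro he
      rcases Sym2.eq_iff.1 he with ⟨-, h'⟩ | ⟨-, h'⟩
      · exact hw (by dsimp only at h'; exact h' ▸ h.start_vis)
      · exact hw (by dsimp only at h'; exact h' ▸ hβ)

/-- The new vertex becomes the bottom of the path of open edges. Its edge to `x` is unused unless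
the jump departs from `x` itself, which can only be the first jump, since later bottoms differ from
`x`. This is the origin of the exception for exactly one jump. -/
theorem RegularWalk.jump {x : Fin N} {l : List (Bool × Fin N)} {w : Fin N}
    (h : RegularWalk x l []) (hw : w ∉ ((start x).run l).vis) :
    RegularWalk x (l ++ [(false, w)]) [] := by
  have hr : (start x).run (l ++ [(false, w)]) = ((start x).run l).jumpStep w := by
    rw [run_concat, step_jump]
  have hcv := h.consistent.cur_vis
  have hself := onEdge_dirSteps_concat_self x l (false, w)
  dsimp only at hself
  rw [h.onEdge_of_notMem hw] at hself
  constructor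
  · rw [hr]; exact h.stack.jump w
  · rw [hr, ← step_jump, List.length_append]; exact h.consistent.step (false, w)
  · rw [hr]
    simp only [jumpStep]
    rw [if_neg (not_or.2 ⟨h.stack.even_degree, hw⟩)]
    exact h.flags
  · rw [hr]
    intro d hd
    simp only [jumpStep, Finset.mem_insert]
    rw [dirSteps_concat] at hd
    rcases List.mem_append.1 hd with hd | hd
    · obtain ⟨h1, h2, h3⟩ := h.steps d hd
      exact ⟨Or.inr h1, Or.inr h2, h3⟩
    · rw [List.mem_singleton.1 hd]
      exact ⟨Or.inr hcv, Or.inl rfl, fun e => hw (by dsimp only at e; exact e ▸ hcv)⟩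
  · rw [hr]; exact Finset.mem_insert_of_mem h.start_vis
  · intro p a b q hpq
    have := congrArg List.length hpq
    simp only [List.length_append, List.length_cons, List.length_nil] at this
    omega
  · rw [hr]
    intro e he
    have he : e ∉ ((start x).run l).opn := he
    show _ ∨ _ ∨ ∃ a b, b ∉ [w] ∧ _
    by_cases hee : e = s(((start x).run l).cur, w)
    · right; left
      exact ⟨_, by rw [hee, hself]; rfl⟩
    rw [onEdge_dirSteps_concat_of_ne fun h' => hee h'.symm]
    rcases h.closed e he with h1 | h1 | ⟨a, b, hb, h1⟩
    · exact Or.inl h1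
    · exact Or.inr (Or.inl h1)
    · refine Or.inr (Or.inr ⟨a, b, fun h' => ?_, h1⟩)
      have : (a, b) ∈ dirSteps x l :=
        List.mem_of_mem_filter (p := fun d => dirEdge d = e) (by
          show (a, b) ∈ onEdge (dirSteps x l) e
          rw [h1]; simp)
      exact hw (List.mem_singleton.1 h' ▸ (h.steps _ this).2.1)
  · rw [hr, numJump_concat_false]
    obtain ⟨β, h1, h2, h3, h4⟩ := h.bottom
    have hβ : ((start x).run l).cur = β := by simpa using h1
    have hwx : w ≠ x := fun e => hw (e ▸ h.start_vis)
    refine ⟨w, rfl, by omega, fun _ => hwx, fun hj => ?_⟩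
    rw [onEdge_dirSteps_concat_of_ne, Sym2.eq_swap, h.onEdge_of_notMem hw]
    intro he
    rcases Sym2.eq_iff.1 he with ⟨-, h'⟩ | ⟨h', -⟩
    · exact hwx h'
    · exact h3 (by omega) (hβ ▸ h')

theorem exists_regularWalk {x : Fin N} {l : List (Bool × Fin N)}
    (hf : ((start x).run l).flags = 0) : ∃ tl, RegularWalk x l tl := by
  induction l using List.reverseRecOn with
  | nil => exact ⟨[], regularWalk_nil x⟩
  | append_singleton l a ih =>
    rw [run_concat] at hf
    have hf' : ((start x).run l).flags = 0 := by
      have := flags_le_step ((start x).run l) a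
      omega
    obtain ⟨tl, h⟩ := ih hf'
    rcases h.stack.step_cases h.consistent hf' hf with ⟨w, tl', rfl, rfl, ho, -⟩ | ⟨w, rfl, hw, ho, -⟩ |
      ⟨w, rfl, hw, rfl, -⟩
    · exact ⟨tl', h.close ho⟩
    · exact ⟨_, h.opening ho hw⟩
    · exact ⟨[], h.jump hw⟩

end DeformedWigner

/-! ### Exact expectation of closed regular walks. -/

namespace DeformedWigner

variable {σ θ : ℝ} {N : ℕ}

open WalkState

theorem matrixSteps_sublist {V : Type*} (x : V) (l : List (Bool × V)) :
    (matrixSteps x l).Sublist (dirSteps x l) := by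
  induction l generalizing x with
  | nil => exact List.Sublist.refl _
  | cons a l ih =>
    simp only [matrixSteps, dirSteps]
    split_ifs
    · exact (ih a.2).cons_cons _
    · exact (ih a.2).cons _

/-- In a closed regular walk the matrix steps are matched in pairs of opposite steps. -/
theorem RegularWalk.matched {x : Fin N} {l : List (Bool × Fin N)} {tl : List (Fin N)}
    (h : RegularWalk x l tl) (ho : ((start x).run l).opn = ∅) (e : Sym2 (Fin N)) :
    onEdge (matrixSteps x l) e = [] ∨
      ∃ a b, a ≠ b ∧ onEdge (matrixSteps x l) e = [(a, b), (b, a)] := by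
  have hsub : (onEdge (matrixSteps x l) e).Sublist (onEdge (dirSteps x l) e) :=
    (matrixSteps_sublist x l).filter _
  have heven : Even (onEdge (matrixSteps x l) e).length := by
    rw [← edgeCount_eq_length, ← Nat.not_odd_iff_even, odd_edgeCount_iff, ho]
    simp
  generalize onEdge (matrixSteps x l) e = F at *
  have h01 : F.length ≤ 1 → F = [] := fun hl => by
    rw [Nat.even_iff] at heven
    exact List.length_eq_zero_iff.1 (by omega)
  rcases h.closed e (by simp [ho]) with h1 | ⟨d, h1⟩ | ⟨a, b, -, h1⟩
  · rw [h1] at hsub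
    exact Or.inl (h01 (by simpa using hsub.length_le.trans (by simp)))
  · rw [h1] at hsub
    exact Or.inl (h01 hsub.length_le)
  · by_cases hF : F.length ≤ 1
    · exact Or.inl (h01 hF)
    · have hab : (a, b) ∈ dirSteps x l :=
        List.mem_of_mem_filter (p := fun d => dirEdge d = e) (by
          show (a, b) ∈ onEdge (dirSteps x l) e
          rw [h1]; simp)
      refine Or.inr ⟨a, b, (h.steps _ hab).2.2, ?_⟩
      rw [h1] at hsub
      exact hsub.eq_of_length_le (by simp; omega)

/-- Each matrix edge is crossed exactly twice, in opposite directions, so it contributes `𝔼 |W_ab|²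
= σ²`, the weight of a first opening. The constant `B` never enters. -/
theorem WignerLike.walkExpect_eq_listWeight {Ω : Type*} [MeasurableSpace Ω] {P : Measure Ω}
    [IsProbabilityMeasure P] {W : Ω → Matrix (Fin N) (Fin N) ℂ} {b B : ℝ}
    (hW : WignerLike σ b P W) {x : Fin N} {l : List (Bool × Fin N)}
    (hf : ((start x).run l).flags = 0) (ho : ((start x).run l).opn = ∅) :
    walkExpect θ P W x l = (listWeight σ θ B (start x) l : ℂ) := by
  obtain ⟨tl, h⟩ := exists_regularWalk hf
  have hm := h.matched ho
  rw [walkExpect, hW.expect_of_matched hm, listWeight_start, openProd,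
    matrixSteps_length_of_closed ho, sqrt_inv_pow_two_mul]
  have h1 : ∏ e, edgeWeight σ B e (((start x).run l).mult e)
      = σ ^ (2 * ∑ e, ((start x).run l).mult e) := by
    rw [Finset.mul_sum, ← Finset.prod_pow_eq_pow_sum]
    refine Finset.prod_congr rfl fun e _ => ?_
    have hc := edgeCount_run_start x l e
    rw [openCount_of_notMem (by simp [ho]), add_zero, edgeCount_eq_length] at hc
    rcases hm e with h2 | ⟨a, c, hac, h2⟩
    · rw [h2, List.length_nil] at hc
      have : ((start x).run l).mult e = 0 := by omega
      simp [this, edgeWeight]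
    · rw [h2] at hc
      have h3 : ((start x).run l).mult e = 1 := by simp at hc; omega
      have he : s(a, c) = e := by
        have : (a, c) ∈ onEdge (matrixSteps x l) e := by rw [h2]; simp
        exact of_decide_eq_true (List.mem_filter.1 this).2
      rw [h3, ← he]
      simp [edgeWeight, openWeight, hac]
  rw [h1]
  push_cast
  ring

theorem flags_prefix {x : Fin N} {l l' : List (Bool × Fin N)}
    (hf : ((start x).run (l ++ l')).flags = 0) : ((start x).run l).flags = 0 := by
  have := flags_le_run ((start x).run l) l'
  rw [run_append] at hf
  omega

theorem vis_prefix (x : Fin N) (l l' : List (Bool × Fin N)) :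
    ((start x).run l).vis ⊆ ((start x).run (l ++ l')).vis := by
  rw [run_append]; exact vis_subset_run _ _

/-- A step of a regular walk either reaches a new vertex along a new edge, or closes an edge. -/
theorem regular_split {x : Fin N} {l l' : List (Bool × Fin N)} {a : Bool × Fin N}
    (hf : ((start x).run (l ++ a :: l')).flags = 0) :
    (a.2 ∉ ((start x).run l).vis ∧ onEdge (dirSteps x l) s(((start x).run l).cur, a.2) = []) ∨
    (a.1 = true ∧ s(((start x).run l).cur, a.2) ∈ ((start x).run l).opn ∧
      onEdge (dirSteps x l) s(((start x).run l).cur, a.2) = [(a.2, ((start x).run l).cur)]) := by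
  have hf1 := flags_prefix hf
  obtain ⟨tl, h⟩ := exists_regularWalk hf1
  have hf2 : ((((start x).run l)).step a).flags = 0 := by
    rw [← run_concat]
    exact flags_prefix (l' := l') (by simpa using hf)
  rcases h.stack.step_cases h.consistent hf1 hf2 with ⟨w, tl', rfl, rfl, ho, -⟩ |
    ⟨w, rfl, hw, ho, -⟩ | ⟨w, rfl, hw, rfl, -⟩
  · exact Or.inr ⟨rfl, ho, h.opened [] _ _ _ rfl⟩
  · exact Or.inl ⟨hw, h.onEdge_of_notMem hw _⟩
  · exact Or.inl ⟨hw, h.onEdge_of_notMem hw _⟩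

theorem regular_onEdge_length_le {x : Fin N} {l : List (Bool × Fin N)}
    (hf : ((start x).run l).flags = 0) (e : Sym2 (Fin N)) :
    (onEdge (dirSteps x l) e).length ≤ 2 := by
  obtain ⟨tl, h⟩ := exists_regularWalk hf
  by_cases he : e ∈ ((start x).run l).opn
  · rw [h.stack.opn_eq] at he
    have key : ∀ st : List (Fin N), e ∈ pathEdges st → ∃ p a b q, st = p ++ a :: b :: q ∧
        e = s(a, b) := by
      intro st
      induction st with
      | nil => simp [pathEdges]
      | cons c st ih =>
        cases st with
        | nil => simp [pathEdges]
        | cons d st =>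
          intro hm
          rw [pathEdges, Finset.mem_insert] at hm
          rcases hm with hm | hm
          · exact ⟨[], c, d, st, rfl, hm⟩
          · obtain ⟨p, a, b, q, h1, h2⟩ := ih hm
            exact ⟨c :: p, a, b, q, by rw [h1]; rfl, h2⟩
    obtain ⟨p, a, b, q, h1, rfl⟩ := key _ he
    rw [h.opened p a b q h1]; simp
  · rcases h.closed e he with h1 | ⟨d, h1⟩ | ⟨a, b, -, h1⟩ <;> rw [h1] <;> simp

end DeformedWigner

/-! ### Marked steps of the rotated path. -/

namespace DeformedWigner

variable {σ θ : ℝ} {N : ℕ}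

open WalkState

/-- A step `d` preceded by the steps in `ds` is marked. -/
def MarkedAfter (ds : List (Fin N × Fin N)) (d : Fin N × Fin N) : Prop :=
  Even (edgeCount ds (dirEdge d))

/-- Some marked step ends at `x`. -/
def ReachesMarked (x : Fin N) (ds : List (Fin N × Fin N)) : Prop :=
  ∃ E d E', ds = E ++ d :: E' ∧ MarkedAfter E d ∧ d.2 = x

/-- No two marked steps have the same end. -/
def SimpleSteps (ds : List (Fin N × Fin N)) : Prop :=
  ∀ E d E' F c F', ds = E ++ d :: E' → ds = F ++ c :: F' → MarkedAfter E d → MarkedAfter F c →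
    d.2 = c.2 → E.length = F.length

theorem append_eq_split {α : Type*} {X Y E E' : List α} {d : α} (h : X ++ Y = E ++ d :: E') :
    (∃ X', X = E ++ d :: X' ∧ E' = X' ++ Y) ∨ ∃ Y', E = X ++ Y' ∧ Y = Y' ++ d :: E' := by
  rcases List.append_eq_append_iff.1 h with ⟨A, h1, h2⟩ | ⟨A, h1, h2⟩
  · exact Or.inr ⟨A, h1, h2⟩
  · cases A with
    | nil => exact Or.inr ⟨[], by simpa using h1.symm, by simpa using h2.symm⟩
    | cons c A =>
      simp only [List.cons_append, List.cons.injEq] at h2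
      obtain ⟨rfl, rfl⟩ := h2
      exact Or.inl ⟨A, h1, rfl⟩

theorem dirSteps_eq_split {x : Fin N} {l : List (Bool × Fin N)} {E E' : List (Fin N × Fin N)}
    {d : Fin N × Fin N} (h : dirSteps x l = E ++ d :: E') :
    ∃ m a m', l = m ++ a :: m' ∧ E = dirSteps x m ∧ d = (((start x).run m).cur, a.2) := by
  induction l using List.reverseRecOn generalizing E' with
  | nil => simp [dirSteps] at h
  | append_singleton l a ih =>
    rw [dirSteps_concat] at h
    rcases append_eq_split h with ⟨X', h1, -⟩ | ⟨Y', h1, h2⟩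
    · obtain ⟨m, b, m', rfl, h3, h4⟩ := ih h1
      exact ⟨m, b, m' ++ [a], by simp, h3, h4⟩
    · cases Y' with
      | nil =>
        simp only [List.nil_append, List.cons.injEq] at h2
        exact ⟨l, a, [], rfl, by simpa using h1, h2.1.symm⟩
      | cons c Y' => simp at h2

/-- A regular walk has no marked step to its starting vertex. -/
theorem not_reachesMarked_of_regular {x : Fin N} {l : List (Bool × Fin N)}
    (hf : ((start x).run l).flags = 0) : ¬ ReachesMarked x (dirSteps x l) := by
  rintro ⟨E, d, E', h, hm, hd⟩
  obtain ⟨m, a, m', rfl, rfl, rfl⟩ := dirSteps_eq_split h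
  rcases regular_split hf with ⟨h1, -⟩ | ⟨-, -, h2⟩
  · have := vis_subset_run (start x) m (show x ∈ (start x).vis by simp [start])
    exact h1 (by rw [show a.2 = x from hd]; exact this)
  · unfold MarkedAfter at hm
    rw [edgeCount_eq_length, show dirEdge (((start x).run m).cur, a.2)
      = s(((start x).run m).cur, a.2) from rfl, h2] at hm
    simp at hm

section rotation

variable {x : Fin N} {l₁ l₂ : List (Bool × Fin N)}

theorem dirSteps_rotate (x : Fin N) (l₁ l₂ : List (Bool × Fin N)) :
    dirSteps ((start x).run l₁).cur (l₂ ++ (false, x) :: l₁)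
      = dirSteps ((start x).run l₁).cur l₂ ++
        (((start x).run (l₁ ++ l₂)).cur, x) :: dirSteps x l₁ := by
  rw [dirSteps_append _ ((start x).run l₁) rfl, run_append]; rfl

theorem edgeCount_dirSteps_le (x : Fin N) (m m' : List (Bool × Fin N)) (e : Sym2 (Fin N)) :
    edgeCount (dirSteps x m) e ≤ edgeCount (dirSteps x (m ++ m')) e := by
  rw [dirSteps_append x (start x) rfl, edgeCount_append]; omega

theorem edgeCount_dirSteps_split (x : Fin N) (m m' : List (Bool × Fin N)) (a : Bool × Fin N) :
    edgeCount (dirSteps x m) s(((start x).run m).cur, a.2) + 1 ≤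
      edgeCount (dirSteps x (m ++ a :: m')) s(((start x).run m).cur, a.2) := by
  have h := edgeCount_dirSteps_le x (m ++ [a]) m' s(((start x).run m).cur, a.2)
  rw [edgeCount_eq_length, onEdge_dirSteps_concat_self, List.length_append,
    ← edgeCount_eq_length] at h
  simpa using h

theorem mem_matrixSteps_split (x : Fin N) (m m' : List (Bool × Fin N)) {a : Bool × Fin N}
    (ha : a.1 = true) :
    1 ≤ edgeCount (matrixSteps x (m ++ a :: m')) s(((start x).run m).cur, a.2) := by
  rw [matrixSteps_append x (start x) rfl, edgeCount_append]
  simp only [matrixSteps, if_pos ha]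
  rw [edgeCount_cons, if_pos (show dirEdge (((start x).run m).cur, a.2)
    = s(((start x).run m).cur, a.2) from rfl)]
  omega

theorem edgeCount_matrixSteps_le (x : Fin N) (l : List (Bool × Fin N)) (e : Sym2 (Fin N)) :
    edgeCount (matrixSteps x l) e ≤ edgeCount (dirSteps x l) e :=
  ((matrixSteps_sublist x l).filter _).length_le

/-- A matrix edge is used exactly twice by a closed regular walk. -/
theorem edgeCount_of_closed {m m' : List (Bool × Fin N)} {a : Bool × Fin N}
    (hf : ((start x).run (m ++ a :: m')).flags = 0) (ho : ((start x).run (m ++ a :: m')).opn = ∅)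
    (ha : a.1 = true) :
    edgeCount (dirSteps x (m ++ a :: m')) s(((start x).run m).cur, a.2) = 2 := by
  have h1 := mem_matrixSteps_split x m m' ha
  have h2 := edgeCount_matrixSteps_le x (m ++ a :: m') s(((start x).run m).cur, a.2)
  have h3 := regular_onEdge_length_le hf s(((start x).run m).cur, a.2)
  have h4 : ¬ Odd (edgeCount (matrixSteps x (m ++ a :: m')) s(((start x).run m).cur, a.2)) := by
    rw [odd_edgeCount_iff, ho]; simp
  rw [Nat.not_odd_iff_even, Nat.even_iff] at h4
  rw [← edgeCount_eq_length] at h3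
  omega

/-- A closed regular walk does not use the edge between its end points unless it has exactly one
jump. -/
theorem edgeCount_closing_edge {l : List (Bool × Fin N)} (hf : ((start x).run l).flags = 0)
    (ho : ((start x).run l).opn = ∅) (hj : numJump l ≠ 1) :
    edgeCount (dirSteps x l) s(((start x).run l).cur, x) = 0 := by
  obtain ⟨tl, h⟩ := exists_regularWalk hf
  obtain rfl := h.stack.opn_eq_empty.1 ho
  obtain ⟨β, h1, -, -, h4⟩ := h.bottom
  have hβ : ((start x).run l).cur = β := by simpa using h1
  rw [edgeCount_eq_length, hβ, h4 hj]; rfl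

/-- The marked steps of a rotated closed regular walk. -/
theorem rotated_marked (hf : ((start x).run (l₁ ++ l₂)).flags = 0)
    (ho : ((start x).run (l₁ ++ l₂)).opn = ∅) (hj : numJump (l₁ ++ l₂) ≠ 1)
    (h1 : ∀ a ∈ l₁, a.1 = true) {E E' : List (Fin N × Fin N)} {d : Fin N × Fin N}
    (hE : dirSteps ((start x).run l₁).cur (l₂ ++ (false, x) :: l₁) = E ++ d :: E')
    (hm : MarkedAfter E d) :
    (∃ m a m', l₂ = m ++ a :: m' ∧ d.2 = a.2 ∧ a.2 ∉ ((start x).run (l₁ ++ m)).vis ∧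
      E.length = m.length) ∨
    (∃ m a m', l₂ = m ++ a :: m' ∧ d = (((start x).run (l₁ ++ m)).cur, a.2) ∧
      onEdge (dirSteps x (l₁ ++ m)) (dirEdge d) = [(d.2, d.1)] ∧
      edgeCount (dirSteps x l₁) (dirEdge d) = 1) ∨
    (d = (((start x).run (l₁ ++ l₂)).cur, x) ∧ E.length = l₂.length) ∨
    (∃ m a m', l₁ = m ++ a :: m' ∧ d = (((start x).run m).cur, a.2) ∧
      a.2 ∉ ((start x).run m).vis ∧ onEdge (dirSteps x m) (dirEdge d) = [] ∧
      Even (edgeCount (dirSteps x l₁) (dirEdge d)) ∧ E.length = l₂.length + 1 + m.length) := by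
  rw [dirSteps_rotate] at hE
  rcases append_eq_split hE with ⟨X', h2, -⟩ | ⟨Y', h2, h3⟩
  · obtain ⟨m, a, m', rfl, h4, h5⟩ : ∃ m a m', l₂ = m ++ a :: m' ∧
        E = dirSteps ((start x).run l₁).cur m ∧ d = (((start x).run (l₁ ++ m)).cur, a.2) := by
      have hD : dirSteps x (l₁ ++ l₂) = (dirSteps x l₁ ++ E) ++ d :: X' := by
        rw [dirSteps_append x (start x) rfl, h2]; simp
      obtain ⟨m, a, m', h4, h5, h6⟩ := dirSteps_eq_split hD
      have hlen : l₁.length ≤ m.length := by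
        have := congrArg List.length h5
        simp at this; omega
      obtain ⟨r, rfl⟩ : ∃ r, m = l₁ ++ r := by
        have := List.prefix_of_prefix_length_le (l₃ := l₁ ++ l₂) (List.prefix_append l₁ l₂)
          ⟨a :: m', h4.symm⟩ hlen
        obtain ⟨r, hr⟩ := this
        exact ⟨r, hr.symm⟩
      refine ⟨r, a, m', ?_, ?_, h6⟩
      · rw [List.append_assoc] at h4
        exact List.append_cancel_left h4
      · rw [dirSteps_append x (start x) rfl] at h5
        exact List.append_cancel_left h5
    have hE' : E.length = m.length := by rw [h4]; simp
    rw [← List.append_assoc] at hf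
    rcases regular_split hf with ⟨h6, -⟩ | ⟨-, -, h7⟩
    · exact Or.inl ⟨m, a, m', rfl, by rw [h5], h6, hE'⟩
    · refine Or.inr (Or.inl ⟨m, a, m', rfl, h5, ?_, ?_⟩)
      · rw [h5]; exact h7
      -- In the order from `x` there is exactly one earlier traversal. Markedness in the rotated
      -- order makes the number of earlier traversals in `l₂` even, so this traversal lies in `l₁`.
      · have h8 := congrArg List.length h7
        rw [← edgeCount_eq_length, dirSteps_append x (start x) rfl, edgeCount_append, ← h4] at h8
        unfold MarkedAfter at hm
        rw [h5] at hm ⊢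
        rw [show dirEdge (((start x).run (l₁ ++ m)).cur, a.2)
          = s(((start x).run (l₁ ++ m)).cur, a.2) from rfl, Nat.even_iff] at *
        simp only [List.length_singleton] at h8
        omega
  · right; right
    cases Y' with
    | nil =>
      simp only [List.nil_append, List.cons.injEq] at h3
      left
      refine ⟨h3.1.symm, by rw [h2]; simp⟩
    | cons c Y' =>
      right
      simp only [List.cons_append, List.cons.injEq] at h3
      obtain ⟨rfl, h3⟩ := h3
      obtain ⟨m, a, m', rfl, rfl, hd⟩ := dirSteps_eq_split h3
      have hde : dirEdge d = s(((start x).run m).cur, a.2) := by rw [hd]; rfl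
      have ha := h1 a (by simp)
      have hf' := hf
      have ho' := ho
      rw [List.append_assoc, List.cons_append] at hf' ho'
      -- The edge of a step of `l₁` is crossed twice in all and differs from the closing edge.
      -- Comparing parities leaves only an opening whose number of traversals inside `l₁` is even.
      have c1 := edgeCount_of_closed hf' ho' ha
      have c2 := edgeCount_dirSteps_split x m m' a
      have c3 := edgeCount_closing_edge hf ho hj
      have c4 : edgeCount (dirSteps x ((m ++ a :: m') ++ l₂)) s(((start x).run m).cur, a.2)
          = edgeCount (dirSteps x (m ++ a :: m')) s(((start x).run m).cur, a.2) +
            edgeCount (dirSteps ((start x).run (m ++ a :: m')).cur l₂)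
              s(((start x).run m).cur, a.2) := by
        rw [dirSteps_append x (start x) rfl, edgeCount_append]
      have hne : dirEdge (((start x).run ((m ++ a :: m') ++ l₂)).cur, x)
          ≠ s(((start x).run m).cur, a.2) := by
        intro h
        have h : s(((start x).run ((m ++ a :: m') ++ l₂)).cur, x)
          = s(((start x).run m).cur, a.2) := h
        rw [h] at c3
        rw [List.append_assoc, List.cons_append] at c3
        omega
      unfold MarkedAfter at hm
      rw [h2, hde, edgeCount_append, edgeCount_cons, if_neg hne, Nat.even_iff] at hm
      rw [← List.cons_append, ← List.append_assoc] at c1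
      rcases regular_split hf' with ⟨h6, h7⟩ | ⟨-, -, h7⟩
      · refine ⟨m, a, m', rfl, hd, h6, by rw [hde]; exact h7, ?_, by rw [h2]; simp; omega⟩
        have h8 := congrArg List.length h7
        rw [← edgeCount_eq_length] at h8
        rw [hde, Nat.even_iff]
        simp only [List.length_nil] at h8
        omega
      · exfalso
        have h8 := congrArg List.length h7
        rw [← edgeCount_eq_length] at h8
        simp only [List.length_singleton] at h8
        omega

theorem mem_opn_iff_odd_edgeCount {l : List (Bool × Fin N)} (h1 : ∀ a ∈ l, a.1 = true)
    (e : Sym2 (Fin N)) :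
    e ∈ ((start x).run l).opn ↔ Odd (edgeCount (dirSteps x l) e) := by
  rw [← odd_edgeCount_iff, matrixSteps_eq_dirSteps x h1]

theorem numJump_eq_zero {V : Type*} {l : List (Bool × V)} (h1 : ∀ a ∈ l, a.1 = true) :
    numJump l = 0 := by
  rw [numJump, List.countP_eq_zero]
  intro a ha
  simp [h1 a ha]

/-- If the initial part of a closed regular walk is closed, the rotated walk has a marked step to
its starting vertex. -/
theorem reachesMarked_rotate (hf : ((start x).run (l₁ ++ l₂)).flags = 0)
    (ho : ((start x).run (l₁ ++ l₂)).opn = ∅) (hj : numJump (l₁ ++ l₂) ≠ 1)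
    (h1 : ∀ a ∈ l₁, a.1 = true) (ho1 : ((start x).run l₁).opn = ∅) :
    ReachesMarked ((start x).run l₁).cur
      (dirSteps ((start x).run l₁).cur (l₂ ++ (false, x) :: l₁)) := by
  refine ⟨_, _, _, dirSteps_rotate x l₁ l₂, ?_, ?_⟩
  · have c3 := edgeCount_closing_edge hf ho hj
    rw [dirSteps_append x (start x) rfl, edgeCount_append] at c3
    unfold MarkedAfter
    rw [show dirEdge (((start x).run (l₁ ++ l₂)).cur, x)
      = s(((start x).run (l₁ ++ l₂)).cur, x) from rfl, Nat.even_iff]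
    omega
  · obtain ⟨tl, h⟩ := exists_regularWalk (flags_prefix hf)
    obtain rfl := h.stack.opn_eq_empty.1 ho1
    obtain ⟨β, h2, h3, -⟩ := h.bottom
    have hβ : ((start x).run l₁).cur = β := by simpa using h2
    exact (hβ.trans (h3 (numJump_eq_zero h1))).symm

/-- A step to a vertex not yet visited cannot come after another step with the same end. -/
theorem fresh_injective {l m m' p p' : List (Bool × Fin N)} {a b : Bool × Fin N}
    (hm : l = m ++ a :: m') (hp : l = p ++ b :: p') (hb : b.2 ∉ ((start x).run p).vis)
    (hab : a.2 = b.2) : ¬ m.length < p.length := by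
  intro hlt
  rcases append_eq_split (hm.symm.trans hp) with ⟨X', h1, -⟩ | ⟨Y', h1, h2⟩
  · rw [h1] at hlt; simp at hlt
  · cases Y' with
    | nil => rw [h1] at hlt; simp at hlt
    | cons c Y' =>
      simp only [List.cons_append, List.cons.injEq] at h2
      obtain ⟨rfl, -⟩ := h2
      apply hb
      rw [h1, ← hab, show m ++ a :: Y' = (m ++ [a]) ++ Y' by simp]
      refine vis_prefix x _ _ ?_
      have hc := ((consistent_start x).run (m ++ [a])).cur_vis
      rwa [run_concat, step_cur, ← run_concat] at hc

/-- If the initial part of a closed regular walk is closed, the rotated walk is simple. -/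
theorem simpleSteps_rotate (hf : ((start x).run (l₁ ++ l₂)).flags = 0)
    (ho : ((start x).run (l₁ ++ l₂)).opn = ∅) (hj : numJump (l₁ ++ l₂) ≠ 1)
    (h1 : ∀ a ∈ l₁, a.1 = true) (ho1 : ((start x).run l₁).opn = ∅) :
    SimpleSteps (dirSteps ((start x).run l₁).cur (l₂ ++ (false, x) :: l₁)) := by
  -- Every marked step is either a first visit in the order from `x`, or the restored jump to `x`,
  -- which no first visit repeats. The conditional translates positions in that order into positions
  -- along the rotated path.
  have key : ∀ E d E', dirSteps ((start x).run l₁).cur (l₂ ++ (false, x) :: l₁) = E ++ d :: E' →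
      MarkedAfter E d → (∃ m a m', l₁ ++ l₂ = m ++ a :: m' ∧ d.2 = a.2 ∧
        a.2 ∉ ((start x).run m).vis ∧ E.length =
          if m.length < l₁.length then l₂.length + 1 + m.length else m.length - l₁.length) ∨
        (d.2 = x ∧ E.length = l₂.length) := by
    intro E d E' hE hm
    rcases rotated_marked hf ho hj h1 hE hm with ⟨m, a, m', h2, h3, h4, h5⟩ |
      ⟨m, a, m', -, -, -, h3⟩ | ⟨h3, h4⟩ | ⟨m, a, m', h2, h3, h4, -, -, h5⟩
    · refine Or.inl ⟨l₁ ++ m, a, m', by rw [h2]; simp, h3, h4, ?_⟩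
      rw [if_neg (by simp), h5]; simp
    · have := (mem_opn_iff_odd_edgeCount (x := x) h1 (dirEdge d)).2 (by rw [h3]; exact odd_one)
      rw [ho1] at this
      simp at this
    · exact Or.inr ⟨by rw [h3], h4⟩
    · refine Or.inl ⟨m, a, m' ++ l₂, by rw [h2]; simp, by rw [h3], h4, ?_⟩
      rw [if_pos (by rw [h2]; simp), h5]
  intro E d E' F c F' hE hF hmE hmF hdc
  rcases key E d E' hE hmE with ⟨m, a, m', h2, h3, h4, h5⟩ | ⟨h3, h4⟩ <;>
    rcases key F c F' hF hmF with ⟨p, b, p', k2, k3, k4, k5⟩ | ⟨k3, k4⟩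
  · have hab : a.2 = b.2 := by rw [← h3, ← k3, hdc]
    have e1 := fresh_injective h2 k2 k4 hab
    have e2 := fresh_injective k2 h2 h4 hab.symm
    rw [h5, k5, show m.length = p.length by omega]
  · exfalso
    apply h4
    rw [← h3, hdc, k3]
    exact vis_subset_run (start x) m (by simp [start])
  · exfalso
    apply k4
    rw [← k3, ← hdc, h3]
    exact vis_subset_run (start x) p (by simp [start])
  · rw [h4, k4]

/-- If the initial part of a closed regular walk is not closed, the rotated walk has no marked step
to its starting vertex. -/
theorem not_reachesMarked_rotate (hf : ((start x).run (l₁ ++ l₂)).flags = 0)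
    (ho : ((start x).run (l₁ ++ l₂)).opn = ∅) (hj : numJump (l₁ ++ l₂) ≠ 1)
    (h1 : ∀ a ∈ l₁, a.1 = true) (ho1 : ((start x).run l₁).opn ≠ ∅) :
    ¬ ReachesMarked ((start x).run l₁).cur
      (dirSteps ((start x).run l₁).cur (l₂ ++ (false, x) :: l₁)) := by
  rintro ⟨E, d, E', hE, hm, hd⟩
  obtain ⟨tl, h⟩ := exists_regularWalk (flags_prefix hf)
  have htl : tl ≠ [] := fun h' => ho1 (h.stack.opn_eq_empty.2 h')
  rcases rotated_marked hf ho hj h1 hE hm with ⟨m, a, m', h2, h3, h4, h5⟩ |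
    ⟨m, a, m', -, h4, h2, h3⟩ | ⟨h3, h4⟩ | ⟨m, a, m', h2, h3, h4, h5, h6, -⟩
  · apply h4
    rw [← h3, hd]
    exact vis_prefix x l₁ m h.consistent.cur_vis
  -- The edge is open after `l₁` and touches the origin, so it was first crossed towards the origin;
  -- the closing crossing leaves the origin and cannot end there.
  · have hmem := (mem_opn_iff_odd_edgeCount (x := x) h1 (dirEdge d)).2 (by rw [h3]; exact odd_one)
    have hde : dirEdge d = s(((start x).run l₁).cur, d.1) := by
      rw [← hd, Sym2.eq_swap]; rfl
    rw [hde, h.stack.opn_eq] at hmem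
    obtain ⟨tl', rfl⟩ := head_edge_mem_pathEdges h.stack.nodup hmem
    have h6 := h.opened [] _ _ _ rfl
    rw [dirSteps_append x (start x) rfl, onEdge_append, hde, h6] at h2
    simp only [List.cons_append, List.cons.injEq, Prod.mk.injEq] at h2
    have := h.stack.nodup
    rw [List.nodup_cons] at this
    apply this.1
    rw [h2.1.2]
    simp
  -- Here the origin would be `x`, the bottom of a nontrivial path without repetition of which it is
  -- also the current end.
  · obtain ⟨β, k1, k2, -⟩ := h.bottom
    rw [h3] at hd
    have hβ := k2 (numJump_eq_zero h1)
    have hx : x = ((start x).run l₁).cur := hd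
    have := h.stack.nodup
    rw [List.nodup_cons] at this
    apply this.1
    obtain ⟨c, tl, rfl⟩ := List.exists_cons_of_ne_nil htl
    rw [List.getLast?_cons_cons, hβ, hx] at k1
    exact List.mem_of_getLast? k1
  -- An edge opened and closed inside `l₁` leads to a vertex that is no longer on the path of open
  -- edges, whereas the origin is its current end.
  · have hne : dirEdge d ∉ ((start x).run l₁).opn := by
      rw [mem_opn_iff_odd_edgeCount h1, Nat.not_odd_iff_even]; exact h6
    have hD : onEdge (dirSteps x l₁) (dirEdge d) = d :: onEdge
        (dirSteps a.2 m') (dirEdge d) := by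
      rw [h2, dirSteps_append x (start x) rfl, onEdge_append, h5, List.nil_append]
      simp only [dirSteps]
      rw [← h3]
      simp [onEdge]
    rcases h.closed _ hne with k | ⟨c, k⟩ | ⟨u, v, hv, k⟩
    · rw [k] at hD; simp at hD
    · rw [edgeCount_eq_length, k] at h6
      simp at h6
    · rw [k] at hD
      have : d = (u, v) := (List.cons.inj hD).1.symm
      rw [this] at hd
      exact hv (by rw [← hd]; simp)

end rotation

end DeformedWigner

/-! ### Total weight of regular walks. -/

namespace DeformedWigner

variable {σ θ : ℝ} {N : ℕ}

namespace WalkState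

/-- A nontrivial path offers a single closing. An edge to a new vertex is neither a loop nor
reopened, so its weight is `σ²/N`. -/
theorem Stack.sum_step_eq {B : ℝ} {s : WalkState (Fin N)} {t : ℕ} {tl : List (Fin N)}
    (h : s.Stack tl) (hs : s.Consistent t) (hf : s.flags = 0) {Φ : Bool × Fin N → ℝ}
    (h0 : ∀ a, (s.step a).flags ≠ 0 → Φ a = 0) :
    ∑ a, stepWeight σ θ B s a * Φ a
      = (∑ w, if tl.head? = some w then Φ (true, w) else 0)
        + σ ^ 2 / N * (∑ w, if w ∉ s.vis then Φ (true, w) else 0)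
        + if tl = [] then θ / N * (∑ w, if w ∉ s.vis then Φ (false, w) else 0) else 0 := by
  rw [Fintype.sum_prod_type, Fintype.sum_bool]
  congr 1
  · rw [Finset.mul_sum, ← Finset.sum_add_distrib]
    refine Finset.sum_congr rfl fun w _ => ?_
    by_cases hfl : (s.step (true, w)).flags = 0
    · rcases h.step_cases hs hf hfl with ⟨w', tl', hw, rfl, ho, -⟩ | ⟨w', hw, hv, ho, -⟩ |
        ⟨w', hw, -⟩
      · obtain rfl : w = w' := (Prod.mk.inj hw).2
        have hv : w ∈ s.vis := h.mem_vis w (by simp)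
        simp [stepWeight, ho, hv]
      · obtain rfl : w = w' := (Prod.mk.inj hw).2
        have hh : tl.head? ≠ some w := fun hh =>
          hv (h.mem_vis w (List.mem_cons_of_mem _ (List.mem_of_mem_head? hh)))
        have hm : s.mult s(s.cur, w) = 0 := by
          rw [Sym2.eq_swap]; exact hs.mult_vis w s.cur hv
        have hne : s.cur ≠ w := fun e => hv (e ▸ hs.cur_vis)
        have hw : stepWeight σ θ B s (true, w) = σ ^ 2 / N := by
          simp [stepWeight, ho, hm, openWeight, hne]
        rw [if_neg hh, if_pos hv, hw, zero_add]
      · exact absurd (Prod.mk.inj hw).1 (by simp)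
    · rw [h0 _ hfl]; simp
  · have hz : ∀ w, (¬ (w ∉ s.vis) ∨ tl ≠ []) → Φ (false, w) = 0 := by
      intro w hw
      refine h0 _ fun hfl => ?_
      rcases h.step_cases hs hf hfl with ⟨w', tl', hw', -⟩ | ⟨w', hw', -⟩ | ⟨w', hw', hv, ht, -⟩
      · exact absurd (Prod.mk.inj hw').1 (by simp)
      · exact absurd (Prod.mk.inj hw').1 (by simp)
      · obtain rfl : w = w' := (Prod.mk.inj hw').2
        rcases hw with hw | hw
        · exact hw hv
        · exact hw ht
    split_ifs with ht
    · rw [Finset.mul_sum]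
      refine Finset.sum_congr rfl fun w _ => ?_
      by_cases hv : w ∉ s.vis
      · rw [if_pos hv]; simp [stepWeight]
      · rw [if_neg hv, hz w (Or.inl hv)]; simp
    · exact Finset.sum_eq_zero fun w _ => by rw [hz w (Or.inr ht), mul_zero]

theorem fresh_sum_bounds {s : WalkState (Fin N)} {φ : Fin N → ℝ} {κ c u : ℝ} (hN : 1 ≤ N)
    (hκ : κ ≤ 1 - s.vis.card / N) (hc : 0 ≤ c) (hu : 0 ≤ u)
    (h : ∀ w ∉ s.vis, c * u ≤ φ w ∧ φ w ≤ u) :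
    κ * (c * u) ≤ 1 / N * (∑ w, if w ∉ s.vis then φ w else 0) ∧
      1 / N * (∑ w, if w ∉ s.vis then φ w else 0) ≤ u := by
  have hN' : (0 : ℝ) < N := by exact_mod_cast hN
  rw [← Finset.sum_filter]
  have hcard : ((Finset.univ.filter fun w => w ∉ s.vis).card : ℝ) = N - s.vis.card := by
    have h1 : (Finset.univ.filter fun w => w ∉ s.vis) = s.visᶜ := by ext; simp
    rw [h1, Finset.card_compl, Fintype.card_fin, Nat.cast_sub]
    simpa using Finset.card_le_univ s.vis
  have hlow := Finset.card_nsmul_le_sum (Finset.univ.filter fun w => w ∉ s.vis) φ (c * u)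
    fun w hw => (h w (Finset.mem_filter.1 hw).2).1
  have hupp := Finset.sum_le_card_nsmul (Finset.univ.filter fun w => w ∉ s.vis) φ u
    fun w hw => (h w (Finset.mem_filter.1 hw).2).2
  rw [nsmul_eq_mul, hcard] at hlow hupp
  constructor
  · calc κ * (c * u) ≤ (1 - s.vis.card / N) * (c * u) := by gcongr
      _ = 1 / N * ((N - s.vis.card) * (c * u)) := by field_simp
      _ ≤ _ := by gcongr
  · calc 1 / N * _ ≤ 1 / N * ((N - s.vis.card : ℝ) * u) := by gcongr
      _ ≤ 1 / N * (N * u) := by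
        gcongr
        have : (0 : ℝ) ≤ s.vis.card := Nat.cast_nonneg _
        linarith
      _ = u := by field_simp

theorem Stack.sum_step_bounds {B : ℝ} {s : WalkState (Fin N)} {t : ℕ} {tl : List (Fin N)}
    (h : s.Stack tl) (hs : s.Consistent t) (hf : s.flags = 0) {Φ : Bool × Fin N → ℝ}
    (h0 : ∀ a, (s.step a).flags ≠ 0 → Φ a = 0) {κ c u d f : ℝ} (hN : 1 ≤ N) (hθ : 0 ≤ θ)
    (hκ : κ ≤ 1 - s.vis.card / N) (hc : 0 ≤ c) (hu : 0 ≤ u) (hd : 0 ≤ d) (hf' : 0 ≤ f)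
    (hclose : ∀ w tl', tl = w :: tl' → c * d ≤ Φ (true, w) ∧ Φ (true, w) ≤ d)
    (hopen : ∀ w ∉ s.vis, c * u ≤ Φ (true, w) ∧ Φ (true, w) ≤ u)
    (hjump : tl = [] → ∀ w ∉ s.vis, c * f ≤ Φ (false, w) ∧ Φ (false, w) ≤ f) :
    κ * c * (σ ^ 2 * u + if tl = [] then θ * f else d) ≤ ∑ a, stepWeight σ θ B s a * Φ a ∧
      ∑ a, stepWeight σ θ B s a * Φ a ≤ σ ^ 2 * u + if tl = [] then θ * f else d := by
  rw [h.sum_step_eq hs hf h0]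
  obtain ⟨u1, u2⟩ := fresh_sum_bounds hN hκ hc hu hopen
  have hsq := sq_nonneg σ
  have u3 := mul_le_mul_of_nonneg_left u1 hsq
  have u4 := mul_le_mul_of_nonneg_left u2 hsq
  rw [← mul_assoc (σ ^ 2) (1 / (N : ℝ)), mul_one_div] at u3 u4
  cases tl with
  | nil =>
    obtain ⟨f1, f2⟩ := fresh_sum_bounds hN hκ hc hf' (hjump rfl)
    have f3 := mul_le_mul_of_nonneg_left f1 hθ
    have f4 := mul_le_mul_of_nonneg_left f2 hθ
    rw [← mul_assoc θ (1 / (N : ℝ)), mul_one_div] at f3 f4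
    have : (∑ w, if ([] : List (Fin N)).head? = some w then Φ (true, w) else 0) = 0 :=
      Finset.sum_eq_zero fun w _ => by simp
    rw [this, if_pos rfl, if_pos rfl, zero_add]
    constructor
    · calc _ = σ ^ 2 * (κ * (c * u)) + θ * (κ * (c * f)) := by ring
        _ ≤ _ := add_le_add u3 f3
    · exact add_le_add u4 f4
  | cons w tl =>
    have : (∑ v, if (w :: tl).head? = some v then Φ (true, v) else 0) = Φ (true, w) := by
      simp
    rw [this, if_neg (by simp), if_neg (by simp), add_zero]
    obtain ⟨d1, d2⟩ := hclose w tl rfl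
    have hκ1 : κ ≤ 1 := hκ.trans (by
      have : (0 : ℝ) ≤ s.vis.card / N := by positivity
      linarith)
    have : κ * (c * d) ≤ c * d := mul_le_of_le_one_left (by positivity) hκ1
    constructor
    · calc _ = κ * (c * d) + σ ^ 2 * (κ * (c * u)) := by ring
        _ ≤ _ := add_le_add (this.trans d1) u3
    · rw [add_comm]; exact add_le_add u4 d2

/-- Total weight of the regular closed walks of length `n` from the state `s`. -/
noncomputable def regularSum (σ θ B : ℝ) (n : ℕ) (s : WalkState (Fin N)) : ℝ :=
  walkSum n fun l => if (s.run l).opn = ∅ ∧ (s.run l).flags = 0 then listWeight σ θ B s l else 0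

/-- Total weight of the regular closed walks of length `n` from the state `s` whose first `j` steps
are matrix steps after which the walk is closed. -/
noncomputable def splitSum (σ θ B : ℝ) (n j : ℕ) (s : WalkState (Fin N)) : ℝ :=
  walkSum n fun l => if StartsWith j l ∧ (s.run (l.take j)).opn = ∅ ∧ (s.run l).opn = ∅ ∧
    (s.run l).flags = 0 then listWeight σ θ B s l else 0

theorem regularSum_succ (B : ℝ) (n : ℕ) (s : WalkState (Fin N)) :
    regularSum σ θ B (n + 1) s = ∑ a, stepWeight σ θ B s a * regularSum σ θ B n (s.step a) := by
  unfold regularSum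
  simp only [walkSum]
  refine Finset.sum_congr rfl fun a _ => ?_
  rw [← walkSum_mul_left]
  refine walkSum_congr fun l _ => ?_
  rw [mul_ite, mul_zero]
  rfl

theorem regularSum_of_flags {B : ℝ} (n : ℕ) {s : WalkState (Fin N)} (h : s.flags ≠ 0) :
    regularSum σ θ B n s = 0 := by
  unfold regularSum
  refine (walkSum_congr fun l _ => ?_).trans (walkSum_const_zero (α := Bool × Fin N) (M := ℝ) n)
  rw [if_neg]
  have := flags_le_run s l
  omega

theorem splitSum_succ (B : ℝ) (n j : ℕ) (s : WalkState (Fin N)) :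
    splitSum σ θ B (n + 1) (j + 1) s =
      ∑ a, stepWeight σ θ B s a * if a.1 = true then splitSum σ θ B n j (s.step a) else 0 := by
  unfold splitSum
  simp only [walkSum]
  refine Finset.sum_congr rfl fun a _ => ?_
  by_cases ha : a.1 = true
  · rw [if_pos ha, ← walkSum_mul_left]
    refine walkSum_congr fun l _ => ?_
    rw [mul_ite, mul_zero]
    exact if_congr (and_congr_left fun _ => by simp [startsWith_cons, ha]) rfl rfl
  · rw [if_neg ha, mul_zero]
    refine (walkSum_congr fun l _ => ?_).trans (walkSum_const_zero (α := Bool × Fin N) (M := ℝ) n)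
    rw [if_neg]
    simp [startsWith_cons, ha]

theorem splitSum_of_flags {B : ℝ} (n j : ℕ) {s : WalkState (Fin N)} (h : s.flags ≠ 0) :
    splitSum σ θ B n j s = 0 := by
  unfold splitSum
  refine (walkSum_congr fun l _ => ?_).trans (walkSum_const_zero (α := Bool × Fin N) (M := ℝ) n)
  rw [if_neg]
  have := flags_le_run s l
  omega

theorem Stack.regular_open {s : WalkState (Fin N)} {t : ℕ} {tl : List (Fin N)}
    (h : s.Stack tl) (hs : s.Consistent t) (hf : s.flags = 0) {w : Fin N} (hw : w ∉ s.vis) :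
    (s.step (true, w)).Stack (s.cur :: tl) ∧ (s.step (true, w)).flags = 0 ∧
      (s.step (true, w)).opn.card = s.opn.card + 1 := by
  have ho := hs.open_vis (w := s.cur) hw
  rw [step_open ho]
  refine ⟨h.opening hw, by simp [openStep, hw, hf], ?_⟩
  simp only [openStep]
  rw [Finset.card_insert_of_notMem ho]

theorem Stack.regular_close {s : WalkState (Fin N)} {tl : List (Fin N)} {w : Fin N}
    (h : s.Stack (w :: tl)) (hf : s.flags = 0) :
    (s.step (true, w)).Stack tl ∧ (s.step (true, w)).flags = 0 ∧
      (s.step (true, w)).opn.card + 1 = s.opn.card := by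
  have ho : s(s.cur, w) ∈ s.opn := by rw [h.opn_eq]; simp [pathEdges]
  rw [step_close ho]
  exact ⟨h.close, hf, Finset.card_erase_add_one ho⟩

theorem Stack.regular_jump {s : WalkState (Fin N)} (h : s.Stack []) (hf : s.flags = 0) {w : Fin N}
    (hw : w ∉ s.vis) :
    (s.step (false, w)).Stack [] ∧ (s.step (false, w)).flags = 0 ∧
      (s.step (false, w)).opn.card = s.opn.card := by
  rw [step_jump]
  refine ⟨h.jump w, ?_, rfl⟩
  simp only [jumpStep]
  rw [if_neg (not_or.2 ⟨h.even_degree, hw⟩), hf]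

theorem Consistent.one_sub_le {s : WalkState (Fin N)} {t T : ℕ} (hs : s.Consistent t)
    (ht : t ≤ T) : 1 - ((T : ℝ) + 1) / N ≤ 1 - s.vis.card / N := by
  have : (s.vis.card : ℝ) ≤ T + 1 := by
    have := hs.vis_le
    exact_mod_cast this.trans (by omega)
  gcongr

theorem Stack.card_eq_zero {s : WalkState (Fin N)} {tl : List (Fin N)} (h : s.Stack tl) :
    s.opn.card = 0 ↔ tl = [] := by rw [Finset.card_eq_zero, h.opn_eq_empty]

/-- The first-step recursion is that of `ballot`, except that a new vertex is chosen among at least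
`N - (T + 1)` vertices instead of `N`. -/
theorem regularSum_bounds {B : ℝ} (hN : 1 ≤ N) (hθ : 0 ≤ θ) {T : ℕ}
    (hT : 0 ≤ 1 - ((T : ℝ) + 1) / N) (n : ℕ) {s : WalkState (Fin N)} {t : ℕ} {tl : List (Fin N)}
    (h : s.Stack tl) (hs : s.Consistent t) (hf : s.flags = 0) (ht : t + n ≤ T) :
    (1 - ((T : ℝ) + 1) / N) ^ n * ballot σ θ n 0 s.opn.card ≤ regularSum σ θ B n s ∧
      regularSum σ θ B n s ≤ ballot σ θ n 0 s.opn.card := by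
  induction n generalizing s t tl with
  | zero =>
    have : regularSum σ θ B 0 s = ballot σ θ 0 0 s.opn.card := by
      simp only [regularSum, walkSum, run_nil, hf, and_true, listWeight, ballot, Finset.card_eq_zero]
    rw [this]; simp
  | succ n ih =>
    rw [regularSum_succ]
    have hb := fun k => ballot_nonneg (σ := σ) hθ n 0 k
    have key := h.sum_step_bounds (σ := σ) (θ := θ) (B := B) hs hf
      (Φ := fun a => regularSum σ θ B n (s.step a)) (fun a ha => regularSum_of_flags n ha)
      (κ := 1 - ((T : ℝ) + 1) / N) (c := (1 - ((T : ℝ) + 1) / N) ^ n)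
      (u := ballot σ θ n 0 (s.opn.card + 1)) (d := ballot σ θ n 0 (s.opn.card - 1))
      (f := ballot σ θ n 0 s.opn.card) hN hθ (hs.one_sub_le (by omega)) (by positivity)
      (hb _) (hb _) (hb _) ?_ ?_ ?_
    · rw [← pow_succ'] at key
      have e : ballot σ θ (n + 1) 0 s.opn.card = σ ^ 2 * ballot σ θ n 0 (s.opn.card + 1) +
          if tl = [] then θ * ballot σ θ n 0 s.opn.card else ballot σ θ n 0 (s.opn.card - 1) := by
        have hc := h.card_eq_zero
        cases hk : s.opn.card with
        | zero => rw [if_pos (hc.1 hk)]; simp [ballot]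
        | succ k => rw [if_neg (fun h' => by rw [hc.2 h'] at hk; omega)]; simp [ballot]
      rw [e]; exact key
    · rintro w tl' rfl
      obtain ⟨h1, h2, h3⟩ := h.regular_close hf
      have := ih h1 (hs.step _) h2 (by omega)
      rwa [show (s.step (true, w)).opn.card = s.opn.card - 1 by omega] at this
    · intro w hw
      obtain ⟨h1, h2, h3⟩ := h.regular_open hs hf hw
      have := ih h1 (hs.step _) h2 (by omega)
      rwa [h3] at this
    · rintro rfl w hw
      obtain ⟨h1, h2, h3⟩ := h.regular_jump hf hw
      have := ih h1 (hs.step _) h2 (by omega)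
      rwa [h3] at this

theorem splitSum_bounds {B : ℝ} (hN : 1 ≤ N) (hθ : 0 ≤ θ) {T : ℕ}
    (hT : 0 ≤ 1 - ((T : ℝ) + 1) / N) (n j : ℕ) (hj : j ≤ n) {s : WalkState (Fin N)} {t : ℕ}
    {tl : List (Fin N)} (h : s.Stack tl) (hs : s.Consistent t) (hf : s.flags = 0)
    (ht : t + n ≤ T) :
    (1 - ((T : ℝ) + 1) / N) ^ n * (ballot σ θ j j s.opn.card * ballot σ θ (n - j) 0 0)
        ≤ splitSum σ θ B n j s ∧
      splitSum σ θ B n j s ≤ ballot σ θ j j s.opn.card * ballot σ θ (n - j) 0 0 := by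
  induction j generalizing n s t tl with
  | zero =>
    by_cases ho : s.opn = ∅
    · have e : splitSum σ θ B n 0 s = regularSum σ θ B n s := by
        unfold splitSum regularSum
        refine walkSum_congr fun l _ => if_congr ?_ rfl rfl
        simp [startsWith_zero, ho]
      have := regularSum_bounds (σ := σ) (B := B) hN hθ hT n h hs hf ht
      rw [ho, Finset.card_empty] at this ⊢
      rw [e]
      simpa [ballot] using this
    · have e : splitSum σ θ B n 0 s = 0 := by
        unfold splitSum
        refine (walkSum_congr fun l _ => ?_).trans
          (walkSum_const_zero (α := Bool × Fin N) (M := ℝ) n)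
        rw [if_neg]
        simp [ho]
      rw [e]
      simp [ballot, ho]
  | succ j ih =>
    obtain ⟨n, rfl⟩ : ∃ m, n = m + 1 := ⟨n - 1, by omega⟩
    rw [splitSum_succ, Nat.add_sub_add_right]
    have hb := fun k => mul_nonneg (ballot_nonneg (σ := σ) hθ j j k)
      (ballot_nonneg (σ := σ) hθ (n - j) 0 0)
    have key := h.sum_step_bounds (σ := σ) (θ := θ) (B := B) hs hf
      (Φ := fun a => if a.1 = true then splitSum σ θ B n j (s.step a) else 0)
      (fun a ha => by simp [splitSum_of_flags n j ha])
      (κ := 1 - ((T : ℝ) + 1) / N) (c := (1 - ((T : ℝ) + 1) / N) ^ n)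
      (u := ballot σ θ j j (s.opn.card + 1) * ballot σ θ (n - j) 0 0)
      (d := ballot σ θ j j (s.opn.card - 1) * ballot σ θ (n - j) 0 0)
      -- The value zero for jumps encodes that the first `j` steps are matrix steps.
      (f := 0) hN hθ (hs.one_sub_le (by omega)) (by positivity)
      (hb _) (hb _) le_rfl ?_ ?_ ?_
    · rw [← pow_succ'] at key
      have e : ballot σ θ (j + 1) (j + 1) s.opn.card * ballot σ θ (n - j) 0 0
          = σ ^ 2 * (ballot σ θ j j (s.opn.card + 1) * ballot σ θ (n - j) 0 0) +
          if tl = [] then θ * 0 else ballot σ θ j j (s.opn.card - 1) * ballot σ θ (n - j) 0 0 := by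
        have hc := h.card_eq_zero
        cases hk : s.opn.card with
        | zero => rw [if_pos (hc.1 hk)]; simp [ballot]; ring
        | succ k =>
          rw [if_neg (fun h' => by rw [hc.2 h'] at hk; omega)]; simp [ballot]; ring
      rw [e]; exact key
    · rintro w tl' rfl
      obtain ⟨h1, h2, h3⟩ := h.regular_close hf
      have := ih n (by omega) h1 (hs.step _) h2 (by omega)
      rw [show (s.step (true, w)).opn.card = s.opn.card - 1 by omega] at this
      simpa using this
    · intro w hw
      obtain ⟨h1, h2, h3⟩ := h.regular_open hs hf hw
      have := ih n (by omega) h1 (hs.step _) h2 (by omega)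
      rw [h3] at this
      simpa using this
    · rintro rfl w hw
      simp

end WalkState

end DeformedWigner

/-! ### Rotation to the last jump, and closed paths as lists of steps. -/

namespace DeformedWigner

variable {σ θ : ℝ} {N : ℕ}

open WalkState

section walkSum

variable {M : Type*} [AddCommMonoid M]

theorem walkSum_insert {α : Type*} [Fintype α] (n j : ℕ) (hj : j ≤ n) (φ : List α → M) :
    walkSum (n + 1) φ = ∑ a, walkSum n fun l => φ (l.take j ++ a :: l.drop j) := by
  induction j generalizing n φ with
  | zero => rfl
  | succ j ih =>
    obtain ⟨n, rfl⟩ : ∃ m, n = m + 1 := ⟨n - 1, by omega⟩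
    have h1 : walkSum (n + 1 + 1) φ = ∑ b, walkSum (n + 1) fun l => φ (b :: l) := rfl
    rw [h1, Finset.sum_congr rfl fun b _ => ih n (by omega) fun l => φ (b :: l), Finset.sum_comm]
    rfl

theorem walkSum_finset_sum {α ι : Type*} [Fintype α] (n : ℕ) (s : Finset ι) (φ : ι → List α → M) :
    walkSum n (fun l => ∑ i ∈ s, φ i l) = ∑ i ∈ s, walkSum n (φ i) := by
  simp only [walkSum_eq_sum]
  exact Finset.sum_comm

theorem startsWith_insert {V : Type*} {j : ℕ} {l : List (Bool × V)} (hj : j ≤ l.length) (a : Bool × V) :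
    StartsWith j (l.take j ++ a :: l.drop j) ↔ StartsWith j l := by
  unfold StartsWith
  rw [List.take_append_of_le_length (by simp [hj]), List.take_take, min_self]

variable {V : Type*} [Fintype V]

/-- Lists of steps are sorted by the number of steps after the last jump, and rotated so that the
last jump comes last. -/
theorem walkSum_rotate (L : ℕ) (F : List (Bool × V) → M) :
    walkSum L F = walkSum L (fun l => if StartsWith L l then F l else 0) +
      ∑ j ∈ Finset.range L, walkSum (L - 1) fun f =>
        if StartsWith j f then ∑ x, F (f.drop j ++ (false, x) :: f.take j) else 0 := by
  induction L generalizing F with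
  | zero => simp [walkSum, startsWith_zero]
  | succ L ih =>
    have h1 : walkSum (L + 1) F = ∑ a, walkSum L fun l => F (a :: l) := rfl
    rw [h1, Finset.sum_congr rfl fun a _ => ih fun l => F (a :: l), Finset.sum_add_distrib, Finset.sum_comm (t := Finset.range L)]
    -- If the last jump lies after the first letter `a`, then `a` lands right behind the first `j`
    -- letters of the rotated list. The remaining index `j = L` is the case where `a` itself is the
    -- last jump.
    have h2 : ∀ j ∈ Finset.range L, (∑ a, walkSum (L - 1) fun f =>
          if StartsWith j f then ∑ x, F (a :: (f.drop j ++ (false, x) :: f.take j)) else 0) =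
        walkSum L fun f =>
          if StartsWith j f then ∑ x, F (f.drop j ++ (false, x) :: f.take j) else 0 := by
      intro j hj
      rw [Finset.mem_range] at hj
      obtain ⟨m, rfl⟩ : ∃ m, L = m + 1 := ⟨L - 1, by omega⟩
      rw [walkSum_insert m j (by omega)]
      refine Finset.sum_congr rfl fun a _ => walkSum_congr fun l hl => ?_
      have hjl : j ≤ l.length := by omega
      rw [if_congr (startsWith_insert hjl a) rfl rfl]
      have e1 : (l.take j ++ a :: l.drop j).take j = l.take j := by
        rw [List.take_append_of_le_length (by simp [hjl]), List.take_take, min_self]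
      have e2 : (l.take j ++ a :: l.drop j).drop j = a :: l.drop j := by
        rw [List.drop_append_of_le_length (by simp [hjl])]
        simp
      rw [e1, e2]
      rfl
    rw [Finset.sum_congr rfl h2, Finset.sum_range_succ, Nat.add_sub_cancel, Fintype.sum_prod_type,
      Fintype.sum_bool]
    have h3 : (walkSum (L + 1) fun l => if StartsWith (L + 1) l then F l else 0) =
        ∑ x, walkSum L fun l => if StartsWith L l then F ((true, x) :: l) else 0 := by
      have : (walkSum (L + 1) fun l => if StartsWith (L + 1) l then F l else 0) =
          ∑ a, walkSum L fun l => if StartsWith (L + 1) (a :: l) then F (a :: l) else 0 := rfl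
      rw [this, Fintype.sum_prod_type, Fintype.sum_bool]
      have hz : ∑ x, (walkSum L fun l => if StartsWith (L + 1) ((false, x) :: l) then
          F ((false, x) :: l) else 0) = 0 := by
        refine Finset.sum_eq_zero fun x _ => ?_
        refine (walkSum_congr fun l _ => ?_).trans
          (walkSum_const_zero (α := Bool × V) (M := M) L)
        rw [if_neg]
        simp [startsWith_cons]
      rw [hz, add_zero]
      refine Finset.sum_congr rfl fun x _ => walkSum_congr fun l _ => if_congr ?_ rfl rfl
      simp [startsWith_cons]
    have h4 : (walkSum L fun f => if StartsWith L f then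
          ∑ x, F (f.drop L ++ (false, x) :: f.take L) else 0) =
        ∑ x, walkSum L fun l => if StartsWith L l then F ((false, x) :: l) else 0 := by
      rw [← walkSum_finset_sum]
      refine walkSum_congr fun l hl => ?_
      rw [← hl, List.drop_length, List.take_length]
      split_ifs <;> simp
    rw [h3, h4, add_assoc, add_comm (Finset.sum _ _) (Finset.sum _ _), ← add_assoc]

end walkSum

section paths

variable {L : ℕ}

theorem take_ofFn_succ {α : Type*} (d : Fin L → α) {k : ℕ} (hk : k < L) :
    (List.ofFn d).take (k + 1) = (List.ofFn d).take k ++ [d ⟨k, hk⟩] := by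
  rw [List.take_succ_eq_append_getElem (by simpa using hk)]
  simp

theorem ofFn_split {α : Type*} (d : Fin L → α) (t : Fin L) :
    List.ofFn d = (List.ofFn d).take t ++ d t :: (List.ofFn d).drop (t + 1) := by
  conv_lhs => rw [← List.take_append_drop (t + 1) (List.ofFn d), take_ofFn_succ d t.2]
  simp

theorem eq_of_ofFn_split {α : Type*} {d : Fin L → α} {E E' : List α} {c : α}
    (h : List.ofFn d = E ++ c :: E') :
    ∃ t : Fin L, E.length = t ∧ E = (List.ofFn d).take t ∧ c = d t := by
  have hlen : E.length < L := by
    have := congrArg List.length h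
    simp at this
    omega
  refine ⟨⟨E.length, hlen⟩, rfl, by rw [h]; simp, ?_⟩
  have h1 : (List.ofFn d)[E.length]'(by simpa using hlen) = d ⟨E.length, hlen⟩ := by simp
  rw [← h1]
  simp [h]

theorem edgeCount_take_ofFn (d : Fin L → Fin N × Fin N) (e : Sym2 (Fin N)) (k : ℕ) (hk : k ≤ L) :
    edgeCount ((List.ofFn d).take k) e
      = (Finset.univ.filter fun u : Fin L => (u : ℕ) < k ∧ dirEdge (d u) = e).card := by
  induction k with
  | zero => simp
  | succ k ih =>
    rw [take_ofFn_succ d hk, edgeCount_append, ih (by omega), edgeCount_cons, edgeCount_nil, zero_add]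
    by_cases he : dirEdge (d ⟨k, hk⟩) = e
    · rw [if_pos he]
      have : (Finset.univ.filter fun u : Fin L => (u : ℕ) < k + 1 ∧ dirEdge (d u) = e)
          = insert ⟨k, hk⟩ (Finset.univ.filter fun u : Fin L => (u : ℕ) < k ∧ dirEdge (d u) = e) := by
        ext u
        simp only [Finset.mem_filter, Finset.mem_univ, true_and, Finset.mem_insert, Fin.ext_iff]
        constructor
        · rintro ⟨h1, h2⟩
          by_cases h3 : (u : ℕ) = k
          · exact Or.inl h3
          · exact Or.inr ⟨by omega, h2⟩
        · rintro (h1 | ⟨h1, h2⟩)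
          · exact ⟨by omega, by rw [← he]; congr 2; exact Fin.ext h1⟩
          · exact ⟨by omega, h2⟩
      rw [this, Finset.card_insert_of_notMem (by simp)]
    · rw [if_neg he, add_zero]
      congr 1
      ext u
      simp only [Finset.mem_filter, Finset.mem_univ, true_and]
      constructor
      · rintro ⟨h1, h2⟩
        exact ⟨by omega, h2⟩
      · rintro ⟨h1, h2⟩
        refine ⟨?_, h2⟩
        by_contra h3
        apply he
        rw [← h2]; congr 2
        exact Fin.ext (by simp; omega)

/-- The directed steps of a closed path. -/
def ClosedPath.steps (p : ClosedPath N L) (t : Fin L) : Fin N × Fin N :=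
  (p.1 t.castSucc, p.1 t.succ)

theorem ClosedPath.marked_iff (p : ClosedPath N L) (t : Fin L) :
    p.Marked t ↔ MarkedAfter ((List.ofFn p.steps).take t) (p.steps t) := by
  unfold ClosedPath.Marked MarkedAfter
  rw [edgeCount_take_ofFn _ _ _ t.2.le]
  have h : (Finset.univ.filter fun u : Fin L => u ≤ t ∧ p.edge u = p.edge t)
      = insert t (Finset.univ.filter fun u : Fin L => (u : ℕ) < t ∧
        dirEdge (p.steps u) = dirEdge (p.steps t)) := by
    ext u
    simp only [Finset.mem_filter, Finset.mem_univ, true_and, Finset.mem_insert]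
    constructor
    · rintro ⟨h1, h2⟩
      rcases eq_or_lt_of_le h1 with h3 | h3
      · exact Or.inl h3
      · exact Or.inr ⟨h3, h2⟩
    · rintro (rfl | ⟨h1, h2⟩)
      · exact ⟨le_rfl, rfl⟩
      · exact ⟨le_of_lt h1, h2⟩
  rw [h, Finset.card_insert_of_notMem (by simp)]
  -- `Marked` counts the current instant and `MarkedAfter` does not, hence odd against even.
  rw [Nat.odd_add_one, Nat.not_odd_iff_even]

theorem ClosedPath.markedOrigin_iff (p : ClosedPath N L) :
    p.MarkedOrigin ↔ ReachesMarked (p.1 0) (List.ofFn p.steps) := by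
  constructor
  · rintro ⟨t, h1, h2⟩
    exact ⟨_, _, _, ofFn_split p.steps t, (p.marked_iff t).1 h1, h2⟩
  · rintro ⟨E, c, E', h, h1, h2⟩
    obtain ⟨t, -, rfl, rfl⟩ := eq_of_ofFn_split h
    exact ⟨t, (p.marked_iff t).2 h1, h2⟩

theorem ClosedPath.isSimple_iff (p : ClosedPath N L) :
    p.IsSimple ↔ SimpleSteps (List.ofFn p.steps) := by
  constructor
  · intro hp E d E' F c F' h1 h2 h3 h4 h5
    obtain ⟨t, ht, rfl, rfl⟩ := eq_of_ofFn_split h1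
    obtain ⟨u, hu, rfl, rfl⟩ := eq_of_ofFn_split h2
    rw [hp t u ((p.marked_iff t).2 h3) ((p.marked_iff u).2 h4) h5]
  · intro hp t u h1 h2 h3
    have := hp _ _ _ _ _ _ (ofFn_split p.steps t) (ofFn_split p.steps u) ((p.marked_iff t).1 h1)
      ((p.marked_iff u).1 h2) h3
    rw [List.length_take, List.length_take, List.length_ofFn] at this
    exact Fin.ext (by have := t.2; have := u.2; omega)

theorem cons_tail_snd {V : Type*} (g : Fin (L + 1) → Bool × V) :
    (Fin.cons (g 0).2 fun u : Fin L => (g u.succ).2 : Fin (L + 1) → V) = fun u => (g u).2 := by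
  funext t
  exact Fin.cases rfl (fun _ => rfl) t

theorem dirSteps_ofFn (x : Fin N) (g : Fin L → Bool × Fin N) :
    dirSteps x (List.ofFn g) = List.ofFn fun t : Fin L =>
      ((Fin.cons x fun u => (g u).2 : Fin (L + 1) → Fin N) t.castSucc, (g t).2) := by
  induction L generalizing x with
  | zero => rfl
  | succ L ih =>
    rw [List.ofFn_succ, dirSteps, ih, List.ofFn_succ]
    congr 2
    funext t
    have h := cons_tail_snd g
    rw [h, ← Fin.succ_castSucc, Fin.cons_succ]

theorem run_cur_eq {V : Type*} [DecidableEq V] {s s' : WalkState V} (h : s.cur = s'.cur)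
    (l : List (Bool × V)) : (s.run l).cur = (s'.run l).cur := by
  induction l generalizing s s' with
  | nil => exact h
  | cons a l ih => exact ih (by rw [step_cur, step_cur])

theorem run_ofFn_cur (x : Fin N) (g : Fin L → Bool × Fin N) :
    ((start x).run (List.ofFn g)).cur
      = (Fin.cons x fun u => (g u).2 : Fin (L + 1) → Fin N) (Fin.last L) := by
  induction L generalizing x with
  | zero => rfl
  | succ L ih =>
    rw [List.ofFn_succ, run_cons, run_cur_eq (s' := start (g 0).2) (step_cur _ _), ih]
    have h := cons_tail_snd g
    rw [h, ← Fin.succ_last, Fin.cons_succ]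

end paths

end DeformedWigner

/-! ### Expansion of a contribution over walks. -/

namespace DeformedWigner

variable {σ θ : ℝ} {N : ℕ}

open WalkState

section expansion

variable {Ω : Type*} [MeasurableSpace Ω] {P : Measure Ω}
  {W : Ω → Matrix (Fin N) (Fin N) ℂ} {b : ℝ} {L : ℕ}

/-- Product of the terms selected by a list of steps. -/
noncomputable def stepProd (θ : ℝ) (w : Matrix (Fin N) (Fin N) ℂ) :
    Fin N → List (Bool × Fin N) → ℂ
  | _, [] => 1
  | x, a :: l => (if a.1 = true then w x a.2 / ((√(N : ℝ) : ℝ) : ℂ) else (θ : ℂ) / (N : ℂ)) *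
      stepProd θ w a.2 l

theorem stepProd_eq (w : Matrix (Fin N) (Fin N) ℂ) (x : Fin N) (l : List (Bool × Fin N)) :
    stepProd θ w x l =
      ((((√(N : ℝ))⁻¹ ^ (matrixSteps x l).length * (θ / N) ^ numJump l : ℝ)) : ℂ) *
        ((matrixSteps x l).map fun d => w d.1 d.2).prod := by
  induction l generalizing x with
  | nil => simp [stepProd, matrixSteps, numJump]
  | cons a l ih =>
    obtain ⟨c, y⟩ := a
    cases c with
    | false =>
      have h2 : numJump ((false, y) :: l) = numJump l + 1 := by simp [numJump]
      have h3 : matrixSteps x ((false, y) :: l) = matrixSteps y l := by simp [matrixSteps]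
      rw [h2, h3, stepProd, ih]
      simp only [Bool.false_eq_true, if_false]
      push_cast
      ring
    | true =>
      have h2 : numJump ((true, y) :: l) = numJump l := by simp [numJump]
      have h3 : matrixSteps x ((true, y) :: l) = (x, y) :: matrixSteps y l := by simp [matrixSteps]
      rw [h2, h3, stepProd, ih]
      simp only [if_true, List.length_cons, List.map_cons, List.prod_cons]
      push_cast
      ring

theorem stepProd_ofFn (w : Matrix (Fin N) (Fin N) ℂ) (x : Fin N) (g : Fin L → Bool × Fin N) :
    stepProd θ w x (List.ofFn g) = ∏ t : Fin L, if (g t).1 = true then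
      w ((Fin.cons x fun u => (g u).2 : Fin (L + 1) → Fin N) t.castSucc) (g t).2 /
        ((√(N : ℝ) : ℝ) : ℂ) else (θ : ℂ) / (N : ℂ) := by
  induction L generalizing x with
  | zero => simp [stepProd]
  | succ L ih =>
    rw [List.ofFn_succ, stepProd, ih, Fin.prod_univ_succ]
    congr 1
    refine Finset.prod_congr rfl fun t _ => ?_
    have h := cons_tail_snd g
    rw [h, ← Fin.succ_castSucc, Fin.cons_succ]

theorem WignerLike.integrable_stepProd [IsProbabilityMeasure P] (h : WignerLike σ b P W) (x : Fin N)
    (l : List (Bool × Fin N)) : Integrable (fun ω => stepProd θ (W ω) x l) P := by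
  simp only [stepProd_eq]
  refine Integrable.const_mul ?_ _
  have h1 := h.integrable_prod (Finset.univ : Finset (Fin (matrixSteps x l).length))
    fun i => (matrixSteps x l)[i]
  refine h1.congr (Filter.Eventually.of_forall fun ω => ?_)
  exact Fin.prod_univ_fun_getElem (matrixSteps x l) fun d => W ω d.1 d.2

theorem integral_stepProd (x : Fin N) (l : List (Bool × Fin N)) :
    ∫ ω, stepProd θ (W ω) x l ∂P = walkExpect θ P W x l := by
  simp only [stepProd_eq]
  rw [integral_const_mul]
  rfl

theorem WignerLike.integral_prod_deformed [IsProbabilityMeasure P] (h : WignerLike σ b P W) (x : Fin N)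
    (y : Fin L → Fin N) :
    ∫ ω, ∏ t : Fin L, deformed θ (W ω) ((Fin.cons x y : Fin (L + 1) → Fin N) t.castSucc) (y t) ∂P
      = ∑ c : Fin L → Bool, walkExpect θ P W x (List.ofFn fun t => (c t, y t)) := by
  have h1 : ∀ ω, ∏ t : Fin L,
      deformed θ (W ω) ((Fin.cons x y : Fin (L + 1) → Fin N) t.castSucc) (y t)
      = ∑ c : Fin L → Bool, stepProd θ (W ω) x (List.ofFn fun t => (c t, y t)) := by
    intro ω
    have h2 : ∀ t : Fin L,
        deformed θ (W ω) ((Fin.cons x y : Fin (L + 1) → Fin N) t.castSucc) (y t) =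
        ∑ c ∈ (Finset.univ : Finset Bool), if c = true then
          W ω ((Fin.cons x y : Fin (L + 1) → Fin N) t.castSucc) (y t) / ((√(N : ℝ) : ℝ) : ℂ)
          else (θ : ℂ) / (N : ℂ) := by
      intro t
      rw [Fintype.sum_bool]
      simp [deformed]
    rw [Finset.prod_congr rfl fun t _ => h2 t, Finset.prod_univ_sum, Fintype.piFinset_univ]
    refine Finset.sum_congr rfl fun c _ => ?_
    rw [stepProd_ofFn]
  simp only [h1]
  rw [integral_finsetSum _ fun c _ => h.integrable_stepProd x _]
  exact Finset.sum_congr rfl fun c _ => integral_stepProd x _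

open Classical in
/-- Expansion of a contribution as a sum over walks. -/
theorem WignerLike.contribution_eq [IsProbabilityMeasure P] (h : WignerLike σ b P W)
    {A : ClosedPath N L → Prop}
    {Q : Fin N → List (Fin N × Fin N) → Prop}
    (hA : ∀ p : ClosedPath N L, A p ↔ Q (p.1 0) (List.ofFn p.steps)) :
    contribution P (fun ω => deformed θ (W ω)) L A =
      ∑ x, walkSum L fun l => if ((start x).run l).cur = x ∧ Q x (dirSteps x l) then
        walkExpect θ P W x l else 0 := by
  have h1 : contribution P (fun ω => deformed θ (W ω)) L A =
      ∑ i : Fin (L + 1) → Fin N, if i (Fin.last L) = i 0 ∧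
        Q (i 0) (List.ofFn fun t : Fin L => (i t.castSucc, i t.succ)) then
        ∫ ω, ∏ t : Fin L, deformed θ (W ω) (i t.castSucc) (i t.succ) ∂P else 0 := by
    rw [contribution, Finset.sum_filter]
    have e1 : ∀ i : Fin (L + 1) → Fin N, (if i (Fin.last L) = i 0 ∧
        Q (i 0) (List.ofFn fun t : Fin L => (i t.castSucc, i t.succ)) then
        ∫ ω, ∏ t : Fin L, deformed θ (W ω) (i t.castSucc) (i t.succ) ∂P else 0) =
        if i (Fin.last L) = i 0 then (if
        Q (i 0) (List.ofFn fun t : Fin L => (i t.castSucc, i t.succ)) then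
        ∫ ω, ∏ t : Fin L, deformed θ (W ω) (i t.castSucc) (i t.succ) ∂P else 0) else 0 := by
      intro i; rw [← ite_and]
    have e2 := Finset.sum_subtype (F := inferInstance)
      (p := fun i : Fin (L + 1) → Fin N => i (Fin.last L) = i 0)
      (Finset.univ.filter fun i : Fin (L + 1) → Fin N => i (Fin.last L) = i 0)
      (fun i => by simp) fun i => if Q (i 0) (List.ofFn fun t : Fin L => (i t.castSucc, i t.succ))
        then ∫ ω, ∏ t : Fin L, deformed θ (W ω) (i t.castSucc) (i t.succ) ∂P else 0
    rw [Finset.sum_filter] at e2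
    rw [Finset.sum_congr rfl fun i _ => e1 i, e2]
    exact Finset.sum_congr rfl fun p _ => if_congr (hA p) rfl rfl
  rw [h1, ← (Fin.consEquiv fun _ => Fin N).sum_comp, Fintype.sum_prod_type]
  refine Finset.sum_congr rfl fun x _ => ?_
  rw [walkSum_eq_sum, ← (Equiv.arrowProdEquivProdArrow (Fin L) (fun _ => Bool)
    (fun _ => Fin N)).symm.sum_comp, Fintype.sum_prod_type_right]
  refine Finset.sum_congr rfl fun y _ => ?_
  simp only [Fin.consEquiv, Equiv.coe_fn_mk, Fin.cons_succ, Fin.cons_zero]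
  rw [h.integral_prod_deformed]
  have e3 : ∀ c : Fin L → Bool, ((start x).run (List.ofFn fun t => (c t, y t))).cur
      = (Fin.cons x y : Fin (L + 1) → Fin N) (Fin.last L) := fun c => run_ofFn_cur x _
  have e4 : ∀ c : Fin L → Bool, dirSteps x (List.ofFn fun t => (c t, y t))
      = List.ofFn fun t : Fin L => ((Fin.cons x y : Fin (L + 1) → Fin N) t.castSucc, y t) :=
    fun c => dirSteps_ofFn x _
  by_cases hc : (Fin.cons x y : Fin (L + 1) → Fin N) (Fin.last L) = x ∧
      Q x (List.ofFn fun t : Fin L => ((Fin.cons x y : Fin (L + 1) → Fin N) t.castSucc, y t))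
  · rw [if_pos hc]
    refine Finset.sum_congr rfl fun c _ => ?_
    have hc' := hc
    rw [← e3 c, ← e4 c] at hc'
    exact (if_pos hc').symm
  · rw [if_neg hc]
    refine (Finset.sum_eq_zero fun c _ => ?_).symm
    have hc' := hc
    rw [← e3 c, ← e4 c] at hc'
    exact if_neg hc'

end expansion

end DeformedWigner

/-! ### Comparison of a contribution with the main sum. -/

namespace DeformedWigner

variable {σ θ : ℝ} {N : ℕ}

open WalkState

theorem walkSum_sub {α : Type*} [Fintype α] (n : ℕ) (φ ψ : List α → ℂ) :
    walkSum n (fun l => φ l - ψ l) = walkSum n φ - walkSum n ψ := by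
  simp [walkSum_eq_sum, Finset.sum_sub_distrib]

theorem norm_walkSum_le {α : Type*} [Fintype α] {n : ℕ} {φ : List α → ℂ} {ψ : List α → ℝ}
    (h : ∀ l, l.length = n → ‖φ l‖ ≤ ψ l) : ‖walkSum n φ‖ ≤ walkSum n ψ := by
  rw [walkSum_eq_sum, walkSum_eq_sum]
  exact norm_sum_le_of_le _ fun f _ => h _ (by simp)

theorem ofReal_walkSum {α : Type*} [Fintype α] (n : ℕ) (φ : List α → ℝ) :
    ((walkSum n φ : ℝ) : ℂ) = walkSum n fun l => (φ l : ℂ) := by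
  simp [walkSum_eq_sum]

theorem walkSum_mul_left_complex {α : Type*} [Fintype α] (n : ℕ) (c : ℂ) (φ : List α → ℂ) :
    walkSum n (fun l => c * φ l) = c * walkSum n φ := by
  simp [walkSum_eq_sum, Finset.mul_sum]

/-- Total weight of the regular closed walks of length `n` from `x` with exactly one jump. -/
noncomputable def oneJumpSum (σ θ B : ℝ) (n : ℕ) (x : Fin N) : ℝ :=
  walkSum n fun l => if ((start x).run l).opn = ∅ ∧ ((start x).run l).flags = 0 ∧ numJump l = 1 then
    listWeight σ θ B (start x) l else 0

/-- The weight depends on `θ` only through one factor per jump, so for a single jump a change of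
parameter costs the ratio `θ/θ'`. -/
theorem oneJumpSum_le {θ' B : ℝ} (hθ : 0 ≤ θ) (hθ' : 0 < θ') (hB : 0 ≤ B) (n : ℕ) (x : Fin N) :
    oneJumpSum σ θ B n x ≤ θ / θ' * regularSum σ θ' B n (start x) := by
  unfold oneJumpSum regularSum
  rw [← walkSum_mul_left]
  refine walkSum_mono fun l _ => ?_
  have h0 := listWeight_nonneg (σ := σ) hθ'.le hB (start x) l
  by_cases h : ((start x).run l).opn = ∅ ∧ ((start x).run l).flags = 0 ∧ numJump l = 1
  · rw [if_pos h, if_pos ⟨h.1, h.2.1⟩, listWeight_start, listWeight_start, h.2.2, pow_one, pow_one]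
    refine le_of_eq ?_
    field_simp
  · rw [if_neg h]
    split_ifs <;> positivity

section classes

variable {Ω : Type*} [MeasurableSpace Ω] {P : Measure Ω}
  {W : Ω → Matrix (Fin N) (Fin N) ℂ} {b B : ℝ}

/-- Rotation only permutes commuting entries, and the dropped jump accounts for `θ/N`. -/
theorem walkExpect_rotate (x : Fin N) (l₁ l₂ : List (Bool × Fin N)) :
    walkExpect θ P W ((start x).run l₁).cur (l₂ ++ (false, x) :: l₁)
      = ((θ / N : ℝ) : ℂ) * walkExpect θ P W x (l₁ ++ l₂) := by
  have h1 : matrixSteps ((start x).run l₁).cur (l₂ ++ (false, x) :: l₁)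
      = matrixSteps ((start x).run l₁).cur l₂ ++ matrixSteps x l₁ := by
    rw [matrixSteps_append _ ((start x).run l₁) rfl]; simp [matrixSteps]
  have h2 : matrixSteps x (l₁ ++ l₂)
      = matrixSteps x l₁ ++ matrixSteps ((start x).run l₁).cur l₂ :=
    matrixSteps_append x (start x) rfl _ _
  have h3 : numJump (l₂ ++ (false, x) :: l₁) = numJump (l₁ ++ l₂) + 1 := by
    simp [numJump]; omega
  have h4 : expect P W (matrixSteps ((start x).run l₁).cur l₂ ++ matrixSteps x l₁)
      = expect P W (matrixSteps x l₁ ++ matrixSteps ((start x).run l₁).cur l₂) := by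
    unfold expect
    simp only [List.map_append, List.prod_append, mul_comm]
  unfold walkExpect
  rw [h1, h2, h3, h4]
  simp only [List.length_append]
  push_cast
  ring

open Classical in
theorem sum_start_rotate (Q : Fin N → List (Fin N × Fin N) → Prop) (x : Fin N)
    (l₁ l₂ : List (Bool × Fin N)) :
    (∑ x₀, if ((start x₀).run (l₂ ++ (false, x) :: l₁)).cur = x₀ ∧
        Q x₀ (dirSteps x₀ (l₂ ++ (false, x) :: l₁)) then
        walkExpect θ P W x₀ (l₂ ++ (false, x) :: l₁) else 0) =
      if Q ((start x).run l₁).cur (dirSteps ((start x).run l₁).cur (l₂ ++ (false, x) :: l₁)) then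
        ((θ / N : ℝ) : ℂ) * walkExpect θ P W x (l₁ ++ l₂) else 0 := by
  have h : ∀ x₀, ((start x₀).run (l₂ ++ (false, x) :: l₁)).cur = ((start x).run l₁).cur := by
    intro x₀
    rw [run_append, run_cons]
    exact run_cur_eq (step_cur _ _) _
  rw [Finset.sum_eq_single ((start x).run l₁).cur]
  · rw [h, walkExpect_rotate]
    simp
  · intro x₀ _ hx
    rw [if_neg]
    rw [h]
    exact fun h' => hx h'.1.symm
  · simp

open Classical in
-- On closed regular walks with a number of jumps other than one, both terms agree: if the initial
-- part is closed the path is simple with a marked origin, so `Q` is `α`; otherwise `Q` fails. All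
-- other walks go into the error terms.
theorem WignerLike.norm_rotate_sub_le [IsProbabilityMeasure P] (h : WignerLike σ b P W) (hb : 0 ≤ b)
    (hθ : 0 ≤ θ) (hB1 : b * Real.exp 1 ≤ B) (hB2 : (b * Real.exp 1) ^ 2 ≤ σ ^ 2 * B)
    {Q : Fin N → List (Fin N × Fin N) → Prop} {α : Prop}
    (hQ1 : ∀ x D, Q x D → ReachesMarked x D)
    (hQ2 : ∀ x D, ReachesMarked x D → SimpleSteps D → (Q x D ↔ α)) (j : ℕ) (x : Fin N)
    (f : List (Bool × Fin N)) :
    ‖(if StartsWith j f ∧ Q ((start x).run (f.take j)).cur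
        (dirSteps ((start x).run (f.take j)).cur (f.drop j ++ (false, x) :: f.take j)) then
        walkExpect θ P W x f else 0) -
      (if α then 1 else 0 : ℂ) * ((if StartsWith j f ∧ ((start x).run (f.take j)).opn = ∅ ∧
        ((start x).run f).opn = ∅ ∧ ((start x).run f).flags = 0 then
        listWeight σ θ B (start x) f else 0 : ℝ) : ℂ)‖ ≤
      (if StartsWith j f ∧ ((start x).run f).opn = ∅ ∧ 1 ≤ ((start x).run f).flags then
        listWeight σ θ B (start x) f else 0) +
      if ((start x).run f).opn = ∅ ∧ ((start x).run f).flags = 0 ∧ numJump f = 1 then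
        listWeight σ θ B (start x) f else 0 := by
  have hB0 : 0 ≤ B := le_trans (by positivity) hB1
  have hw := listWeight_nonneg (σ := σ) hθ hB0 (start x) f
  by_cases hS : StartsWith j f
  swap
  · simp only [hS, false_and, if_false, Complex.ofReal_zero, mul_zero, sub_zero, norm_zero, zero_add]
    split_ifs <;> positivity
  by_cases ho : ((start x).run f).opn = ∅
  swap
  · rw [h.walkExpect_eq_zero ho]
    simp [ho]
  by_cases hf : ((start x).run f).flags = 0
  swap
  · have hf1 : 1 ≤ ((start x).run f).flags := by omega
    have hn := h.norm_walkExpect_le hb hθ hB1 hB2 x f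
    rw [if_pos ho] at hn
    simp only [hS, ho, hf, hf1, true_and, and_false, if_false, false_and, Complex.ofReal_zero,
      mul_zero, sub_zero, and_self, if_true, add_zero]
    split_ifs
    · exact hn
    · rw [norm_zero]; exact hw
  rw [h.walkExpect_eq_listWeight (B := B) hf ho]
  have hft : f.take j ++ f.drop j = f := List.take_append_drop j f
  by_cases hj : numJump f = 1
  -- Both terms are zero or the weight of the walk, so the one-jump error covers their difference
  -- whatever `Q` says.
  · simp only [hS, ho, hf, hj, true_and, and_self, and_true, if_true]
    have hl : ‖(listWeight σ θ B (start x) f : ℂ)‖ ≤ listWeight σ θ B (start x) f := by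
      rw [Complex.norm_real, Real.norm_of_nonneg hw]
    have : (if 1 ≤ 0 then listWeight σ θ B (start x) f else 0) = 0 := by simp
    rw [this, zero_add]
    split_ifs <;> simp [hw, abs_of_nonneg hw]
  · have hf' := hf
    have ho' := ho
    have hj' := hj
    rw [← hft] at hf' ho' hj'
    by_cases ho1 : ((start x).run (f.take j)).opn = ∅
    · have hQ := hQ2 _ _ (reachesMarked_rotate hf' ho' hj' hS ho1)
        (simpleSteps_rotate hf' ho' hj' hS ho1)
      simp only [hS, ho, hf, hj, ho1, hQ, true_and, and_self, if_true]
      split_ifs <;> simp at *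
    · have hQ : ¬ Q ((start x).run (f.take j)).cur
          (dirSteps ((start x).run (f.take j)).cur (f.drop j ++ (false, x) :: f.take j)) :=
        fun hq => not_reachesMarked_rotate hf' ho' hj' hS ho1 (hQ1 _ _ hq)
      simp [hQ, ho1, hf, hj]

open Classical in
/-- Comparison of a contribution with the main sum. -/
theorem WignerLike.norm_contribution_sub_le [IsProbabilityMeasure P] (h : WignerLike σ b P W)
    (hb : 0 ≤ b) (hθ : 0 ≤ θ) (hB1 : b * Real.exp 1 ≤ B) (hB2 : (b * Real.exp 1) ^ 2 ≤ σ ^ 2 * B)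
    {Q : Fin N → List (Fin N × Fin N) → Prop} {α : Prop}
    (hQ1 : ∀ x D, Q x D → ReachesMarked x D)
    (hQ2 : ∀ x D, ReachesMarked x D → SimpleSteps D → (Q x D ↔ α)) {n : ℕ}
    {A : ClosedPath N (n + 1) → Prop}
    (hA : ∀ p : ClosedPath N (n + 1), A p ↔ Q (p.1 0) (List.ofFn p.steps)) :
    ‖contribution P (fun ω => deformed θ (W ω)) (n + 1) A - (if α then 1 else 0 : ℂ) *
        ((∑ j ∈ Finset.range (n + 1), ∑ x : Fin N, θ / N * splitSum σ θ B n j (start x) : ℝ) : ℂ)‖ ≤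
      ∑ x : Fin N, irregularSum σ θ B (n + 1) (n + 1) (start x) +
        ∑ j ∈ Finset.range (n + 1), ∑ x : Fin N, θ / N *
          (irregularSum σ θ B n j (start x) + oneJumpSum σ θ B n x) := by
  have hB0 : 0 ≤ B := le_trans (by positivity) hB1
  rw [h.contribution_eq hA, Finset.sum_congr rfl fun x _ => walkSum_rotate _ _,
    Finset.sum_add_distrib, Finset.sum_comm (t := Finset.range (n + 1)), Nat.add_sub_cancel,
    add_sub_assoc]
  refine (norm_add_le _ _).trans (add_le_add ?_ ?_)
  · refine norm_sum_le_of_le _ fun x _ => norm_walkSum_le fun l hl => ?_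
    have hw := listWeight_nonneg (σ := σ) hθ hB0 (start x) l
    have hn := h.norm_walkExpect_le hb hθ hB1 hB2 x l
    by_cases hc : StartsWith (n + 1) l ∧ ((start x).run l).cur = x ∧ Q x (dirSteps x l)
    · rw [if_pos hc.1, if_pos hc.2]
      -- A regular walk never makes a marked step back to its start, so only irregular walks remain
      -- among those without jumps.
      have hf : 1 ≤ ((start x).run l).flags := by
        by_contra hf
        exact not_reachesMarked_of_regular (by omega) (hQ1 _ _ hc.2.2)
      simpa [hc.1, hf] using hn
    · rw [← ite_and, if_neg hc, norm_zero]
      split_ifs <;> positivity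
  · have e1 : ∀ j ∈ Finset.range (n + 1), (∑ x₀ : Fin N, walkSum n fun f =>
        if StartsWith j f then ∑ x, (if ((start x₀).run (f.drop j ++ (false, x) :: f.take j)).cur = x₀ ∧
          Q x₀ (dirSteps x₀ (f.drop j ++ (false, x) :: f.take j)) then
          walkExpect θ P W x₀ (f.drop j ++ (false, x) :: f.take j) else 0) else 0) =
        ∑ x : Fin N, ((θ / N : ℝ) : ℂ) * walkSum n fun f => if StartsWith j f ∧
          Q ((start x).run (f.take j)).cur
            (dirSteps ((start x).run (f.take j)).cur (f.drop j ++ (false, x) :: f.take j)) then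
          walkExpect θ P W x f else 0 := by
      intro j _
      rw [← walkSum_finset_sum]
      simp only [← walkSum_mul_left_complex]
      rw [← walkSum_finset_sum]
      refine walkSum_congr fun f _ => ?_
      by_cases hS : StartsWith j f
      · simp only [hS, if_true, true_and]
        rw [Finset.sum_comm]
        refine Finset.sum_congr rfl fun x _ => ?_
        rw [sum_start_rotate, List.take_append_drop, mul_ite, mul_zero]
      · simp [hS]
    rw [Finset.sum_congr rfl e1]
    push_cast
    rw [Finset.mul_sum, ← Finset.sum_sub_distrib]
    refine norm_sum_le_of_le _ fun j _ => ?_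
    rw [Finset.mul_sum, ← Finset.sum_sub_distrib]
    refine norm_sum_le_of_le _ fun x _ => ?_
    rw [mul_left_comm, ← mul_sub, norm_mul]
    have hn : ‖(θ : ℂ) / (N : ℂ)‖ = θ / N := by
      rw [norm_div, Complex.norm_real, Real.norm_of_nonneg hθ, Complex.norm_natCast]
    rw [hn]
    refine mul_le_mul_of_nonneg_left ?_ (by positivity)
    unfold splitSum irregularSum oneJumpSum
    rw [ofReal_walkSum, ← walkSum_mul_left_complex, ← walkSum_sub, ← walkSum_add]
    exact norm_walkSum_le fun f _ => h.norm_rotate_sub_le hb hθ hB1 hB2 hQ1 hQ2 j x f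

end classes

end DeformedWigner

/-! ### Quantitative bounds for the main sum and the errors. -/

namespace DeformedWigner

variable {σ θ : ℝ} {N : ℕ}

open WalkState

theorem inv_one_sub_sub_one_le {y z : ℝ} (hz : z ≤ y) (hy : y ≤ 1 / 2) (h0 : 0 ≤ z) :
    (1 - z)⁻¹ - 1 ≤ 2 * y := by
  have h1 : 0 < 1 - z := by linarith
  have h2 : (1 - z)⁻¹ ≤ 1 + 2 * y := by
    rw [inv_le_comm₀ h1 (by linarith), inv_le_iff_one_le_mul₀ (by linarith)]
    nlinarith
  linarith

/-- Small parameter which controls the irregular walks of length `L`. -/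
noncomputable def errorScale (σ B : ℝ) (N L : ℕ) : ℝ :=
  (9 * B / σ ^ 2 + 6) * (L / √(N : ℝ)) ^ 2 + 9 * (L / √(N : ℝ))

theorem sq_div_sqrt (L : ℕ) : ((L : ℝ) / √(N : ℝ)) ^ 2 = L ^ 2 / N := by
  rw [div_pow, Real.sq_sqrt (Nat.cast_nonneg N)]

theorem mul_rate_le_errorScale {B : ℝ} (hσ : 0 < σ) (hB : 0 ≤ B) {L : ℕ} (hL : 1 ≤ L) :
    L * (3 * B * (2 * L + 1) / (σ ^ 2 * N) + (3 * (L + 1) / N + 9 / √(N : ℝ)))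
      ≤ errorScale σ B N L := by
  have hL' : (1 : ℝ) ≤ L := by exact_mod_cast hL
  rw [errorScale, sq_div_sqrt]
  have h1 : L * (3 * B * (2 * L + 1) / (σ ^ 2 * N)) ≤ 9 * B / σ ^ 2 * (L ^ 2 / N) := by
    have : 9 * B / σ ^ 2 * ((L : ℝ) ^ 2 / N) = L * (3 * B * (3 * L) / (σ ^ 2 * N)) := by
      field_simp; ring
    rw [this]
    gcongr
    linarith
  have h2 : L * (3 * ((L : ℝ) + 1) / N) ≤ 6 * (L ^ 2 / N) := by
    have : 6 * ((L : ℝ) ^ 2 / N) = L * (3 * (L + L) / N) := by ring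
    rw [this]
    gcongr
  have h3 : (L : ℝ) * (9 / √(N : ℝ)) = 9 * (L / √(N : ℝ)) := by ring
  linarith

section bounds

variable {B : ℝ} {n : ℕ}

/-- Without jumps there is no factor `θ/N` to offset the sum over the `N` starting vertices. The
rate `O(L/N)` of irregular matrix steps offsets it, and the growth is only `(2σ)^L`. -/
theorem sum_irregular_matrix_le (hN : 1 ≤ N) (hσ : 0 < σ) (hθ : σ < θ) (hB : σ ^ 2 ≤ B)
    (hy : errorScale σ B N (n + 1) ≤ 1 / 2) :
    ∑ x : Fin N, irregularSum σ θ B (n + 1) (n + 1) (start x)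
      ≤ 18 * B / σ ^ 2 * ((n + 1 : ℕ) ^ 2 * (2 * σ) ^ (n + 1)) := by
  have hB0 : 0 ≤ B := (sq_nonneg σ).trans hB
  have hN' : (0 : ℝ) < N := by exact_mod_cast hN
  set L : ℕ := n + 1 with hLdef
  have hL : 1 ≤ L := by omega
  have hL' : (1 : ℝ) ≤ L := by exact_mod_cast hL
  have hm := mul_rate_le_errorScale (σ := σ) (N := N) hσ hB0 hL
  set q : ℝ := 3 * B * (2 * L + 1) / (σ ^ 2 * N) with hq
  have hq0 : 0 ≤ q := by positivity
  have hr : 0 ≤ 3 * ((L : ℝ) + 1) / N + 9 / √(N : ℝ) := by positivity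
  have hLq : L * q ≤ errorScale σ B N L := by
    refine le_trans ?_ hm
    gcongr
    linarith
  have hb := ballot_le hσ hθ L L 0 le_rfl
  have hb0 := ballot_nonneg (σ := σ) (hσ.le.trans hθ.le) L L 0
  simp only [Nat.sub_self, pow_zero, one_mul, mul_one] at hb
  have key : ∀ x : Fin N, irregularSum σ θ B L L (start x) ≤ (2 * σ) ^ L * (2 * (L * q)) := by
    intro x
    have h1 := irregularSum_start_le (B := B) (q := q) hN hσ (hσ.le.trans hθ.le) hB hq0 L
      (by linarith) le_rfl L L x le_rfl (Or.inl le_rfl)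
    refine h1.trans ?_
    have h2 := inv_one_sub_sub_one_le (le_refl (L * q)) (by linarith) (by positivity)
    have h3 : 0 ≤ (1 - L * q)⁻¹ - 1 := by
      have := one_le_inv_one_sub (n := L) hq0 (by linarith)
      linarith
    gcongr
  refine (Finset.sum_le_sum fun x _ => key x).trans ?_
  rw [Finset.sum_const, Finset.card_univ, Fintype.card_fin, nsmul_eq_mul]
  have e : (N : ℝ) * ((2 * σ) ^ L * (2 * (L * q)))
      = (2 * σ) ^ L * (6 * B / σ ^ 2 * (L * (2 * L + 1))) := by
    rw [hq]; field_simp; ring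
  rw [e]
  calc _ ≤ (2 * σ) ^ L * (6 * B / σ ^ 2 * (L * (2 * L + L))) := by gcongr
    _ = _ := by ring

/-- The first `j` letters grow at rate `2σ < ρ`, so the sum over `j` is geometric and costs only a
constant. -/
theorem sum_geometric_le (hσ : 0 < σ) (hθ : σ < θ) (n : ℕ) :
    ∑ j ∈ Finset.range (n + 1), ballot σ θ n j 0 ≤ rho θ σ ^ n * (1 - 2 * σ / rho θ σ)⁻¹ := by
  have hρ := rho_pos hσ (hσ.trans hθ)
  have hr : 2 * σ / rho θ σ < 1 := (div_lt_one hρ).2 (two_mul_lt_rho hσ hθ)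
  have hr0 : 0 ≤ 2 * σ / rho θ σ := by positivity
  have h1 : ∀ j ∈ Finset.range (n + 1), ballot σ θ n j 0 ≤
      rho θ σ ^ n * (2 * σ / rho θ σ) ^ j := by
    intro j hj
    have hj : j ≤ n := by rw [Finset.mem_range] at hj; omega
    have := ballot_le hσ hθ n j 0 hj
    rw [pow_zero, mul_one] at this
    refine this.trans (le_of_eq ?_)
    rw [div_pow, ← Nat.sub_add_cancel hj, pow_add]
    simp only [Nat.add_sub_cancel]
    field_simp
  refine (Finset.sum_le_sum h1).trans ?_
  rw [← Finset.mul_sum]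
  gcongr
  rw [← tsum_geometric_of_lt_one hr0 hr]
  exact (summable_geometric_of_lt_one hr0 hr).sum_le_tsum _ fun i _ => by positivity

theorem sum_irregular_jump_le (hN : 1 ≤ N) (hσ : 0 < σ) (hθ : σ < θ) (hB : σ ^ 2 ≤ B)
    (hy : errorScale σ B N (n + 1) ≤ 1 / 2) :
    ∑ j ∈ Finset.range (n + 1), ∑ x : Fin N, θ / N * irregularSum σ θ B n j (start x)
      ≤ 2 * θ * (1 - 2 * σ / rho θ σ)⁻¹ * errorScale σ B N (n + 1) * rho θ σ ^ n := by
  have hB0 : 0 ≤ B := (sq_nonneg σ).trans hB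
  have hθ0 : 0 < θ := hσ.trans hθ
  have hN' : (0 : ℝ) < N := by exact_mod_cast hN
  have hm := mul_rate_le_errorScale (σ := σ) (N := N) hσ hB0 (Nat.le_add_left 1 n)
  set y := errorScale σ B N (n + 1) with hydef
  set q : ℝ := 3 * B * (2 * (n + 1 : ℕ) + 1) / (σ ^ 2 * N) +
    (3 * ((n + 1 : ℕ) + 1) / N + 9 / √(N : ℝ)) with hq
  have hr : 0 ≤ 3 * (((n + 1 : ℕ) : ℝ) + 1) / N + 9 / √(N : ℝ) := by positivity
  have hq0 : 0 ≤ q := by positivity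
  have hy0 : 0 ≤ y := le_trans (by positivity) hm
  have key : ∀ j x, irregularSum σ θ B n j (start (x : Fin N)) ≤ ballot σ θ n j 0 * (2 * y) := by
    intro j x
    have h1 := irregularSum_start_le (B := B) (q := q) hN hσ hθ0.le hB hq0 (n + 1)
      (by linarith) (by rw [hq]; linarith) n j x (by omega) (Or.inr le_rfl)
    refine h1.trans ?_
    have hnq : (n : ℝ) * q ≤ y := by
      refine le_trans ?_ hm
      gcongr
      exact Nat.le_succ n
    have h2 := inv_one_sub_sub_one_le hnq hy (by positivity)
    have := ballot_nonneg (σ := σ) hθ0.le n j 0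
    gcongr
  have h3 : ∀ j ∈ Finset.range (n + 1), ∑ x : Fin N, θ / N * irregularSum σ θ B n j (start x)
      ≤ θ * (ballot σ θ n j 0 * (2 * y)) := by
    intro j _
    refine (Finset.sum_le_sum fun x _ =>
      mul_le_mul_of_nonneg_left (key j x) (by positivity)).trans ?_
    rw [Finset.sum_const, Finset.card_univ, Fintype.card_fin, nsmul_eq_mul]
    refine le_of_eq ?_
    field_simp
  refine (Finset.sum_le_sum h3).trans ?_
  rw [← Finset.mul_sum, ← Finset.sum_mul]
  calc _ ≤ θ * ((rho θ σ ^ n * (1 - 2 * σ / rho θ σ)⁻¹) * (2 * y)) := by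
        gcongr
        exact sum_geometric_le hσ hθ n
    _ = _ := by ring

theorem add_two_div_le (hN : 1 ≤ N) (hσ : 0 < σ) (hB : 0 ≤ B) :
    (((n + 1 : ℕ) : ℝ) + 1) * (n + 1 : ℕ) / N ≤ errorScale σ B N (n + 1) := by
  have hN' : (0 : ℝ) < N := by exact_mod_cast hN
  have hm := mul_rate_le_errorScale (σ := σ) (N := N) hσ hB (Nat.le_add_left 1 n)
  refine le_trans ?_ hm
  have h1 : 0 ≤ 3 * B * (2 * ((n + 1 : ℕ) : ℝ) + 1) / (σ ^ 2 * N) := by positivity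
  have h2 : 0 ≤ 9 / √(N : ℝ) := by positivity
  have h3 : (((n + 1 : ℕ) : ℝ) + 1) * (n + 1 : ℕ) / N
      = (n + 1 : ℕ) * ((((n + 1 : ℕ) : ℝ) + 1) / N) := by ring
  rw [h3]
  gcongr
  have h4 : 0 ≤ ((((n + 1 : ℕ) : ℝ) + 1) / N) := by positivity
  have h5 : 3 * (((n + 1 : ℕ) : ℝ) + 1) / N = 3 * ((((n + 1 : ℕ) : ℝ) + 1) / N) := by ring
  rw [h5]
  linarith

theorem one_sub_nonneg (hN : 1 ≤ N) (hσ : 0 < σ) (hB : 0 ≤ B)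
    (hy : errorScale σ B N (n + 1) ≤ 1 / 2) : 0 ≤ 1 - (((n + 1 : ℕ) : ℝ) + 1) / N := by
  have h1 := add_two_div_le (n := n) hN hσ hB
  have h2 : (((n + 1 : ℕ) : ℝ) + 1) / N ≤ (((n + 1 : ℕ) : ℝ) + 1) * (n + 1 : ℕ) / N := by
    gcongr
    refine le_mul_of_one_le_right (by positivity) ?_
    exact_mod_cast Nat.le_add_left 1 n
  linarith

theorem sum_oneJump_le {θ' : ℝ} (hN : 1 ≤ N) (hσ : 0 < σ) (hθ : σ < θ) (hθ' : σ < θ') (hB : 0 ≤ B)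
    (hy : errorScale σ B N (n + 1) ≤ 1 / 2) :
    ∑ _j ∈ Finset.range (n + 1), ∑ x : Fin N, θ / N * oneJumpSum σ θ B n x
      ≤ θ ^ 2 / θ' * ((n + 1 : ℕ) * rho θ' σ ^ n) := by
  have hN' : (0 : ℝ) < N := by exact_mod_cast hN
  have hθ0 : 0 < θ := hσ.trans hθ
  have hθ'0 : 0 < θ' := hσ.trans hθ'
  have key : ∀ x : Fin N, oneJumpSum σ θ B n x ≤ θ / θ' * rho θ' σ ^ n := by
    intro x
    refine (oneJumpSum_le hθ0.le hθ'0 hB n x).trans ?_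
    have h1 := (regularSum_bounds (σ := σ) (θ := θ') (B := B) hN hθ'0.le (T := n + 1)
      (one_sub_nonneg hN hσ hB hy) n (stack_start x) (consistent_start x) rfl (by omega)).2
    have h2 := ballot_le hσ hθ' n 0 0 (Nat.zero_le n)
    have h3 : (start x).opn.card = 0 := rfl
    rw [h3] at h1
    simp only [Nat.sub_zero, pow_zero, mul_one] at h2
    gcongr
    exact h1.trans h2
  refine (Finset.sum_le_sum fun _ _ => Finset.sum_le_sum fun x _ =>
    mul_le_mul_of_nonneg_left (key x) (by positivity)).trans ?_
  rw [Finset.sum_const, Finset.sum_const, Finset.card_univ, Fintype.card_fin, Finset.card_range,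
    nsmul_eq_mul, nsmul_eq_mul]
  refine le_of_eq ?_
  field_simp

/-- The sum over `j` reassembles the ballot words of length `n + 1` with at least one level step.
The words without level step and the remainder of `ballot_asymptotic` account for `3 (2σ)^(n+1)`. -/
theorem main_sum_bound (hN : 1 ≤ N) (hσ : 0 < σ) (hθ : σ < θ) (hB : 0 ≤ B)
    (hy : errorScale σ B N (n + 1) ≤ 1 / 2) :
    |∑ j ∈ Finset.range (n + 1), ∑ x : Fin N, θ / N * splitSum σ θ B n j (start x)
        - (1 - σ ^ 2 / θ ^ 2) * rho θ σ ^ (n + 1)|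
      ≤ errorScale σ B N (n + 1) * rho θ σ ^ (n + 1) + 3 * (2 * σ) ^ (n + 1) := by
  have hN' : (0 : ℝ) < N := by exact_mod_cast hN
  have hθ0 : 0 < θ := hσ.trans hθ
  have hρ := rho_pos hσ hθ0
  have hκ := one_sub_nonneg (n := n) hN hσ hB hy
  have hb1 : ∀ j, 0 ≤ θ * (ballot σ θ j j 0 * ballot σ θ (n - j) 0 0) := fun j =>
    mul_nonneg hθ0.le (mul_nonneg (ballot_nonneg hθ0.le _ _ _) (ballot_nonneg hθ0.le _ _ _))
  have hS : ∑ j ∈ Finset.range (n + 1), θ * (ballot σ θ j j 0 * ballot σ θ (n - j) 0 0)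
      = ballot σ θ (n + 1) 0 0 - ballot σ θ (n + 1) (n + 1) 0 := by
    rw [ballot_last_level (n + 1) 0, add_sub_cancel_left]
    refine Finset.sum_congr rfl fun j _ => ?_
    rw [Nat.add_sub_cancel]; ring
  have hB1 : ballot σ θ (n + 1) 0 0 ≤ rho θ σ ^ (n + 1) := by
    simpa using ballot_le hσ hθ (n + 1) 0 0 (Nat.zero_le _)
  have hB2 : ballot σ θ (n + 1) (n + 1) 0 ≤ (2 * σ) ^ (n + 1) := by
    simpa using ballot_le hσ hθ (n + 1) (n + 1) 0 le_rfl
  have hB3 := ballot_nonneg (σ := σ) hθ0.le (n + 1) (n + 1) 0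
  have hasy := abs_le.1 (ballot_asymptotic hσ hθ (n + 1))
  have hsum : ∀ j ∈ Finset.range (n + 1),
      (1 - (((n + 1 : ℕ) : ℝ) + 1) / N) ^ n * (θ * (ballot σ θ j j 0 * ballot σ θ (n - j) 0 0))
        ≤ ∑ x : Fin N, θ / N * splitSum σ θ B n j (start x) ∧
      ∑ x : Fin N, θ / N * splitSum σ θ B n j (start x)
        ≤ θ * (ballot σ θ j j 0 * ballot σ θ (n - j) 0 0) := by
    intro j hj
    have hj : j ≤ n := by rw [Finset.mem_range] at hj; omega
    have h1 := fun x : Fin N => splitSum_bounds (σ := σ) (θ := θ) (B := B) hN hθ0.le (T := n + 1)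
      hκ n j hj (stack_start x) (consistent_start x) rfl (by omega)
    have h3 : ∀ x : Fin N, (start x).opn.card = 0 := fun _ => rfl
    simp only [h3] at h1
    have e : ∀ c : ℝ, ∑ x : Fin N, θ / N * c = θ * c := by
      intro c
      rw [Finset.sum_const, Finset.card_univ, Fintype.card_fin, nsmul_eq_mul]
      field_simp
    constructor
    · rw [mul_left_comm, ← e]
      exact Finset.sum_le_sum fun x _ => mul_le_mul_of_nonneg_left (h1 x).1 (by positivity)
    · rw [← e (ballot σ θ j j 0 * ballot σ θ (n - j) 0 0)]
      exact Finset.sum_le_sum fun x _ => mul_le_mul_of_nonneg_left (h1 x).2 (by positivity)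
  have hlow := Finset.sum_le_sum fun j hj => (hsum j hj).1
  have hupp := Finset.sum_le_sum fun j hj => (hsum j hj).2
  rw [← Finset.mul_sum, hS] at hlow
  rw [hS] at hupp
  have hS0 : 0 ≤ ballot σ θ (n + 1) 0 0 - ballot σ θ (n + 1) (n + 1) 0 := by
    rw [← hS]; exact Finset.sum_nonneg fun j _ => hb1 j
  -- Bernoulli: the loss of new vertices over `n` steps is at most `n (n + 2) / N`.
  have hbern : 1 - errorScale σ B N (n + 1) ≤ (1 - (((n + 1 : ℕ) : ℝ) + 1) / N) ^ n := by
    have h1 := one_add_mul_le_pow (a := -((((n + 1 : ℕ) : ℝ) + 1) / N)) (by linarith) n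
    rw [← sub_eq_add_neg] at h1
    refine le_trans ?_ h1
    have h2 := add_two_div_le (n := n) hN hσ hB
    have h3 : (n : ℝ) * ((((n + 1 : ℕ) : ℝ) + 1) / N)
        ≤ (((n + 1 : ℕ) : ℝ) + 1) * (n + 1 : ℕ) / N := by
      rw [mul_div_assoc', mul_comm]
      gcongr
      exact Nat.le_succ n
    linarith
  have hy0 : 0 ≤ errorScale σ B N (n + 1) :=
    le_trans (by positivity) (add_two_div_le (n := n) hN hσ hB)
  set S := ballot σ θ (n + 1) 0 0 - ballot σ θ (n + 1) (n + 1) 0 with hSdef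
  set M := ∑ j ∈ Finset.range (n + 1), ∑ x : Fin N, θ / N * splitSum σ θ B n j (start x)
  have h1 : (1 - errorScale σ B N (n + 1)) * S ≤ M :=
    (mul_le_mul_of_nonneg_right hbern hS0).trans hlow
  have h2 : errorScale σ B N (n + 1) * S ≤ errorScale σ B N (n + 1) * rho θ σ ^ (n + 1) := by
    gcongr
    linarith
  have h3 : 0 ≤ errorScale σ B N (n + 1) * rho θ σ ^ (n + 1) := by positivity
  rw [abs_le]
  constructor <;> linarith [hasy.1, hasy.2]

end bounds

end DeformedWigner

/-! ### Passage to the limit. -/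

namespace DeformedWigner

variable {σ θ : ℝ} {N : ℕ}

open WalkState

/-- Relative error of the asymptotics of a contribution. -/
noncomputable def relError (σ θ θ' B : ℝ) (N L : ℕ) : ℝ :=
  18 * B / σ ^ 2 * (L ^ 2 * (2 * σ / rho θ σ) ^ L) +
    (2 * θ * (1 - 2 * σ / rho θ σ)⁻¹ / rho θ σ + 1) * errorScale σ B N L +
    θ ^ 2 / θ' / rho θ' σ * (L * (rho θ' σ / rho θ σ) ^ L) + 3 * (2 * σ / rho θ σ) ^ L

open Classical in
theorem WignerLike.norm_contribution_error {Ω : Type*} [MeasurableSpace Ω] {P : Measure Ω}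
    [IsProbabilityMeasure P] {W : Ω → Matrix (Fin N) (Fin N) ℂ} {b B θ' : ℝ}
    (h : WignerLike σ b P W) (hN : 1 ≤ N) (hσ : 0 < σ) (hθ : σ < θ) (hθ' : σ < θ')
    (hb : 0 ≤ b) (hB : σ ^ 2 ≤ B) (hB1 : b * Real.exp 1 ≤ B)
    (hB2 : (b * Real.exp 1) ^ 2 ≤ σ ^ 2 * B)
    {Q : Fin N → List (Fin N × Fin N) → Prop} {α : Prop}
    (hQ1 : ∀ x D, Q x D → ReachesMarked x D)
    (hQ2 : ∀ x D, ReachesMarked x D → SimpleSteps D → (Q x D ↔ α)) {L : ℕ} (hL : 1 ≤ L)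
    (hy : errorScale σ B N L ≤ 1 / 2) {A : ClosedPath N L → Prop}
    (hA : ∀ p : ClosedPath N L, A p ↔ Q (p.1 0) (List.ofFn p.steps)) :
    ‖contribution P (fun ω => deformed θ (W ω)) L A - (if α then 1 else 0 : ℂ) *
        ((rho θ σ ^ L * (1 - σ ^ 2 / θ ^ 2) : ℝ) : ℂ)‖ ≤ relError σ θ θ' B N L * rho θ σ ^ L := by
  obtain ⟨n, rfl⟩ : ∃ n, L = n + 1 := ⟨L - 1, by omega⟩
  have hB0 : 0 ≤ B := (sq_nonneg σ).trans hB
  have hθ0 : 0 < θ := hσ.trans hθ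
  have hρ := rho_pos hσ hθ0
  have hρ' := rho_pos hσ (hσ.trans hθ')
  have h1 := h.norm_contribution_sub_le hb hθ0.le hB1 hB2 hQ1 hQ2 hA
  have h2 := sum_irregular_matrix_le (n := n) hN hσ hθ hB hy
  have h3 := sum_irregular_jump_le (n := n) hN hσ hθ hB hy
  have h4 := sum_oneJump_le (n := n) hN hσ hθ hθ' hB0 hy
  have h5 := main_sum_bound (n := n) hN hσ hθ hB0 hy
  simp only [mul_add, Finset.sum_add_distrib] at h1
  set M := ∑ j ∈ Finset.range (n + 1), ∑ x : Fin N, θ / N * splitSum σ θ B n j (start x) with hM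
  have h6 : ‖(if α then 1 else 0 : ℂ) * (M : ℂ) - (if α then 1 else 0 : ℂ) *
      ((rho θ σ ^ (n + 1) * (1 - σ ^ 2 / θ ^ 2) : ℝ) : ℂ)‖ ≤
      errorScale σ B N (n + 1) * rho θ σ ^ (n + 1) + 3 * (2 * σ) ^ (n + 1) := by
    rw [← mul_sub, norm_mul, ← Complex.ofReal_sub, Complex.norm_real, Real.norm_eq_abs,
      mul_comm (rho θ σ ^ (n + 1))]
    refine le_trans (mul_le_of_le_one_left (abs_nonneg _) ?_) h5
    split_ifs <;> simp
  have h7 := norm_sub_le_norm_sub_add_norm_sub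
    (contribution P (fun ω => deformed θ (W ω)) (n + 1) A) ((if α then 1 else 0 : ℂ) * (M : ℂ))
    ((if α then 1 else 0 : ℂ) * ((rho θ σ ^ (n + 1) * (1 - σ ^ 2 / θ ^ 2) : ℝ) : ℂ))
  have e : relError σ θ θ' B N (n + 1) * rho θ σ ^ (n + 1) =
      18 * B / σ ^ 2 * ((n + 1 : ℕ) ^ 2 * (2 * σ) ^ (n + 1)) +
      2 * θ * (1 - 2 * σ / rho θ σ)⁻¹ * errorScale σ B N (n + 1) * rho θ σ ^ n +
      θ ^ 2 / θ' * ((n + 1 : ℕ) * rho θ' σ ^ n) +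
      (errorScale σ B N (n + 1) * rho θ σ ^ (n + 1) + 3 * (2 * σ) ^ (n + 1)) := by
    have a1 : (2 * σ / rho θ σ) ^ (n + 1) * rho θ σ ^ (n + 1) = (2 * σ) ^ (n + 1) := by
      rw [← mul_pow, div_mul_cancel₀ _ hρ.ne']
    have a2 : (rho θ' σ / rho θ σ) ^ (n + 1) * rho θ σ ^ (n + 1) = rho θ' σ * rho θ' σ ^ n := by
      rw [← mul_pow, div_mul_cancel₀ _ hρ.ne', pow_succ']
    have a3 : (rho θ σ)⁻¹ * rho θ σ ^ (n + 1) = rho θ σ ^ n := by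
      rw [pow_succ', inv_mul_cancel_left₀ hρ.ne']
    have a4 : (rho θ' σ)⁻¹ * rho θ' σ = 1 := inv_mul_cancel₀ hρ'.ne'
    unfold relError
    rw [← a1]
    generalize (1 - 2 * σ / rho θ σ)⁻¹ = z
    generalize (2 * σ / rho θ σ) ^ (n + 1) = u at *
    generalize hv : (rho θ' σ / rho θ σ) ^ (n + 1) = v at *
    calc _ = 18 * B / σ ^ 2 * ((n + 1 : ℕ) ^ 2 * (u * rho θ σ ^ (n + 1))) +
          2 * θ * z * errorScale σ B N (n + 1) * ((rho θ σ)⁻¹ * rho θ σ ^ (n + 1)) +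
          θ ^ 2 / θ' * ((n + 1 : ℕ) * ((rho θ' σ)⁻¹ * (v * rho θ σ ^ (n + 1)))) +
          (errorScale σ B N (n + 1) * rho θ σ ^ (n + 1) + 3 * (u * rho θ σ ^ (n + 1))) := by
            ring
      _ = _ := by rw [a2, a3, ← mul_assoc (rho θ' σ)⁻¹, a4, one_mul]
  rw [e]
  linarith

theorem rho_lt_rho {θ' : ℝ} (hσ : 0 < σ) (h1 : σ < θ') (h2 : θ' < θ) : rho θ' σ < rho θ σ := by
  have h3 : 0 < θ' := hσ.trans h1
  have h4 : 0 < θ := h3.trans h2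
  have : rho θ σ - rho θ' σ = (θ - θ') * (θ * θ' - σ ^ 2) / (θ * θ') := by
    unfold rho; field_simp; ring
  have h5 : 0 < (θ - θ') * (θ * θ' - σ ^ 2) / (θ * θ') := by
    have : σ ^ 2 < θ * θ' := by nlinarith
    have h6 : 0 < θ - θ' := by linarith
    have h7 : 0 < θ * θ' - σ ^ 2 := by linarith
    positivity
  linarith

theorem tendsto_relError {θ' B : ℝ} (hσ : 0 < σ) (h1 : σ < θ') (h2 : θ' < θ) {L : ℕ → ℕ}
    (hL : Tendsto L atTop atTop)
    (hLN : Tendsto (fun N => (L N : ℝ) / √(N : ℝ)) atTop (𝓝 0)) :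
    Tendsto (fun N => errorScale σ B N (L N)) atTop (𝓝 0) ∧
      Tendsto (fun N => relError σ θ θ' B N (L N)) atTop (𝓝 0) := by
  have hρ := rho_pos hσ (hσ.trans (h1.trans h2))
  have hρ' := rho_pos hσ (hσ.trans h1)
  have he : Tendsto (fun N => errorScale σ B N (L N)) atTop (𝓝 0) := by
    have := ((hLN.pow 2).const_mul (9 * B / σ ^ 2 + 6)).add (hLN.const_mul 9)
    simpa [errorScale] using this
  refine ⟨he, ?_⟩
  have hr : |2 * σ / rho θ σ| < 1 := by
    rw [abs_of_nonneg (by positivity)]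
    exact (div_lt_one hρ).2 (two_mul_lt_rho hσ (h1.trans h2))
  have hr' : |rho θ' σ / rho θ σ| < 1 := by
    rw [abs_of_nonneg (by positivity)]
    exact (div_lt_one hρ).2 (rho_lt_rho hσ h1 h2)
  have t1 := (tendsto_pow_const_mul_const_pow_of_abs_lt_one 2 hr).comp hL
  have t2 := (tendsto_pow_const_mul_const_pow_of_abs_lt_one 1 hr').comp hL
  have t3 := (tendsto_pow_const_mul_const_pow_of_abs_lt_one 0 hr).comp hL
  have := (((t1.const_mul (18 * B / σ ^ 2)).add
    (he.const_mul (2 * θ * (1 - 2 * σ / rho θ σ)⁻¹ / rho θ σ + 1))).add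
    (t2.const_mul (θ ^ 2 / θ' / rho θ' σ))).add (t3.const_mul 3)
  simpa [relError, Function.comp_def] using this

section limits

variable {Ω : ℕ → Type*} [∀ N, MeasurableSpace (Ω N)] {P : ∀ N, Measure (Ω N)}
  [∀ N, IsProbabilityMeasure (P N)] {W : ∀ N, Ω N → Matrix (Fin N) (Fin N) ℂ}

theorem exists_wignerLike
    (hW : IsComplexWignerEnsemble σ P W ∨ IsRealWignerEnsemble σ P W) :
    ∃ b, 0 ≤ b ∧ ∀ N, WignerLike σ b (P N) (W N) := by
  rcases hW with ⟨K, β, hβ, h⟩ | ⟨K, β, hβ, h⟩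
  · exact ⟨2 * β, by positivity, fun N => (h N).wignerLike⟩
  · exact ⟨2 * β, by positivity, fun N => (h N).wignerLike hβ⟩

open Classical in
/-- Asymptotics of the contribution of a class of paths which is contained in the paths with a
marked origin, and which contains all or none of the simple ones. -/
theorem tendsto_contribution_sub (hσ : 0 < σ) (hθ : σ < θ)
    (hW : IsComplexWignerEnsemble σ P W ∨ IsRealWignerEnsemble σ P W) {L : ℕ → ℕ}
    (hL : Tendsto L atTop atTop) (hLN : Tendsto (fun N => (L N : ℝ) / √(N : ℝ)) atTop (𝓝 0))
    {Q : ∀ N, Fin N → List (Fin N × Fin N) → Prop} {α : Prop}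
    (hQ1 : ∀ N x D, Q N x D → ReachesMarked x D)
    (hQ2 : ∀ N x D, ReachesMarked x D → SimpleSteps D → (Q N x D ↔ α))
    {A : ∀ N, ClosedPath N (L N) → Prop}
    (hA : ∀ N (p : ClosedPath N (L N)), A N p ↔ Q N (p.1 0) (List.ofFn p.steps)) :
    Tendsto (fun N => (contribution (P N) (fun ω => deformed θ (W N ω)) (L N) (A N) -
      (if α then 1 else 0 : ℂ) * ((rho θ σ ^ L N * (1 - σ ^ 2 / θ ^ 2) : ℝ) : ℂ)) /
      ((rho θ σ ^ L N : ℝ) : ℂ)) atTop (𝓝 0) := by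
  obtain ⟨b, hb, hW⟩ := exists_wignerLike hW
  -- Since `ρ` is strictly increasing in the parameter above `σ`, any such `θ'` makes the one-jump
  -- walks exponentially smaller than `ρ_θ^L`.
  obtain ⟨θ', h1, h2⟩ := exists_between hθ
  have hρ := rho_pos hσ (hσ.trans hθ)
  -- One summand for each of the three lower bounds required of `B`.
  set B : ℝ := σ ^ 2 + b * Real.exp 1 + (b * Real.exp 1) ^ 2 / σ ^ 2 with hBdef
  have hbe : 0 ≤ b * Real.exp 1 := by positivity
  have hbs : 0 ≤ (b * Real.exp 1) ^ 2 / σ ^ 2 := by positivity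
  have hs : 0 ≤ σ ^ 2 := sq_nonneg σ
  have hB2 : (b * Real.exp 1) ^ 2 ≤ σ ^ 2 * B := by
    have : σ ^ 2 * B = σ ^ 2 * (σ ^ 2 + b * Real.exp 1) + (b * Real.exp 1) ^ 2 := by
      rw [hBdef]; field_simp
    rw [this]
    have : 0 ≤ σ ^ 2 * (σ ^ 2 + b * Real.exp 1) := by positivity
    linarith
  obtain ⟨t1, t2⟩ := tendsto_relError (B := B) hσ h1 h2 hL hLN
  rw [tendsto_zero_iff_norm_tendsto_zero]
  refine squeeze_zero' (Eventually.of_forall fun N => norm_nonneg _) ?_ t2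
  filter_upwards [t1.eventually_le_const (show (0 : ℝ) < 1 / 2 by norm_num),
    hL.eventually_ge_atTop 1, eventually_ge_atTop 1] with N hy hL1 hN
  rw [norm_div, Complex.norm_real, Real.norm_of_nonneg (by positivity), div_le_iff₀ (by positivity)]
  exact (hW N).norm_contribution_error hN hσ hθ h1 hb (by linarith) (by linarith) hB2 (hQ1 N)
    (hQ2 N) hL1 hy (hA N)

end limits

end DeformedWigner

theorem theorem4p6 {Ω : ℕ → Type*} [∀ N, MeasurableSpace (Ω N)]
    (P : ∀ N, Measure (Ω N)) [∀ N, IsProbabilityMeasure (P N)]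
    (W : ∀ N, Ω N → Matrix (Fin N) (Fin N) ℂ) (σ θ : ℝ) (hσ : 0 < σ) (hθ : σ < θ)
    (hW : DeformedWigner.IsComplexWignerEnsemble σ P W ∨
      DeformedWigner.IsRealWignerEnsemble σ P W)
    (s L : ℕ → ℕ) (hs : Tendsto s atTop atTop)
    (hsN : (fun N => (s N : ℝ)) =o[atTop] fun N => √(N : ℝ))
    (hL : ∀ N, L N = 2 * s N ∨ L N = 2 * s N + 1) :
    -- all paths with a marked origin
    Tendsto (fun N =>
        DeformedWigner.contribution (P N) (fun ω => DeformedWigner.deformed θ (W N ω)) (L N)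
            (fun p => p.MarkedOrigin) /
          ((DeformedWigner.rho θ σ ^ L N * (1 - σ ^ 2 / θ ^ 2) : ℝ) : ℂ))
      atTop (𝓝 1) ∧
    -- simple paths with a marked origin
    Tendsto (fun N =>
        DeformedWigner.contribution (P N) (fun ω => DeformedWigner.deformed θ (W N ω)) (L N)
            (fun p => p.MarkedOrigin ∧ p.IsSimple) /
          ((DeformedWigner.rho θ σ ^ L N * (1 - σ ^ 2 / θ ^ 2) : ℝ) : ℂ))
      atTop (𝓝 1) ∧
    -- non-simple paths with a marked origin
    (fun N =>
        DeformedWigner.contribution (P N) (fun ω => DeformedWigner.deformed θ (W N ω)) (L N)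
          (fun p => p.MarkedOrigin ∧ ¬ p.IsSimple))
      =o[atTop] fun N => DeformedWigner.rho θ σ ^ L N := by
  have hL0 : Tendsto L atTop atTop :=
    tendsto_atTop_mono (fun N => by rcases hL N with h | h <;> omega) hs
  have hLN : Tendsto (fun N => (L N : ℝ) / √(N : ℝ)) atTop (𝓝 0) := by
    -- The factor 3 covers `2 s + 1 ≤ 3 s`, valid once `s ≥ 1`.
    have h1 := (hsN.tendsto_div_nhds_zero).const_mul 3
    rw [mul_zero] at h1
    refine squeeze_zero' (Eventually.of_forall fun N => by positivity) ?_ h1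
    filter_upwards [hs.eventually_ge_atTop 1] with N hN
    rw [mul_div_assoc']
    gcongr
    have : L N ≤ 3 * s N := by rcases hL N with h | h <;> omega
    exact_mod_cast this
  have hθ0 : 0 < θ := hσ.trans hθ
  have hρ := DeformedWigner.rho_pos hσ hθ0
  have hc : 0 < 1 - σ ^ 2 / θ ^ 2 := by
    have : σ ^ 2 / θ ^ 2 < 1 := (div_lt_one (by positivity)).2 (by gcongr)
    linarith
  have key : ∀ {u : ℕ → ℂ}, Tendsto (fun N => (u N - (1 : ℂ) *
      ((DeformedWigner.rho θ σ ^ L N * (1 - σ ^ 2 / θ ^ 2) : ℝ) : ℂ)) /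
      ((DeformedWigner.rho θ σ ^ L N : ℝ) : ℂ)) atTop (𝓝 0) →
      Tendsto (fun N => u N / ((DeformedWigner.rho θ σ ^ L N * (1 - σ ^ 2 / θ ^ 2) : ℝ) : ℂ))
        atTop (𝓝 1) := by
    intro u hu
    have h1 := (hu.div_const ((1 - σ ^ 2 / θ ^ 2 : ℝ) : ℂ)).add_const 1
    rw [zero_div, zero_add] at h1
    refine h1.congr fun N => ?_
    have e1 : ((DeformedWigner.rho θ σ ^ L N : ℝ) : ℂ) ≠ 0 :=
      Complex.ofReal_ne_zero.2 (by positivity)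
    have e2 : ((1 - σ ^ 2 / θ ^ 2 : ℝ) : ℂ) ≠ 0 := Complex.ofReal_ne_zero.2 hc.ne'
    rw [Complex.ofReal_mul]
    generalize ((DeformedWigner.rho θ σ ^ L N : ℝ) : ℂ) = a at e1 ⊢
    generalize ((1 - σ ^ 2 / θ ^ 2 : ℝ) : ℂ) = c at e2 ⊢
    field_simp
    ring
  refine ⟨key ?_, key ?_, ?_⟩
  · have := DeformedWigner.tendsto_contribution_sub (α := True) hσ hθ hW hL0 hLN
      (Q := fun _ => DeformedWigner.ReachesMarked) (fun _ _ _ h => h)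
      (fun _ _ _ h _ => iff_true_intro h) (fun _ p => p.markedOrigin_iff)
    simpa only [if_true] using this
  · have := DeformedWigner.tendsto_contribution_sub (α := True) hσ hθ hW hL0 hLN
      (Q := fun _ x D => DeformedWigner.ReachesMarked x D ∧ DeformedWigner.SimpleSteps D)
      (fun _ _ _ h => h.1) (fun _ _ _ h h' => iff_true_intro ⟨h, h'⟩)
      (fun _ p => and_congr p.markedOrigin_iff p.isSimple_iff)
    simpa only [if_true] using this
  -- This class contains no simple path, so with `α` false the main term drops out and only the
  -- error remains.
  · have := DeformedWigner.tendsto_contribution_sub (α := False) hσ hθ hW hL0 hLN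
      (Q := fun _ x D => DeformedWigner.ReachesMarked x D ∧ ¬ DeformedWigner.SimpleSteps D)
      (fun _ _ _ h => h.1) (fun _ _ _ _ h' => iff_of_false (fun h => h.2 h') id)
      (fun _ p => and_congr p.markedOrigin_iff (not_congr p.isSimple_iff))
    simp only [if_false, zero_mul, sub_zero] at this
    have h2 : (fun N => DeformedWigner.contribution (P N)
        (fun ω => DeformedWigner.deformed θ (W N ω)) (L N)
        (fun p => p.MarkedOrigin ∧ ¬ p.IsSimple)) =o[atTop]
        fun N => ((DeformedWigner.rho θ σ ^ L N : ℝ) : ℂ) := by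
      refine (isLittleO_iff_tendsto fun N hN => ?_).2 this
      exact absurd hN (Complex.ofReal_ne_zero.2 (by positivity))
    refine h2.trans_isBigO (IsBigO.of_norm_le fun N => ?_)
    rw [Complex.norm_real, Real.norm_of_nonneg (by positivity)]
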